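/- Let $G$ be a connected undirected graph with $n\ge 2$ vertices and $m$ edges (parallel edges are allowed), each edge having a non-negative real weight, and let $T$ be a spanning tree of $G$. A cut of $G$ is a partition $(A,B)$ of its vertices into two non-empty sets; its value is the total weight of the edges with one endpoint in $A$ and the other in $B$; and it $2$-respects $T$ if at most two edges of $T$ cross it. There is a deterministic algorithm that, given $G$ (as a list of edges with weights) and $T$ (as a marking of those edges), finds a cut of minimum value among all cuts of $G$ that $2$-respect $T$, together with its value, in $O(m\log^2 n)$ time. Here time is the number of unit-cost operations of a random access machine whose words have $O(\log(n+m))$ bits, and on which weights are real numbers that can only be copied, added, subtracted and compared. The algorithm is one fixed program, and the constant hidden in $O(\cdot)$ is absolute. -/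

import Mathlib

/-! ## Weighted graphs, cuts, spanning trees -/

/-- An undirected graph with vertices `0, …, n-1` and `m` edges (parallel edges are allowed),
each edge carrying a non-negative real weight. -/
structure WGraph (n m : ℕ) where
  /-- one endpoint of an edge -/
  src : Fin m → Fin n
  /-- the other endpoint of an edge -/
  dst : Fin m → Fin n
  /-- the weight of an edge -/
  wt : Fin m → ℝ
  wt_nonneg : ∀ e, 0 ≤ wt e

namespace WGraph

variable {n m : ℕ}

/-- The unordered pair of endpoints of an edge. -/
def ends (G : WGraph n m) (e : Fin m) : Sym2 (Fin n) := s(G.src e, G.dst e)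

/-- `S` is one side of a cut: both `S` and its complement are non-empty. -/
def IsCut (S : Finset (Fin n)) : Prop := S.Nonempty ∧ Sᶜ.Nonempty

/-- The edges with exactly one endpoint in `S`. -/
def crossing (G : WGraph n m) (S : Finset (Fin n)) : Finset (Fin m) :=
  Finset.univ.filter fun e => ¬ (G.src e ∈ S ↔ G.dst e ∈ S)

/-- The value of the cut `(S, Sᶜ)`: the total weight of the edges crossing it. -/
noncomputable def cutValue (G : WGraph n m) (S : Finset (Fin n)) : ℝ :=
  ∑ e ∈ G.crossing S, G.wt e

/-- The edge set `T` is (the edge set of) a spanning tree of `G`: it has no self-loops and no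
two parallel edges, and the simple graph it forms on all the vertices is a tree. -/
def IsSpanningTree (G : WGraph n m) (T : Finset (Fin m)) : Prop :=
  (∀ e ∈ T, G.src e ≠ G.dst e) ∧ Set.InjOn G.ends T ∧
    (SimpleGraph.fromEdgeSet (G.ends '' (T : Set (Fin m)))).IsTree

/-- The cut `(S, Sᶜ)` `k`-respects `T`: at most `k` edges of `T` cross it. -/
def Respects (G : WGraph n m) (k : ℕ) (T : Finset (Fin m)) (S : Finset (Fin n)) : Prop :=
  (T ∩ G.crossing S).card ≤ k

/-- `(S, Sᶜ)` has minimum value among all the cuts of `G` that `k`-respect `T`. -/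
def IsMinRespectingCut (G : WGraph n m) (k : ℕ) (T : Finset (Fin m)) (S : Finset (Fin n)) :
    Prop :=
  IsCut S ∧ G.Respects k T S ∧
    ∀ S', IsCut S' → G.Respects k T S' → G.cutValue S ≤ G.cutValue S'

end WGraph

/-! ## The machine model

A random access machine with unit costs. It has word registers and word arrays (natural numbers
of bounded size, used for indices, pointers, counters), and weight registers and weight arrays
(real numbers). Weights can only be copied, added, subtracted and compared; words are never
computed from weights except by branching on a comparison, and `0` is the only weight constant.
A program is a finite piece of text, so it uses only finitely many registers and arrays. -/

namespace RAM

/-- Word expressions. -/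
inductive WExp where
  | const (k : ℕ)
  | reg (x : ℕ)
  | load (a : ℕ) (i : WExp)
  | add (e f : WExp)
  | sub (e f : WExp)
  | mul (e f : WExp)
  | div (e f : WExp)

/-- Weight expressions. -/
inductive RExp where
  | zero
  | reg (x : ℕ)
  | load (a : ℕ) (i : WExp)
  | add (e f : RExp)
  | sub (e f : RExp)

/-- Tests. -/
inductive Test where
  | wle (e f : WExp)
  | weq (e f : WExp)
  | rle (e f : RExp)
  | not (b : Test)
  | and (b c : Test)

/-- Programs. -/
inductive Prog where
  | skip
  | wset (x : ℕ) (e : WExp)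
  | wstore (a : ℕ) (i e : WExp)
  | rset (x : ℕ) (e : RExp)
  | rstore (a : ℕ) (i : WExp) (e : RExp)
  | seq (p q : Prog)
  | ite (b : Test) (p q : Prog)
  | loop (b : Test) (p : Prog)

/-- Memory contents. -/
structure State where
  /-- word registers -/
  wreg : ℕ → ℕ
  /-- word arrays: `warr a i` is the cell `i` of the array `a` -/
  warr : ℕ → ℕ → ℕ
  /-- weight registers -/
  rreg : ℕ → ℝ
  /-- weight arrays -/
  rarr : ℕ → ℕ → ℝ

/-- The value of a word expression (subtraction is truncated at `0`, division rounds down). -/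
def WExp.eval (s : State) : WExp → ℕ
  | .const k => k
  | .reg x => s.wreg x
  | .load a i => s.warr a (i.eval s)
  | .add e f => e.eval s + f.eval s
  | .sub e f => e.eval s - f.eval s
  | .mul e f => e.eval s * f.eval s
  | .div e f => e.eval s / f.eval s

/-- The number of operations in a word expression. -/
def WExp.cost : WExp → ℕ
  | .const _ => 1
  | .reg _ => 1
  | .load _ i => i.cost + 1
  | .add e f => e.cost + f.cost + 1
  | .sub e f => e.cost + f.cost + 1
  | .mul e f => e.cost + f.cost + 1
  | .div e f => e.cost + f.cost + 1

/-- The value of a weight expression. -/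
noncomputable def RExp.eval (s : State) : RExp → ℝ
  | .zero => 0
  | .reg x => s.rreg x
  | .load a i => s.rarr a (i.eval s)
  | .add e f => e.eval s + f.eval s
  | .sub e f => e.eval s - f.eval s

/-- The number of operations in a weight expression. -/
def RExp.cost : RExp → ℕ
  | .zero => 1
  | .reg _ => 1
  | .load _ i => i.cost + 1
  | .add e f => e.cost + f.cost + 1
  | .sub e f => e.cost + f.cost + 1

/-- The truth value of a test. -/
def Test.Holds (s : State) : Test → Prop
  | .wle e f => e.eval s ≤ f.eval s
  | .weq e f => e.eval s = f.eval s
  | .rle e f => e.eval s ≤ f.eval s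
  | .not b => ¬ b.Holds s
  | .and b c => b.Holds s ∧ c.Holds s

/-- The number of operations in a test. -/
def Test.cost : Test → ℕ
  | .wle e f => e.cost + f.cost + 1
  | .weq e f => e.cost + f.cost + 1
  | .rle e f => e.cost + f.cost + 1
  | .not b => b.cost + 1
  | .and b c => b.cost + c.cost + 1

namespace State

/-- Set the word register `x` to `v`. -/
def setW (s : State) (x v : ℕ) : State :=
  { s with wreg := Function.update s.wreg x v }

/-- Set the cell `i` of the word array `a` to `v`. -/
def storeW (s : State) (a i v : ℕ) : State :=
  { s with warr := Function.update s.warr a (Function.update (s.warr a) i v) }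

/-- Set the weight register `x` to `v`. -/
noncomputable def setR (s : State) (x : ℕ) (v : ℝ) : State :=
  { s with rreg := Function.update s.rreg x v }

/-- Set the cell `i` of the weight array `a` to `v`. -/
noncomputable def storeR (s : State) (a i : ℕ) (v : ℝ) : State :=
  { s with rarr := Function.update s.rarr a (Function.update (s.rarr a) i v) }

end State

/-- `Exec W p s s' t`: on a machine whose words are the numbers `0, …, W`, the program `p`
started in the memory `s` halts in the memory `s'` after `t` elementary operations. There is no
such `s'` if `p` runs forever, or ever stores a word, or writes to an array cell, beyond `W`. -/
inductive Exec (W : ℕ) : Prog → State → State → ℕ → Prop where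
  | skip (s : State) : Exec W .skip s s 1
  | wset {s : State} {x : ℕ} {e : WExp} (he : e.eval s ≤ W) :
      Exec W (.wset x e) s (s.setW x (e.eval s)) (e.cost + 1)
  | wstore {s : State} {a : ℕ} {i e : WExp} (hi : i.eval s ≤ W) (he : e.eval s ≤ W) :
      Exec W (.wstore a i e) s (s.storeW a (i.eval s) (e.eval s)) (i.cost + e.cost + 1)
  | rset {s : State} {x : ℕ} {e : RExp} :
      Exec W (.rset x e) s (s.setR x (e.eval s)) (e.cost + 1)
  | rstore {s : State} {a : ℕ} {i : WExp} {e : RExp} (hi : i.eval s ≤ W) :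
      Exec W (.rstore a i e) s (s.storeR a (i.eval s) (e.eval s)) (i.cost + e.cost + 1)
  | seq {p q : Prog} {s s' s'' : State} {t t' : ℕ}
      (hp : Exec W p s s' t) (hq : Exec W q s' s'' t') :
      Exec W (.seq p q) s s'' (t + t')
  | ite_true {b : Test} {p q : Prog} {s s' : State} {t : ℕ}
      (hb : b.Holds s) (hp : Exec W p s s' t) :
      Exec W (.ite b p q) s s' (b.cost + t)
  | ite_false {b : Test} {p q : Prog} {s s' : State} {t : ℕ}
      (hb : ¬ b.Holds s) (hq : Exec W q s s' t) :
      Exec W (.ite b p q) s s' (b.cost + t)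
  | loop_true {b : Test} {p : Prog} {s s' s'' : State} {t t' : ℕ}
      (hb : b.Holds s) (hp : Exec W p s s' t) (hl : Exec W (.loop b p) s' s'' t') :
      Exec W (.loop b p) s s'' (b.cost + t + t')
  | loop_false {b : Test} {p : Prog} {s : State} (hb : ¬ b.Holds s) :
      Exec W (.loop b p) s s b.cost

/-- The input memory for a graph `G` and a set `T` of its edges. Word registers `0` and `1` hold
`n` and `m`; word arrays `0` and `1` hold the two endpoints of every edge, word array `2` the
indicator of `T`; weight array `0` holds the edge weights. Everything else is `0`. -/
noncomputable def input {n m : ℕ} (G : WGraph n m) (T : Finset (Fin m)) : State where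
  wreg x := if x = 0 then n else if x = 1 then m else 0
  warr a i :=
    if h : i < m then
      if a = 0 then (G.src ⟨i, h⟩ : ℕ)
      else if a = 1 then (G.dst ⟨i, h⟩ : ℕ)
      else if a = 2 then (if (⟨i, h⟩ : Fin m) ∈ T then 1 else 0)
      else 0
    else 0
  rreg _ := 0
  rarr a i := if h : i < m then (if a = 0 then G.wt ⟨i, h⟩ else 0) else 0

/-- The memory `s` outputs the cut `(S, Sᶜ)` of `G` and its value: the first `n` cells of the
word array `3` hold the indicator of `S`, and the weight register `0` holds the value. -/
def Outputs {n m : ℕ} (G : WGraph n m) (s : State) (S : Finset (Fin n)) : Prop :=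
  (∀ v : Fin n, s.warr 3 v = if v ∈ S then 1 else 0) ∧ s.rreg 0 = G.cutValue S

end RAM

/-! Root `T` at the vertex 0 and number the vertices so that parents precede children. A cut is
determined, up to complement, by the tree edges that cross it. Hence every cut that 2-respects `T`
has the crossing edges of the set of vertices below exactly one of two vertices `v` and `w`, with `w
< v`; the choice `w = 0` gives the cuts crossed by a single tree edge (`TreePos.exists_side`).

For an edge `e` let p_e(v) be 1 if the tree path between the ends of `e` uses the edge from `v` to
its parent, and 0 otherwise (`pathInd`). Then `e` crosses the cut of `v` and `w` iff p_e(v) and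
p_e(w) differ, so the value of the cut is P(v) + P(w) - 2 ∑ wt(e) p_e(v) p_e(w), where P(v) = ∑
wt(e) p_e(v) (`cutValue_side`). Moreover p_e is the subtree sum of a function supported on three
vertices: the ends x, y and their lowest common ancestor l, with coefficients 1, 1, -2
(`subSum_pathDiff`). Hence the mixed term is the subtree sum over `v` of functions f(v) of `w`, and
`e` contributes to f(x), f(y), f(l) only, by nine updates of the form "add a constant at all
ancestors of a vertex".

In a heavy path layout the ancestors of a vertex form O(log n) intervals (`Layout.anc_chain`), and
an interval is a difference of two prefixes. The functions f(v) are kept in segment trees that share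
one static tree holding the minima of P; a tree owns copies of only those nodes that it had to
modify. An addition is recorded at a node for its left half and is never pushed down, so a prefix
addition touches one path from the root to a leaf. It costs O(log n) time and O(log n) new nodes
(`prefAdd_ok`), which makes O(m log² n) for all the edges (`addAnc_ok`, `contribsProg_ok`).

The vertices are then treated in decreasing order, children before parents. When the turn of `v`
comes, its tree has absorbed those of all its descendants, so that with P(v) added it represents the
value of the cut of `v` and `w` as a function of `w`. A prefix minimum finds the best `w < v` in
O(log n) time (`View.min`, `query_ok`), and the tree is merged into that of the parent. A merge
visits only the positions owned by both trees, and each visit reduces the number of owned nodes by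
one. All the merges together therefore cost no more than the creation of the nodes (`sum_owned_mrg`,
`merge_ok`, `mainLoop_ok`).

The preparations are cheaper. The tree is rooted by removing leaves, with only the degree and the
sum of the neighbours kept for each vertex: at a leaf that sum is the neighbour (`PeelInv.step`).
Subtree sizes give the heavy paths, and the light depth is at most log₂ n because sizes halve
(`HeavyPaths.exists_depth`). Lowest common ancestors are found by climbing heavy paths
(`lcaProg_ok`).

All statements about programs have the form `Ok`: termination within a given time, with a given
postcondition. Straight-line code is evaluated by `wp`, loops by an invariant with a potential
(`Ok.loop`), and everything a program does not mention as a target of writing is preserved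
(`Exec.fr`). -/

/-! ## A program logic for the machine -/

namespace RAM

/-- `p`, started in `s`, halts within `T` operations in a memory satisfying `Q`. -/
def Ok (W : ℕ) (p : Prog) (s : State) (T : ℕ) (Q : State → Prop) : Prop :=
  ∃ s' t, Exec W p s s' t ∧ t ≤ T ∧ Q s'

/-- Word registers a program may write. -/
def Prog.ww : Prog → List ℕ
  | .wset x _ => [x]
  | .seq p q => p.ww ++ q.ww
  | .ite _ p q => p.ww ++ q.ww
  | .loop _ p => p.ww
  | _ => []

/-- Word arrays a program may write. -/
def Prog.wa : Prog → List ℕ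
  | .wstore a _ _ => [a]
  | .seq p q => p.wa ++ q.wa
  | .ite _ p q => p.wa ++ q.wa
  | .loop _ p => p.wa
  | _ => []

/-- Weight registers a program may write. -/
def Prog.rw : Prog → List ℕ
  | .rset x _ => [x]
  | .seq p q => p.rw ++ q.rw
  | .ite _ p q => p.rw ++ q.rw
  | .loop _ p => p.rw
  | _ => []

/-- Weight arrays a program may write. -/
def Prog.ra : Prog → List ℕ
  | .rstore a _ _ => [a]
  | .seq p q => p.ra ++ q.ra
  | .ite _ p q => p.ra ++ q.ra
  | .loop _ p => p.ra
  | _ => []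

/-- `s'` agrees with `s` on everything `p` does not write. -/
structure Fr (p : Prog) (s s' : State) : Prop where
  wreg : ∀ x, x ∉ p.ww → s'.wreg x = s.wreg x
  warr : ∀ a, a ∉ p.wa → s'.warr a = s.warr a
  rreg : ∀ x, x ∉ p.rw → s'.rreg x = s.rreg x
  rarr : ∀ a, a ∉ p.ra → s'.rarr a = s.rarr a

theorem Fr.refl (p : Prog) (s : State) : Fr p s s :=
  ⟨fun _ _ => rfl, fun _ _ => rfl, fun _ _ => rfl, fun _ _ => rfl⟩

theorem Fr.trans {p : Prog} {s s' s'' : State} (h : Fr p s s') (h' : Fr p s' s'') :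
    Fr p s s'' :=
  ⟨fun x hx => (h'.wreg x hx).trans (h.wreg x hx), fun x hx => (h'.warr x hx).trans (h.warr x hx),
   fun x hx => (h'.rreg x hx).trans (h.rreg x hx), fun x hx => (h'.rarr x hx).trans (h.rarr x hx)⟩

theorem Fr.mono {p q : Prog} {s s' : State} (h : Fr p s s')
    (h1 : p.ww ⊆ q.ww) (h2 : p.wa ⊆ q.wa) (h3 : p.rw ⊆ q.rw) (h4 : p.ra ⊆ q.ra) :
    Fr q s s' :=
  ⟨fun x hx => h.wreg x fun h => hx (h1 h), fun x hx => h.warr x fun h => hx (h2 h),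
   fun x hx => h.rreg x fun h => hx (h3 h), fun x hx => h.rarr x fun h => hx (h4 h)⟩

/-- What a run can change is visible in the program text, so facts about all other registers and
arrays survive it. For a concrete program the non-membership conditions are closed by `decide`. -/
theorem Exec.fr {W : ℕ} {p : Prog} {s s' : State} {t : ℕ} (h : Exec W p s s' t) :
    Fr p s s' := by
  induction h with
  | skip s => exact Fr.refl _ _
  | wset he =>
    refine ⟨fun y hy => ?_, fun _ _ => rfl, fun _ _ => rfl, fun _ _ => rfl⟩
    simp only [Prog.ww, List.mem_singleton] at hy
    simp [State.setW, hy]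
  | wstore hi he =>
    refine ⟨fun _ _ => rfl, fun y hy => ?_, fun _ _ => rfl, fun _ _ => rfl⟩
    simp only [Prog.wa, List.mem_singleton] at hy
    simp [State.storeW, hy]
  | rset =>
    refine ⟨fun _ _ => rfl, fun _ _ => rfl, fun y hy => ?_, fun _ _ => rfl⟩
    simp only [Prog.rw, List.mem_singleton] at hy
    simp [State.setR, hy]
  | rstore hi =>
    refine ⟨fun _ _ => rfl, fun _ _ => rfl, fun _ _ => rfl, fun y hy => ?_⟩
    simp only [Prog.ra, List.mem_singleton] at hy
    simp [State.storeR, hy]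
  | seq _ _ ih1 ih2 =>
    exact (ih1.mono (by simp [Prog.ww]) (by simp [Prog.wa]) (by simp [Prog.rw])
      (by simp [Prog.ra])).trans (ih2.mono (by simp [Prog.ww]) (by simp [Prog.wa])
      (by simp [Prog.rw]) (by simp [Prog.ra]))
  | ite_true _ _ ih =>
    exact ih.mono (by simp [Prog.ww]) (by simp [Prog.wa]) (by simp [Prog.rw]) (by simp [Prog.ra])
  | ite_false _ _ ih =>
    exact ih.mono (by simp [Prog.ww]) (by simp [Prog.wa]) (by simp [Prog.rw]) (by simp [Prog.ra])
  | loop_true _ _ _ ih1 ih2 =>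
    exact (ih1.mono (by simp [Prog.ww]) (by simp [Prog.wa]) (by simp [Prog.rw])
      (by simp [Prog.ra])).trans ih2
  | loop_false _ => exact Fr.refl _ _

theorem Ok.fr {W : ℕ} {p : Prog} {s : State} {T : ℕ} {Q : State → Prop} (h : Ok W p s T Q) :
    Ok W p s T fun s' => Q s' ∧ Fr p s s' := by
  obtain ⟨s', t, he, ht, hq⟩ := h
  exact ⟨s', t, he, ht, hq, he.fr⟩

theorem Ok.mono {W : ℕ} {p : Prog} {s : State} {T T' : ℕ} {Q Q' : State → Prop}
    (h : Ok W p s T Q) (hT : T ≤ T') (hQ : ∀ s', Q s' → Q' s') : Ok W p s T' Q' := by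
  obtain ⟨s', t, he, ht, hq⟩ := h
  exact ⟨s', t, he, ht.trans hT, hQ _ hq⟩

theorem Ok.seq {W : ℕ} {p q : Prog} {s : State} {T T' : ℕ} {Q : State → Prop}
    (h : Ok W p s T fun s' => Ok W q s' T' Q) : Ok W (.seq p q) s (T + T') Q := by
  obtain ⟨s', t, he, ht, s'', t', he', ht', hq⟩ := h
  exact ⟨s'', t + t', he.seq he', add_le_add ht ht', hq⟩

/-- Sequencing with the frame of the first program. -/
theorem Ok.seq' {W : ℕ} {p q : Prog} {s : State} {T T' : ℕ} {R Q : State → Prop}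
    (h : Ok W p s T R) (h' : ∀ s', R s' → Fr p s s' → Ok W q s' T' Q) :
    Ok W (.seq p q) s (T + T') Q :=
  Ok.seq (h.fr.mono le_rfl fun s' hs => h' s' hs.1 hs.2)

theorem Ok.ite {W : ℕ} {b : Test} {p q : Prog} {s : State} {T : ℕ} {Q : State → Prop}
    (h1 : b.Holds s → Ok W p s T Q) (h2 : ¬ b.Holds s → Ok W q s T Q) :
    Ok W (.ite b p q) s (b.cost + T) Q := by
  by_cases hb : b.Holds s
  · obtain ⟨s', t, he, ht, hq⟩ := h1 hb
    exact ⟨s', _, .ite_true hb he, by omega, hq⟩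
  · obtain ⟨s', t, he, ht, hq⟩ := h2 hb
    exact ⟨s', _, .ite_false hb he, by omega, hq⟩

/-! ### Weakest preconditions of straight-line code; loops with potentials -/

/-- The weakest precondition of a loop-free program. -/
def wp (W : ℕ) : Prog → (State → Prop) → State → Prop
  | .skip, Q, s => Q s
  | .wset x e, Q, s => e.eval s ≤ W ∧ Q (s.setW x (e.eval s))
  | .wstore a i e, Q, s => i.eval s ≤ W ∧ e.eval s ≤ W ∧ Q (s.storeW a (i.eval s) (e.eval s))
  | .rset x e, Q, s => Q (s.setR x (e.eval s))
  | .rstore a i e, Q, s => i.eval s ≤ W ∧ Q (s.storeR a (i.eval s) (e.eval s))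
  | .seq p q, Q, s => wp W p (wp W q Q) s
  | .ite b p q, Q, s => (b.Holds s → wp W p Q s) ∧ (¬ b.Holds s → wp W q Q s)
  | .loop _ _, _, _ => False

/-- A bound on the time of a loop-free program. -/
def Prog.mx : Prog → ℕ
  | .skip => 1
  | .wset _ e => e.cost + 1
  | .wstore _ i e => i.cost + e.cost + 1
  | .rset _ e => e.cost + 1
  | .rstore _ i e => i.cost + e.cost + 1
  | .seq p q => p.mx + q.mx
  | .ite b p q => b.cost + max p.mx q.mx
  | .loop _ _ => 0

theorem Ok.of_wp {W : ℕ} {p : Prog} {s : State} {Q : State → Prop} (h : wp W p Q s) :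
    Ok W p s p.mx Q := by
  induction p generalizing s Q with
  | skip => exact ⟨s, _, .skip s, le_rfl, h⟩
  | wset x e => exact ⟨_, _, .wset h.1, le_rfl, h.2⟩
  | wstore a i e => exact ⟨_, _, .wstore h.1 h.2.1, le_rfl, h.2.2⟩
  | rset x e => exact ⟨_, _, .rset, le_rfl, h⟩
  | rstore a i e => exact ⟨_, _, .rstore h.1, le_rfl, h.2⟩
  | seq p q ihp ihq => exact Ok.seq ((ihp h).mono le_rfl fun _ hs => ihq hs)
  | ite b p q ihp ihq =>
    exact Ok.ite (fun hb => (ihp (h.1 hb)).mono (le_max_left _ _) fun _ => id)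
      (fun hb => (ihq (h.2 hb)).mono (le_max_right _ _) fun _ => id)
  | loop b p => exact h.elim

/-- Loop-free programs, with an explicit time bound. -/
theorem Ok.line {W : ℕ} {p : Prog} {s : State} {Q : State → Prop} {T : ℕ} (hT : p.mx ≤ T)
    (h : wp W p Q s) : Ok W p s T Q := (Ok.of_wp h).mono hT fun _ => id

/-- Loops, with an invariant and a potential on a ghost state. -/
theorem Ok.loop {γ : Type*} {W : ℕ} {b : Test} {p : Prog} (I : γ → State → Prop) (pot : γ → ℕ)
    {Q : State → Prop} {s0 : State} (g0 : γ) (h0 : I g0 s0)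
    (exit : ∀ g s, I g s → Fr p s0 s → ¬ b.Holds s → b.cost ≤ pot g ∧ Q s)
    (step : ∀ g s, I g s → Fr p s0 s → b.Holds s →
      ∃ t, Ok W p s t fun s' => ∃ g', I g' s' ∧ b.cost + t + pot g' ≤ pot g) :
    Ok W (.loop b p) s0 (pot g0) Q := by
  -- Every test costs at least one operation, so each iteration strictly lowers the potential.
  -- Induction on a bound for the potential gives termination and the time bound at once.
  have key : ∀ N g s, pot g ≤ N → I g s → Fr p s0 s → Ok W (.loop b p) s (pot g) Q := by
    intro N
    induction N with
    | zero =>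
      intro g s hg hI hF
      by_cases hb : b.Holds s
      · obtain ⟨t, s', t', he, ht, g', hI', hp⟩ := step g s hI hF hb
        have : 0 < b.cost := by cases b <;> simp [Test.cost]
        omega
      · obtain ⟨hc, hQ⟩ := exit g s hI hF hb
        exact ⟨s, _, .loop_false hb, hc, hQ⟩
    | succ N ih =>
      intro g s hg hI hF
      by_cases hb : b.Holds s
      · obtain ⟨t, s', t', he, ht, g', hI', hp⟩ := step g s hI hF hb
        have : 0 < b.cost := by cases b <;> simp [Test.cost]
        obtain ⟨s'', t'', he', ht', hQ⟩ := ih g' s' (by omega) hI' (hF.trans he.fr)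
        exact ⟨s'', _, .loop_true hb he he', by omega, hQ⟩
      · obtain ⟨hc, hQ⟩ := exit g s hI hF hb
        exact ⟨s, _, .loop_false hb, hc, hQ⟩
  exact key _ g0 s0 le_rfl h0 (Fr.refl _ _)

/-- `while x < y do (p; x := x + 1)` -/
def forUp (x y : ℕ) (p : Prog) : Prog :=
  .loop (.not (.wle (.reg y) (.reg x))) (.seq p (.wset x (.add (.reg x) (.const 1))))

/-- `while 1 ≤ x do (x := x - 1; p)` -/
def forDown (x : ℕ) (p : Prog) : Prog :=
  .loop (.wle (.const 1) (.reg x)) (.seq (.wset x (.sub (.reg x) (.const 1))) p)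

section simps
variable (s : State) (x v a i y b : ℕ) (r : ℝ)

@[simp] theorem setW_wreg : (s.setW x v).wreg y = if y = x then v else s.wreg y := by
  simp [State.setW, Function.update_apply]
@[simp] theorem setW_warr : (s.setW x v).warr = s.warr := rfl
@[simp] theorem setW_rreg : (s.setW x v).rreg = s.rreg := rfl
@[simp] theorem setW_rarr : (s.setW x v).rarr = s.rarr := rfl
@[simp] theorem storeW_wreg : (s.storeW a i v).wreg = s.wreg := rfl
@[simp] theorem storeW_warr : (s.storeW a i v).warr b =
    if b = a then Function.update (s.warr a) i v else s.warr b := by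
  simp [State.storeW, Function.update_apply]
@[simp] theorem storeW_rreg : (s.storeW a i v).rreg = s.rreg := rfl
@[simp] theorem storeW_rarr : (s.storeW a i v).rarr = s.rarr := rfl
@[simp] theorem setR_wreg : (s.setR x r).wreg = s.wreg := rfl
@[simp] theorem setR_warr : (s.setR x r).warr = s.warr := rfl
@[simp] theorem setR_rreg : (s.setR x r).rreg y = if y = x then r else s.rreg y := by
  simp [State.setR, Function.update_apply]
@[simp] theorem setR_rarr : (s.setR x r).rarr = s.rarr := rfl
@[simp] theorem storeR_wreg : (s.storeR a i r).wreg = s.wreg := rfl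
@[simp] theorem storeR_warr : (s.storeR a i r).warr = s.warr := rfl
@[simp] theorem storeR_rreg : (s.storeR a i r).rreg = s.rreg := rfl
@[simp] theorem storeR_rarr : (s.storeR a i r).rarr b =
    if b = a then Function.update (s.rarr a) i r else s.rarr b := by
  simp [State.storeR, Function.update_apply]

end simps

attribute [simp] wp WExp.eval RExp.eval Test.Holds WExp.cost RExp.cost Test.cost Prog.mx

/-- Besides the body, an iteration costs 4 for the test and 4 for the increment; the failing test at
the end costs another 4. The `.const 0` in the frame is a placeholder: only the fact that `x` is
written matters there. -/
theorem Ok.forUp {W : ℕ} {x y : ℕ} {p : Prog} (I : ℕ → State → Prop) {a N : ℕ} (c : ℕ)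
    {s0 : State} (hxy : y ≠ x) (hx : x ∉ p.ww) (hy : y ∉ p.ww)
    (ha : s0.wreg x = a) (hN : s0.wreg y = N) (haN : a ≤ N) (hW : N ≤ W) (h0 : I a s0)
    (step : ∀ i s, a ≤ i → i < N → I i s → s.wreg x = i →
      Fr (.seq p (.wset x (.const 0))) s0 s →
      Ok W p s c fun s' => I (i + 1) (s'.setW x (i + 1))) :
    Ok W (forUp x y p) s0 ((N - a) * (c + 8) + 4) fun s => I N s ∧ s.wreg x = N := by
  refine Ok.loop (fun i s => a ≤ i ∧ i ≤ N ∧ I i s ∧ s.wreg x = i) (fun i => (N - i) * (c + 8) + 4)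
    a ⟨le_rfl, haN, h0, ha⟩ ?_ ?_
  · rintro i s ⟨h1, h2, h3, h4⟩ hF hb
    have := hF.wreg y (by simp [Prog.ww, hy, hxy])
    simp only [Test.Holds, WExp.eval, not_not, this, hN, h4] at hb
    obtain rfl : i = N := by omega
    simp [h3, h4]
  · rintro i s ⟨h1, h2, h3, h4⟩ hF hb
    have hy' := hF.wreg y (by simp [Prog.ww, hy, hxy])
    simp only [Test.Holds, WExp.eval, hy', hN, h4, not_le] at hb
    refine ⟨c + 4, Ok.seq' (step i s h1 hb h3 h4 (hF.mono (by simp [Prog.ww]) (by simp [Prog.wa])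
      (by simp [Prog.rw]) (by simp [Prog.ra]))) ?_⟩
    intro s' hI hF'
    have hx' := (hF'.wreg x hx).trans h4
    refine Ok.line (by simp) ?_
    simp only [wp, WExp.eval, hx']
    refine ⟨by omega, i + 1, ⟨by omega, by omega, hI, by simp⟩, ?_⟩
    obtain ⟨d, rfl⟩ : ∃ d, N = i + 1 + d := ⟨N - i - 1, by omega⟩
    have e1 : i + 1 + d - i = d + 1 := by omega
    have e2 : i + 1 + d - (i + 1) = d := by omega
    rw [e1, e2, add_mul]
    simp; omega

theorem Ok.forDown {W : ℕ} {x : ℕ} {p : Prog} (I : ℕ → State → Prop) {N : ℕ} (c : ℕ)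
    {s0 : State} (hx : x ∉ p.ww) (hN : s0.wreg x = N) (hW : N ≤ W) (h0 : I N s0)
    (step : ∀ i s, i < N → I (i + 1) s → s.wreg x = i + 1 →
      Fr (.seq p (.wset x (.const 0))) s0 s →
      Ok W p (s.setW x i) c (I i)) :
    Ok W (forDown x p) s0 (N * (c + 7) + 3) fun s => I 0 s ∧ s.wreg x = 0 := by
  refine Ok.loop (fun i s => i ≤ N ∧ I i s ∧ s.wreg x = i) (fun i => i * (c + 7) + 3)
    N ⟨le_rfl, h0, hN⟩ ?_ ?_
  · rintro i s ⟨h1, h3, h4⟩ hF hb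
    simp only [Test.Holds, WExp.eval, h4, not_le] at hb
    obtain rfl : i = 0 := by omega
    simp [h3, h4]
  · rintro i s ⟨h1, h3, h4⟩ hF hb
    simp only [Test.Holds, WExp.eval, h4] at hb
    obtain ⟨i, rfl⟩ : ∃ j, i = j + 1 := ⟨i - 1, by omega⟩
    refine ⟨4 + c, Ok.seq (Ok.line (by simp) ?_)⟩
    simp only [wp, WExp.eval, h4, Nat.add_sub_cancel]
    refine ⟨by omega, ?_⟩
    refine (step i s (by omega) h3 h4 (hF.mono (by simp [Prog.ww]) (by simp [Prog.wa])
      (by simp [Prog.rw]) (by simp [Prog.ra]))).fr.mono le_rfl ?_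
    rintro s' ⟨hI, hF'⟩
    refine ⟨i, ⟨by omega, hI, by simpa using hF'.wreg x hx⟩, ?_⟩
    rw [add_mul]
    simp; omega

end RAM

/-! ## Sparse segment trees: the pointer structure -/

namespace RAM

/-- The fields of the nodes of the segment trees. `AD` is added to the left half of a node. -/
structure Mem where
  LC : ℕ → ℕ
  RC : ℕ → ℕ
  ARG : ℕ → ℕ
  AD : ℕ → ℝ
  MN : ℕ → ℝ

/-- Set the minimum stored at a node. -/
noncomputable def Mem.setMin (M : Mem) (p : ℕ) (mn : ℝ) (arg : ℕ) : Mem :=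
  { M with MN := Function.update M.MN p mn, ARG := Function.update M.ARG p arg }

/-- The node `p` with children `c` and `c'` stores its minimum and a place where it is attained. -/
def Mem.PullEq (M : Mem) (p c c' : ℕ) : Prop :=
  M.MN p ≤ M.AD p + M.MN c ∧ M.MN p ≤ M.MN c' ∧
    ((M.MN p = M.AD p + M.MN c ∧ M.ARG p = M.ARG c) ∨ (M.MN p = M.MN c' ∧ M.ARG p = M.ARG c'))

/-- The tree whose node at the heap position `h` is `r h`, with the additions `a`; the minimum
at the positions `bad` may be wrong. -/
structure View (k : ℕ) (base : ℕ → ℝ) (M : Mem) (r : ℕ → ℕ) (a : ℕ → ℝ) (bad : ℕ → Prop) :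
    Prop where
  lc : ∀ h, 1 ≤ h → h < 2 ^ k → M.LC (r h) = r (2 * h)
  rc : ∀ h, 1 ≤ h → h < 2 ^ k → M.RC (r h) = r (2 * h + 1)
  ad : ∀ h, 1 ≤ h → h < 2 ^ k → M.AD (r h) = a h
  mn : ∀ h, 1 ≤ h → h < 2 ^ k → ¬ bad h → M.PullEq (r h) (r (2 * h)) (r (2 * h + 1))
  leaf : ∀ h, 2 ^ k ≤ h → h < 2 * 2 ^ k → r h = h ∧ M.MN h = base (h - 2 ^ k) ∧ M.ARG h = h - 2 ^ k

/-- A forest of sparse segment trees `u < A` over a common static tree. -/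
structure DS (k : ℕ) (base : ℕ → ℝ) (A nx : ℕ) (M : Mem) (ρ : ℕ → ℕ → ℕ) (a : ℕ → ℕ → ℝ)
    (bad : ℕ → ℕ → Prop) : Prop where
  stat : View k base M (fun h => h) (fun _ => 0) (fun _ => False)
  view : ∀ u < A, View k base M (ρ u) (a u) (bad u)
  root : ∀ u < A, ρ u 1 = 2 * 2 ^ k + u
  nx_ge : 2 * 2 ^ k + A ≤ nx
  own : ∀ u < A, ∀ h, 1 ≤ h → h < 2 ^ k → ρ u h = h ∨ (2 * 2 ^ k ≤ ρ u h ∧ ρ u h < nx)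
  inj : ∀ u < A, ∀ u' < A, ∀ h h', 1 ≤ h → h < 2 ^ k → 1 ≤ h' → h' < 2 ^ k →
    2 * 2 ^ k ≤ ρ u h → ρ u h = ρ u' h' → u = u' ∧ h = h'
  arg : ∀ i, M.ARG i < 2 ^ k

/-- A view reads only the nodes in the image of `r`, so writing elsewhere does not disturb it. This
is how the trees of the forest are kept independent of each other. -/
theorem View.congr {k base M M' r a bad} (h : View k base M r a bad)
    (h1 : ∀ h, 1 ≤ h → h < 2 ^ k → M'.LC (r h) = M.LC (r h) ∧ M'.RC (r h) = M.RC (r h) ∧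
      M'.AD (r h) = M.AD (r h))
    (h2 : ∀ h, 1 ≤ h → h < 2 * 2 ^ k → M'.MN (r h) = M.MN (r h) ∧ M'.ARG (r h) = M.ARG (r h)) :
    View k base M' r a bad := by
  refine ⟨fun x hx hx' => ?_, fun x hx hx' => ?_, fun x hx hx' => ?_, fun x hx hx' hb => ?_,
    fun x hx hx' => ?_⟩
  · rw [(h1 x hx hx').1, h.lc x hx hx']
  · rw [(h1 x hx hx').2.1, h.rc x hx hx']
  · rw [(h1 x hx hx').2.2, h.ad x hx hx']
  · have := h.mn x hx hx' hb
    unfold Mem.PullEq at *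
    rw [(h1 x hx hx').2.2, (h2 x hx (by omega)).1, (h2 x hx (by omega)).2,
      (h2 (2 * x) (by omega) (by omega)).1, (h2 (2 * x) (by omega) (by omega)).2,
      (h2 (2 * x + 1) (by omega) (by omega)).1, (h2 (2 * x + 1) (by omega) (by omega)).2]
    exact this
  · have hp : 0 < 2 ^ k := by positivity
    have hl := h.leaf x hx hx'
    have := h2 x (by omega) hx'
    rw [hl.1] at this
    exact ⟨hl.1, by rw [this.1, hl.2.1], by rw [this.2, hl.2.2]⟩

theorem View.mono {k base M r a bad bad'} (h : View k base M r a bad)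
    (hb : ∀ h, 1 ≤ h → h < 2 ^ k → bad h → bad' h) : View k base M r a bad' :=
  ⟨h.lc, h.rc, h.ad, fun x hx hx' hbx => h.mn x hx hx' fun h => hbx (hb x hx hx' h), h.leaf⟩

theorem DS.mono {k base A nx M ρ a bad bad'} (h : DS k base A nx M ρ a bad)
    (hb : ∀ u < A, ∀ h, 1 ≤ h → h < 2 ^ k → bad u h → bad' u h) : DS k base A nx M ρ a bad' :=
  ⟨h.stat, fun u hu => (h.view u hu).mono (hb u hu), h.root, h.nx_ge, h.own, h.inj, h.arg⟩

section
variable {k : ℕ} {base : ℕ → ℝ} {A nx : ℕ} {M : Mem} {ρ : ℕ → ℕ → ℕ} {a : ℕ → ℕ → ℝ}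
  {bad : ℕ → ℕ → Prop}

theorem DS.lt_nx (D : DS k base A nx M ρ a bad) {u h : ℕ} (hu : u < A) (h1 : 1 ≤ h)
    (h2 : h < 2 * 2 ^ k) : ρ u h < nx := by
  have := D.nx_ge
  rcases lt_or_ge h (2 ^ k) with h3 | h3
  · rcases D.own u hu h h1 h3 with h | h <;> omega
  · rw [((D.view u hu).leaf h h3 h2).1]; omega

theorem DS.eq_or (D : DS k base A nx M ρ a bad) {u h : ℕ} (hu : u < A) (h1 : 1 ≤ h)
    (h2 : h < 2 * 2 ^ k) : ρ u h = h ∨ (2 * 2 ^ k ≤ ρ u h ∧ h < 2 ^ k) := by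
  rcases lt_or_ge h (2 ^ k) with h3 | h3
  · rcases D.own u hu h h1 h3 with h | h <;> omega
  · left; rw [((D.view u hu).leaf h h3 h2).1]

/-- An owned node is met only once. -/
theorem DS.ne (D : DS k base A nx M ρ a bad) {u h u' h' : ℕ} (hu : u < A) (h1 : 1 ≤ h)
    (h2 : h < 2 ^ k) (hu' : u' < A) (h1' : 1 ≤ h') (h2' : h' < 2 * 2 ^ k)
    (ho : 2 * 2 ^ k ≤ ρ u h) (hne : ¬ (u = u' ∧ h = h')) : ρ u' h' ≠ ρ u h := by
  intro he
  rcases D.eq_or hu' h1' h2' with h | h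
  · omega
  · exact hne (D.inj u hu u' hu' _ h' h1 h2 h1' h.2 ho he.symm)

/-- Changing an owned node only concerns one tree. -/
theorem DS.modify (D : DS k base A nx M ρ a bad) {u h : ℕ} {M' : Mem} {aᵤ : ℕ → ℝ}
    {badᵤ : ℕ → Prop} (hu : u < A) (h1 : 1 ≤ h)
    (h2 : h < 2 ^ k) (ho : 2 * 2 ^ k ≤ ρ u h)
    (hM : ∀ i, i ≠ ρ u h → M'.LC i = M.LC i ∧ M'.RC i = M.RC i ∧ M'.AD i = M.AD i ∧
      M'.MN i = M.MN i ∧ M'.ARG i = M.ARG i) (hG : M'.ARG (ρ u h) < 2 ^ k)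
    (hV : View k base M' (ρ u) aᵤ badᵤ) :
    DS k base A nx M' ρ (Function.update a u aᵤ) (Function.update bad u badᵤ) := by
  refine ⟨D.stat.congr ?_ ?_, ?_, D.root, D.nx_ge, D.own, D.inj, fun i => ?_⟩
  · intro x hx hx'
    have := hM x (by omega)
    simp [this]
  · intro x hx hx'
    have := hM x (by omega)
    simp [this]
  · intro u' hu'
    by_cases he : u' = u
    · subst he; simpa using hV
    · rw [Function.update_of_ne he, Function.update_of_ne he]
      refine (D.view u' hu').congr ?_ ?_
      · intro x hx hx'
        have := hM _ (D.ne hu h1 h2 hu' hx (by omega) ho (by tauto))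
        simp [this]
      · intro x hx hx'
        have := hM _ (D.ne hu h1 h2 hu' hx (by omega) ho (by tauto))
        simp [this]
  · by_cases hi : i = ρ u h
    · rw [hi]; exact hG
    · rw [(hM i hi).2.2.2.2]; exact D.arg i

/-- The minimum stored at the node becomes stale, so the position must already be marked `bad`. No
other stored minimum refers to this addition. -/
theorem DS.addAD (D : DS k base A nx M ρ a bad) {u h : ℕ} (hu : u < A) (h1 : 1 ≤ h)
    (h2 : h < 2 ^ k) (ho : 2 * 2 ^ k ≤ ρ u h) (hb : bad u h) (x : ℝ) :
    DS k base A nx { M with AD := Function.update M.AD (ρ u h) (M.AD (ρ u h) + x) } ρ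
      (Function.update a u (Function.update (a u) h (a u h + x))) bad := by
  have V := D.view u hu
  have := D.modify (M' := { M with AD := Function.update M.AD (ρ u h) (M.AD (ρ u h) + x) })
    (aᵤ := Function.update (a u) h (a u h + x)) (badᵤ := bad u) hu h1 h2 ho
    (fun i hi => by simp [hi]) (D.arg _) ?_
  · simpa using this
  · refine ⟨V.lc, V.rc, fun y hy hy' => ?_, fun y hy hy' hby => ?_, V.leaf⟩
    · by_cases he : y = h
      · subst he; simp [V.ad y h1 h2]
      · have := D.ne hu h1 h2 hu hy (by omega) ho (by tauto)
        simp [this, he, V.ad y hy hy']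
    · have hne : y ≠ h := by rintro rfl; exact hby hb
      have := D.ne hu h1 h2 hu hy (by omega) ho (by tauto)
      have h3 := V.mn y hy hy' hby
      unfold Mem.PullEq at *
      simpa [Function.update_apply, this] using h3

/-- A new minimum at `h` can only spoil the equation at the parent of `h`, which is therefore
required to be still `bad`. Repairs have to go from the bottom up. -/
theorem DS.pull (D : DS k base A nx M ρ a bad) {u h : ℕ} (hu : u < A) (h1 : 1 ≤ h)
    (h2 : h < 2 ^ k) (ho : 2 * 2 ^ k ≤ ρ u h)
    (hp : ∀ h', 1 ≤ h' → (h = 2 * h' ∨ h = 2 * h' + 1) → bad u h') {mn : ℝ} {arg : ℕ}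
    (hG : arg < 2 ^ k)
    (hm : (M.setMin (ρ u h) mn arg).PullEq (ρ u h) (ρ u (2 * h)) (ρ u (2 * h + 1))) :
    DS k base A nx (M.setMin (ρ u h) mn arg) ρ a
      (Function.update bad u fun y => bad u y ∧ y ≠ h) := by
  have V := D.view u hu
  have := D.modify (M' := M.setMin (ρ u h) mn arg)
    (aᵤ := a u) (badᵤ := fun y => bad u y ∧ y ≠ h) hu h1 h2 ho
    (fun i hi => by simp [Mem.setMin, hi]) (by simpa [Mem.setMin] using hG) ?_
  · simpa using this
  · refine ⟨V.lc, V.rc, V.ad, fun y hy hy' hby => ?_, fun y hy hy' => ?_⟩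
    · by_cases he : y = h
      · subst he; exact hm
      · have hby' : ¬ bad u y := fun h => hby ⟨h, he⟩
        have n1 := D.ne hu h1 h2 hu hy (by omega) ho (by tauto)
        have n2 := D.ne hu h1 h2 hu (h' := 2 * y) (by omega) (by omega) ho
          (fun h => hby' (hp y hy (Or.inl h.2)))
        have n3 := D.ne hu h1 h2 hu (h' := 2 * y + 1) (by omega) (by omega) ho
          (fun h => hby' (hp y hy (Or.inr h.2)))
        have h3 := V.mn y hy hy' hby'
        unfold Mem.PullEq at *
        simpa [Mem.setMin, Function.update_apply, n1, n2, n3] using h3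
    · have := V.leaf y hy hy'
      have hne : y ≠ ρ u h := by omega
      simpa [Mem.setMin, Function.update_apply, hne] using this

/-- Copying a static child `c` of an owned node `ρ u h` to the new node `nx`. -/
theorem DS.copy (D : DS k base A nx M ρ a bad) {u h c : ℕ} {M' : Mem} (hu : u < A) (h1 : 1 ≤ h)
    (ho : 2 * 2 ^ k ≤ ρ u h) (hc : c = 2 * h ∨ c = 2 * h + 1) (hck : c < 2 ^ k)
    (hst : ρ u c = c)
    (hL : M'.LC = if c = 2 * h then
      Function.update (Function.update M.LC nx (M.LC c)) (ρ u h) nx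
      else Function.update M.LC nx (M.LC c))
    (hR : M'.RC = if c = 2 * h then Function.update M.RC nx (M.RC c)
      else Function.update (Function.update M.RC nx (M.RC c)) (ρ u h) nx)
    (hA : M'.AD = Function.update M.AD nx (M.AD c))
    (hM : M'.MN = Function.update M.MN nx (M.MN c))
    (hG : M'.ARG = Function.update M.ARG nx (M.ARG c)) :
    DS k base A (nx + 1) M' (Function.update ρ u (Function.update (ρ u) c nx)) a bad := by
  have V := D.view u hu
  have hnx := D.nx_ge
  have h2 : h < 2 ^ k := by omega
  have hlt := D.lt_nx hu h1 (by omega)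
  have hc1 : c ≠ h := by omega
  have hL' : ∀ i, i ≠ nx → i ≠ ρ u h → M'.LC i = M.LC i := by
    intro i h1 h2; rw [hL]; split_ifs <;> simp [h1, h2]
  have hR' : ∀ i, i ≠ nx → i ≠ ρ u h → M'.RC i = M.RC i := by
    intro i h1 h2; rw [hR]; split_ifs <;> simp [h1, h2]
  have hA' : ∀ i, i ≠ nx → M'.AD i = M.AD i := by intro i h1; rw [hA]; simp [h1]
  have hM' : ∀ i, i ≠ nx → M'.MN i = M.MN i := by intro i h1; rw [hM]; simp [h1]
  have hG' : ∀ i, i ≠ nx → M'.ARG i = M.ARG i := by intro i h1; rw [hG]; simp [h1]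
  refine ⟨D.stat.congr ?_ ?_, ?_, ?_, by omega, ?_, ?_, ?_⟩
  · intro x hx hx'
    exact ⟨hL' _ (by omega) (by omega), hR' _ (by omega) (by omega), hA' _ (by omega)⟩
  · intro x hx hx'
    exact ⟨hM' _ (by omega), hG' _ (by omega)⟩
  · intro u' hu'
    by_cases he : u' = u
    · subst he
      rw [Function.update_self]
      have key : ∀ x, 1 ≤ x → x < 2 * 2 ^ k → x ≠ c → ρ u' x ≠ nx := fun x hx hx' _ =>
        (D.lt_nx hu' hx hx').ne
      have nn : ∀ x, 1 ≤ x → x < 2 * 2 ^ k → x ≠ h → ρ u' x ≠ ρ u' h := fun x hx hx' hne =>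
        D.ne hu h1 h2 hu hx hx' ho (by tauto)
      have mnE : ∀ x, 1 ≤ x → x < 2 * 2 ^ k → M'.MN (Function.update (ρ u') c nx x) =
          M.MN (ρ u' x) ∧ M'.ARG (Function.update (ρ u') c nx x) = M.ARG (ρ u' x) := by
        intro x hx hx'
        by_cases hxc : x = c
        · subst hxc; simp [hM, hG, hst]
        · rw [Function.update_of_ne hxc]
          exact ⟨hM' _ (key x hx hx' hxc), hG' _ (key x hx hx' hxc)⟩
      have adE : ∀ x, 1 ≤ x → x < 2 * 2 ^ k → M'.AD (Function.update (ρ u') c nx x) =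
          M.AD (ρ u' x) := by
        intro x hx hx'
        by_cases hxc : x = c
        · subst hxc; simp [hA, hst]
        · rw [Function.update_of_ne hxc]
          exact hA' _ (key x hx hx' hxc)
      refine ⟨fun x hx hx' => ?_, fun x hx hx' => ?_, fun x hx hx' => ?_, fun x hx hx' hb => ?_,
        fun x hx hx' => ?_⟩
      · by_cases hxc : x = c
        · subst hxc
          have e := V.lc x hx hx'
          rw [hst] at e
          have : 2 * x ≠ x := by omega
          rw [Function.update_self, Function.update_of_ne this, ← e, hL]
          split_ifs <;> simp [hlt.ne']
        · rw [Function.update_of_ne hxc]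
          by_cases hxh : x = h
          · subst hxh
            rw [hL]
            rcases hc with hc | hc
            · simp [hc]
            · have e1 : c ≠ 2 * x := by omega
              simp [e1, e1.symm, hlt.ne, V.lc x hx hx']
          · rw [hL' _ (key x hx (by omega) hxc) (nn x hx (by omega) hxh), V.lc x hx hx']
            have : 2 * x ≠ c := by omega
            simp [this]
      · by_cases hxc : x = c
        · subst hxc
          have e := V.rc x hx hx'
          rw [hst] at e
          have : 2 * x + 1 ≠ x := by omega
          rw [Function.update_self, Function.update_of_ne this, ← e, hR]
          split_ifs <;> simp [hlt.ne']
        · rw [Function.update_of_ne hxc]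
          by_cases hxh : x = h
          · subst hxh
            rw [hR]
            rcases hc with hc | hc
            · have e1 : 2 * x + 1 ≠ c := by omega
              simp only [hc, if_true]
              rw [Function.update_of_ne hlt.ne, Function.update_of_ne (by omega), V.rc x hx hx']
            · have e1 : c ≠ 2 * x := by omega
              simp [hc]
          · rw [hR' _ (key x hx (by omega) hxc) (nn x hx (by omega) hxh), V.rc x hx hx']
            have : 2 * x + 1 ≠ c := by omega
            simp [this]
      · rw [adE x hx (by omega), V.ad x hx hx']
      · have e := V.mn x hx hx' hb
        unfold Mem.PullEq at *
        rw [(mnE x hx (by omega)).1, (mnE x hx (by omega)).2, adE x hx (by omega),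
          (mnE (2 * x) (by omega) (by omega)).1, (mnE (2 * x) (by omega) (by omega)).2,
          (mnE (2 * x + 1) (by omega) (by omega)).1, (mnE (2 * x + 1) (by omega) (by omega)).2]
        exact e
      · have hxc : x ≠ c := by omega
        rw [Function.update_of_ne hxc, hM' _ (by omega), hG' _ (by omega)]
        exact V.leaf x hx hx'
    · rw [Function.update_of_ne he]
      refine (D.view u' hu').congr ?_ ?_
      · intro x hx hx'
        have n1 := (D.lt_nx hu' hx (by omega)).ne
        have n2 := D.ne hu h1 h2 hu' hx (by omega) ho (by tauto)
        exact ⟨hL' _ n1 n2, hR' _ n1 n2, hA' _ n1⟩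
      · intro x hx hx'
        have n1 := (D.lt_nx hu' hx (by omega)).ne
        exact ⟨hM' _ n1, hG' _ n1⟩
  · intro u' hu'
    by_cases he : u' = u
    · subst he
      have : 1 ≠ c := by omega
      rw [Function.update_self, Function.update_of_ne this]
      exact D.root _ hu'
    · rw [Function.update_of_ne he]; exact D.root _ hu'
  · intro u' hu' x hx hx'
    have := D.own u' hu' x hx hx'
    by_cases he : u' = u
    · subst he
      rw [Function.update_self]
      by_cases hxc : x = c
      · subst hxc; simp; omega
      · rw [Function.update_of_ne hxc]; omega
    · rw [Function.update_of_ne he]; omega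
  -- The new node `nx` occurs only at the position `c` of the tree `u`, and all the other nodes are
  -- smaller than `nx`; injectivity follows from the old one.
  · have gen : ∀ u' < A, ∀ x, 1 ≤ x → x < 2 ^ k →
        ((u' = u ∧ x = c) ∧ Function.update ρ u (Function.update (ρ u) c nx) u' x = nx) ∨
        (¬ (u' = u ∧ x = c) ∧
          Function.update ρ u (Function.update (ρ u) c nx) u' x = ρ u' x ∧ ρ u' x < nx) := by
      intro u' hu' x hx hx'
      by_cases he : u' = u
      · subst he
        by_cases hxc : x = c
        · subst hxc; simp
        · right; simp [hxc, D.lt_nx hu hx (by omega)]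
      · right; simp [he, D.lt_nx hu' hx (by omega)]
    intro u1 hu1 u2 hu2 x1 x2 hx1 hx1' hx2 hx2' hh heq
    rcases gen u1 hu1 x1 hx1 hx1' with ⟨e1, g1⟩ | ⟨e1, g1, l1⟩ <;>
      rcases gen u2 hu2 x2 hx2 hx2' with ⟨e2, g2⟩ | ⟨e2, g2, l2⟩
    · omega
    · rw [g1, g2] at heq; omega
    · rw [g1, g2] at heq; omega
    · rw [g1] at hh; rw [g1, g2] at heq
      exact D.inj u1 hu1 u2 hu2 x1 x2 hx1 hx1' hx2 hx2' hh heq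
  · intro i
    rw [hG]
    by_cases hi : i = nx
    · subst hi; simpa using D.arg c
    · simpa [hi] using D.arg i

end

end RAM

/-! ## Adding to a prefix -/

namespace RAM

/-- The nodes stored in a memory. -/
def mem (s : State) : Mem := ⟨s.warr 20, s.warr 21, s.warr 22, s.rarr 2, s.rarr 3⟩

/-- Move to a child (`X` is the array of left or right children), copying it if it is static. -/
def stepChild (X : ℕ) : Prog :=
  .seq (.wset 17 (.load X (.reg 12)))
  (.seq (.ite (.and (.wle (.const 1) (.reg 15)) (.not (.wle (.reg 19) (.reg 17))))
    (.seq (.wstore 20 (.reg 18) (.load 20 (.reg 17)))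
    (.seq (.wstore 21 (.reg 18) (.load 21 (.reg 17)))
    (.seq (.wstore 22 (.reg 18) (.load 22 (.reg 17)))
    (.seq (.rstore 2 (.reg 18) (.load 2 (.reg 17)))
    (.seq (.rstore 3 (.reg 18) (.load 3 (.reg 17)))
    (.seq (.wstore X (.reg 12) (.reg 18))
    (.seq (.wset 17 (.reg 18))
    (.wset 18 (.add (.reg 18) (.const 1))))))))))
    .skip)
  (.wset 12 (.reg 17)))

/-- One level of the descent. -/
def descBody : Prog :=
  .seq (.wstore 23 (.reg 15) (.reg 12))
  (.seq (.wset 13 (.div (.reg 13) (.const 2)))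
  (.ite (.wle (.reg 13) (.reg 14))
    (.seq (.seq (.rstore 2 (.reg 12) (.add (.load 2 (.reg 12)) (.reg 2)))
      (.wset 14 (.sub (.reg 14) (.reg 13)))) (stepChild 21))
    (stepChild 20)))

/-- Recompute the minimum at the node `reg 12`. -/
def pullProg : Prog :=
  .seq (.rset 3 (.add (.load 2 (.reg 12)) (.load 3 (.load 20 (.reg 12)))))
  (.ite (.rle (.reg 3) (.load 3 (.load 21 (.reg 12))))
    (.seq (.rstore 3 (.reg 12) (.reg 3))
      (.wstore 22 (.reg 12) (.load 22 (.load 20 (.reg 12)))))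
    (.seq (.rstore 3 (.reg 12) (.load 3 (.load 21 (.reg 12))))
      (.wstore 22 (.reg 12) (.load 22 (.load 21 (.reg 12))))))

/-- Add the weight `reg 2` to the cells below `reg 11` of the tree `reg 10`. -/
def prefAdd : Prog :=
  .seq (.seq (.wset 12 (.add (.reg 19) (.reg 10)))
    (.seq (.wset 13 (.reg 20))
    (.seq (.wset 14 (.reg 11))
    (.wset 15 (.reg 16)))))
  (.seq (forDown 15 descBody)
    (forUp 15 16 (.seq (.wset 12 (.load 23 (.reg 15))) pullProg)))

variable {W k A : ℕ} {base : ℕ → ℝ} {ρ : ℕ → ℕ → ℕ} {a : ℕ → ℕ → ℝ} {bad : ℕ → ℕ → Prop}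

/-- Copy on write: a static child of an owned node gets a private copy, so one step uses at most one
fresh node. Register 15 holds the height of the child; it keeps leaves from being copied, since they
carry no additions and can stay shared. -/
theorem stepChild_ok {s : State} {X u h c : ℕ}
    (hX : (X = 20 ∧ c = 2 * h) ∨ (X = 21 ∧ c = 2 * h + 1))
    (D : DS k base A (s.wreg 18) (mem s) ρ a bad) (hu : u < A) (h1 : 1 ≤ h) (h2 : h < 2 ^ k)
    (ho : 2 * 2 ^ k ≤ ρ u h) (hcur : s.wreg 12 = ρ u h) (hN2 : s.wreg 19 = 2 * 2 ^ k)
    (hd : 1 ≤ s.wreg 15 ↔ c < 2 ^ k) (hW : s.wreg 18 + 1 ≤ W) :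
    Ok W (stepChild X) s 60 fun s' => ∃ ρ', DS k base A (s'.wreg 18) (mem s') ρ' a bad ∧
      s'.wreg 12 = ρ' u c ∧ (c < 2 ^ k → 2 * 2 ^ k ≤ ρ' u c) ∧ s'.wreg 18 ≤ s.wreg 18 + 1 ∧
      ∀ u' h', ¬ (u' = u ∧ h' = c) → ρ' u' h' = ρ u' h' := by
  have V := D.view u hu
  have hlt := D.lt_nx hu h1 (by omega)
  have hc : s.warr X (ρ u h) = ρ u c := by
    rcases hX with ⟨rfl, rfl⟩ | ⟨rfl, rfl⟩
    · exact V.lc h h1 h2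
    · exact V.rc h h1 h2
  have hc1 : 1 ≤ c := by omega
  have hc2 : c < 2 * 2 ^ k := by omega
  have hclt := D.lt_nx hu hc1 hc2
  refine Ok.line (by simp [stepChild]) ?_
  simp only [stepChild, wp, WExp.eval, RExp.eval, Test.Holds, setW_wreg, hcur, hc, setW_warr]
  refine ⟨by omega, fun hb => ?_, fun hb => ?_⟩
  · simp only [Nat.reduceEqDiff, if_false, if_true, hN2, not_le] at hb
    have hck : c < 2 ^ k := hd.1 hb.1
    have hst : ρ u c = c := by
      rcases D.eq_or hu hc1 hc2 with h | h <;> omega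
    have hl : s.warr 20 c = 2 * c := D.stat.lc c hc1 hck
    have hr : s.warr 21 c = 2 * c + 1 := D.stat.rc c hc1 hck
    have hg : s.warr 22 c < 2 ^ k := D.arg c
    have := D.nx_ge
    simp [hst, hl, hr]
    refine ⟨by omega, by omega, by omega, by omega, by omega, by omega, by omega, by omega,
      by omega, by omega, by omega, Function.update ρ u (Function.update (ρ u) c (s.wreg 18)), ?_, by simp,
      ?_, ?_⟩
    · refine D.copy hu h1 ho (by omega) hck hst ?_ ?_ ?_ ?_ ?_
      · rcases hX with ⟨rfl, rfl⟩ | ⟨rfl, rfl⟩ <;> simp [mem, hl, hcur]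
      · rcases hX with ⟨rfl, rfl⟩ | ⟨rfl, rfl⟩ <;> simp [mem, hr, hcur]
      · simp [mem]
      · simp [mem]
      · rcases hX with ⟨rfl, rfl⟩ | ⟨rfl, rfl⟩ <;> simp [mem]
    · intro _; simp; omega
    · intro u' h' hne
      by_cases he : u' = u
      · subst he
        have : h' ≠ c := by tauto
        simp [this]
      · simp [he]
  · simp
    simp [hN2, not_le] at hb
    exact ⟨by omega, ρ, D, rfl, fun h => hb (hd.2 h), fun _ _ _ => rfl⟩

/-- The additions made by a prefix addition below the leaf `y`. -/
def prefVec (y : ℕ) (i k : ℕ) (h : ℕ) : ℝ :=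
  ∑ j ∈ Finset.Ico i k, if h = y / 2 ^ (j + 1) ∧ y / 2 ^ j % 2 = 1 then 1 else 0

theorem pull_ok {s : State} {u h : ℕ}
    (D : DS k base A (s.wreg 18) (mem s) ρ a bad) (hu : u < A) (h1 : 1 ≤ h) (h2 : h < 2 ^ k)
    (ho : 2 * 2 ^ k ≤ ρ u h) (hcur : s.wreg 12 = ρ u h) (hW : s.wreg 18 ≤ W)
    (hp : ∀ h', 1 ≤ h' → (h = 2 * h' ∨ h = 2 * h' + 1) → bad u h') :
    Ok W pullProg s 40 fun s' => DS k base A (s.wreg 18) (mem s') ρ a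
      (Function.update bad u fun y => bad u y ∧ y ≠ h) := by
  have V := D.view u hu
  have hlt := D.lt_nx hu h1 (by omega)
  have hl : s.warr 20 (ρ u h) = ρ u (2 * h) := V.lc h h1 h2
  have hr : s.warr 21 (ρ u h) = ρ u (2 * h + 1) := V.rc h h1 h2
  have g1 : s.warr 22 (ρ u (2 * h)) < 2 ^ k := D.arg _
  have g2 : s.warr 22 (ρ u (2 * h + 1)) < 2 ^ k := D.arg _
  have n1 := D.ne hu h1 h2 hu (h' := 2 * h) (by omega) (by omega) ho (by omega)
  have n2 := D.ne hu h1 h2 hu (h' := 2 * h + 1) (by omega) (by omega) ho (by omega)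
  have hnx := D.nx_ge
  refine Ok.line (by simp [pullProg]) ?_
  simp [pullProg, hcur, hl, hr]
  refine ⟨fun hb => ⟨by omega, by omega, ?_⟩, fun hb => ⟨by omega, by omega, ?_⟩⟩
  · convert D.pull hu h1 h2 ho hp (mn := s.rarr 2 (ρ u h) + s.rarr 3 (ρ u (2 * h))) g1 ?_ using 1
    · simp [Mem.setMin, mem]
    · simp [Mem.PullEq, Mem.setMin, mem, n1, n2, hb]
  · convert D.pull hu h1 h2 ho hp (mn := s.rarr 3 (ρ u (2 * h + 1))) g2 ?_ using 1
    · simp [Mem.setMin, mem]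
    · simp [Mem.PullEq, Mem.setMin, mem, n1, n2, hb.le]

/-- The leading `2 ^ k` of a heap position does not affect the lower bits. The right side is the
form in which the descent sees the bit: the program keeps the remainder modulo `2 ^ (i + 1)` and
compares it with `2 ^ i`. -/
theorem div_pow_bit {k hi i : ℕ} (hi' : i < k) :
    (2 ^ k + hi) / 2 ^ i % 2 = hi % 2 ^ (i + 1) / 2 ^ i := by
  obtain ⟨d, rfl⟩ : ∃ d, k = i + 1 + d := ⟨k - i - 1, by omega⟩
  have hp : 0 < 2 ^ i := by positivity
  have e : 2 ^ (i + 1 + d) + hi = hi + 2 ^ i * (2 * 2 ^ d) := by ring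
  rw [e, Nat.add_mul_div_left _ _ hp, Nat.add_mul_mod_self_left, pow_succ,
    Nat.mod_mul_right_div_self]

theorem prefVec_succ {y i k h : ℕ} (hi : i < k) :
    prefVec y i k h = prefVec y (i + 1) k h +
      if h = y / 2 ^ (i + 1) ∧ y / 2 ^ i % 2 = 1 then 1 else 0 := by
  unfold prefVec
  rw [Finset.sum_eq_sum_Ico_succ_bot hi, add_comm]

/-- The state of the descent at height `i`. -/
structure Desc (k : ℕ) (base : ℕ → ℝ) (A u hi nx0 i : ℕ) (a0 : ℕ → ℕ → ℝ) (δ : ℝ)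
    (bad : ℕ → ℕ → Prop) (s : State) (ρ : ℕ → ℕ → ℕ) : Prop where
  D : DS k base A (s.wreg 18) (mem s) ρ
    (Function.update a0 u fun h => a0 u h + δ * prefVec (2 ^ k + hi) i k h) bad
  cur : s.wreg 12 = ρ u ((2 ^ k + hi) / 2 ^ i)
  own : 1 ≤ i → 2 * 2 ^ k ≤ s.wreg 12
  half : s.wreg 13 = 2 ^ i
  rem : s.wreg 14 = hi % 2 ^ i
  stk : ∀ j, i ≤ j → j < k → s.warr 23 j = ρ u ((2 ^ k + hi) / 2 ^ (j + 1)) ∧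
    2 * 2 ^ k ≤ s.warr 23 j
  nx : s.wreg 18 + i ≤ nx0 + k

/-- The levels of the heap are disjoint intervals of indices. This separates ancestors of different
heights. -/
theorem pow_div_bounds {k hi i : ℕ} (h : hi < 2 ^ k) (hi' : i ≤ k) :
    2 ^ (k - i) ≤ (2 ^ k + hi) / 2 ^ i ∧ (2 ^ k + hi) / 2 ^ i < 2 * 2 ^ (k - i) := by
  have hp : 0 < 2 ^ i := by positivity
  have e : 2 ^ (k - i) * 2 ^ i = 2 ^ k := by rw [← pow_add]; congr 1; omega
  rw [Nat.le_div_iff_mul_le hp, Nat.div_lt_iff_lt_mul hp]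
  constructor
  · omega
  · rw [mul_assoc]; omega

/-- When the path to the leaf `hi` turns right, the whole left half of the node lies before `hi`,
and this is exactly what the addition field of the node covers. When the path turns left, nothing is
recorded at this node. -/
theorem descBody_ok {s : State} {u hi nx0 i : ℕ} {δ : ℝ}
    (hik : i < k) (hu : u < A) (hhi : hi < 2 ^ k)
    (hb : ∀ j, i ≤ j → j < k → bad u ((2 ^ k + hi) / 2 ^ (j + 1)))
    (hD : Desc k base A u hi nx0 (i + 1) a δ bad s ρ) (hd : s.wreg 15 = i) (hδ : s.rreg 2 = δ)
    (hN2 : s.wreg 19 = 2 * 2 ^ k) (hW : nx0 + k ≤ W) :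
    Ok W descBody s 90 fun s' => ∃ ρ', Desc k base A u hi nx0 i a δ bad s' ρ' := by
  obtain ⟨D, hcur, hown, hhalf, hrem, hstk, hnx⟩ := hD
  have hp : 0 < 2 ^ i := by positivity
  have hpk : 2 ^ i < 2 ^ k := Nat.pow_lt_pow_right (by norm_num) hik
  have hpk1 : 2 ^ (i + 1) ≤ 2 ^ k := Nat.pow_le_pow_right (by norm_num) hik
  have hnxg := D.nx_ge
  have hbd := pow_div_bounds hhi (i := i + 1) hik
  have hbd2 := pow_div_bounds hhi (i := i) hik.le
  have hdd : (2 ^ k + hi) / 2 ^ (i + 1) = (2 ^ k + hi) / 2 ^ i / 2 := by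
    rw [pow_succ, Nat.div_div_eq_div_mul]
  have hmod : hi % 2 ^ (i + 1) < 2 ^ (i + 1) := Nat.mod_lt _ (by positivity)
  have hbit := div_pow_bit (hi := hi) hik
  have hmod2 : hi % 2 ^ (i + 1) = hi % 2 ^ i + 2 ^ i * (hi / 2 ^ i % 2) := Nat.mod_pow_succ
  have hbit2 : hi / 2 ^ i % 2 = hi % 2 ^ (i + 1) / 2 ^ i := by
    rw [pow_succ, Nat.mod_mul_right_div_self]
  set y := 2 ^ k + hi with hy
  have hh1 : 1 ≤ y / 2 ^ (i + 1) := le_trans Nat.one_le_two_pow hbd.1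
  have e1 : 2 ^ (k - (i + 1)) * 2 ^ (i + 1) = 2 ^ k := by rw [← pow_add]; congr 1; omega
  have e2 : 2 ^ (k - i) * 2 ^ i = 2 ^ k := by rw [← pow_add]; congr 1; omega
  have hh2 : y / 2 ^ (i + 1) < 2 ^ k := by
    have : 2 * 2 ^ (k - (i + 1)) ≤ 2 ^ (k - (i + 1)) * 2 ^ (i + 1) := by
      rw [mul_comm 2]; exact Nat.mul_le_mul_left _ (by rw [pow_succ]; omega)
    omega
  have ho := hown (by omega)
  rw [hcur] at ho
  have hcW := D.lt_nx hu hh1 (by omega)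
  have hci : 1 ≤ i ↔ y / 2 ^ i < 2 ^ k := by
    constructor
    · intro h
      have : 2 * 2 ^ (k - i) ≤ 2 ^ (k - i) * 2 ^ i := by
        rw [mul_comm 2]
        exact Nat.mul_le_mul_left _ (by calc 2 = 2 ^ 1 := rfl
                                          _ ≤ 2 ^ i := Nat.pow_le_pow_right (by norm_num) h)
      omega
    · intro h
      by_contra h0
      obtain rfl : i = 0 := by omega
      simp at h; omega
  have hik2 : i < 2 ^ k := hik.trans Nat.lt_two_pow_self
  refine (Ok.seq (T := 3) (T' := 87) (Ok.line (by simp) ?_)).mono le_rfl fun _ => id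
  simp only [wp, WExp.eval, hd, hcur]
  refine ⟨by omega, by omega, ?_⟩
  refine (Ok.seq (T := 4) (T' := 83) (Ok.line (by simp) ?_)).mono le_rfl fun _ => id
  have hhalf2 : 2 ^ (i + 1) / 2 = 2 ^ i := by rw [pow_succ]; omega
  simp only [wp, WExp.eval, storeW_wreg, hhalf, hhalf2]
  refine ⟨by omega, ?_⟩
  -- the step to the child, from any memory with the right contents
  have fin : ∀ (s1 : State) (X r : ℕ), (X = 20 ∧ y / 2 ^ i = 2 * (y / 2 ^ (i + 1))) ∨
      (X = 21 ∧ y / 2 ^ i = 2 * (y / 2 ^ (i + 1)) + 1) →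
      s1.wreg 12 = s.wreg 12 → s1.wreg 13 = 2 ^ i → s1.wreg 14 = hi % 2 ^ i →
      s1.wreg 15 = i → s1.wreg 18 = s.wreg 18 → s1.wreg 19 = s.wreg 19 →
      s1.warr 23 = Function.update (s.warr 23) i (s.wreg 12) →
      DS k base A (s.wreg 18) (mem s1) ρ
        (Function.update a u fun h => a u h + δ * prefVec y i k h) bad →
      Ok W (stepChild X) s1 60 fun s' => ∃ ρ', Desc k base A u hi nx0 i a δ bad s' ρ' := by
    intro s1 X r hX g12 g13 g14 g15 g18 g19 g23 D1
    rw [← g18] at D1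
    refine (stepChild_ok (W := W) hX D1 hu hh1 hh2 ho (by rw [g12, hcur]) (by rw [g19, hN2])
      (by rw [g15]; exact hci) (by omega)).fr.mono le_rfl ?_
    rintro s' ⟨⟨ρ', D', c1, c2, c3, c4⟩, hF⟩
    have hX' : ∀ x ∈ [13, 14, 15], s'.wreg x = s1.wreg x := by
      intro x hx
      apply hF.wreg
      fin_cases hx <;> simp [stepChild, Prog.ww]
    have h23 : s'.warr 23 = s1.warr 23 := by
      apply hF.warr
      rcases hX with ⟨rfl, -⟩ | ⟨rfl, -⟩ <;> simp [stepChild, Prog.wa]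
    refine ⟨ρ', D', c1, ?_, ?_, ?_, ?_, by omega⟩
    · intro hi1; rw [c1]; exact c2 (hci.1 hi1)
    · rw [hX' 13 (by simp), g13]
    · rw [hX' 14 (by simp), g14]
    · intro j hj hjk
      rw [h23, g23]
      have hne : y / 2 ^ (j + 1) ≠ y / 2 ^ i := by
        have : y / 2 ^ (j + 1) ≤ y / 2 ^ (i + 1) :=
          Nat.div_le_div_left (Nat.pow_le_pow_right (by norm_num) (by omega)) (by positivity)
        omega
      rw [c4 _ _ (by tauto)]
      by_cases hji : j = i
      · subst hji
        rw [Function.update_self, hcur]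
        exact ⟨rfl, ho⟩
      · rw [Function.update_of_ne hji]
        exact hstk j (by omega) hjk
  refine (Ok.ite (T := 79) (fun hb' => ?_) (fun hb' => ?_)).mono (by simp) fun _ => id
  · simp only [Test.Holds, WExp.eval, setW_wreg, storeW_wreg, hrem] at hb'
    norm_num at hb'
    have hq : hi % 2 ^ (i + 1) / 2 ^ i = 1 := by
      rw [Nat.div_eq_iff hp, pow_succ] at *
      constructor <;> omega
    have hr : hi % 2 ^ (i + 1) = hi % 2 ^ i + 2 ^ i := by
      rw [hmod2, hbit2, hq, mul_one]
    refine (Ok.seq (T := 19) (T' := 60) (Ok.line (by simp) ?_)).mono (by simp) fun _ => id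
    simp [hcur, hrem]
    refine ⟨by omega, by omega, fin _ 21 0 (Or.inr ⟨rfl, by omega⟩) (by simp) (by simp)
      (by simp; omega) (by simp [hd]) (by simp) (by simp) (by simp [hcur]) ?_⟩
    have D2 := D.addAD hu hh1 hh2 ho (hb i le_rfl hik) δ
    convert D2 using 1
    · simp [mem, hδ]
    · ext u' h'
      by_cases hu' : u' = u
      · subst hu'
        simp only [Function.update_self, prefVec_succ hik, hbit, hq, and_true]
        by_cases hh' : h' = y / 2 ^ (i + 1)
        · subst hh'; simp; ring
        · simp [hh']
      · simp [hu']
  · simp only [Test.Holds, WExp.eval, setW_wreg, storeW_wreg, hrem] at hb'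
    norm_num at hb'
    have hq : hi % 2 ^ (i + 1) / 2 ^ i = 0 := Nat.div_eq_of_lt hb'
    have hr : hi % 2 ^ (i + 1) = hi % 2 ^ i := by
      rw [hmod2, hbit2, hq, mul_zero, add_zero]
    refine (fin _ 20 0 (Or.inl ⟨rfl, by omega⟩) (by simp) (by simp)
      (by simp; omega) (by simp [hd]) (by simp) (by simp) (by simp [hcur]) ?_).mono
      (by norm_num) fun _ => id
    convert D using 1
    · simp [mem]
    · simp [prefVec_succ hik, hbit, hq]

/-- The descent records the additions and stacks the nodes of its path; the second loop then
recomputes their minima from the lowest node to the root. Each level creates at most one node,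
whence the bound `k`. -/
theorem prefAdd_ok {s : State} {u hi : ℕ} {δ : ℝ}
    (D : DS k base A (s.wreg 18) (mem s) ρ a fun _ _ => False)
    (hu : u < A) (hhi : hi < 2 ^ k) (hu' : s.wreg 10 = u) (hhi' : s.wreg 11 = hi)
    (hδ : s.rreg 2 = δ) (hk : s.wreg 16 = k) (hk1 : 1 ≤ k) (hN : s.wreg 20 = 2 ^ k)
    (hN2 : s.wreg 19 = 2 * 2 ^ k) (hW : s.wreg 18 + k ≤ W) :
    Ok W prefAdd s (160 * k + 30) fun s' => ∃ ρ',
      DS k base A (s'.wreg 18) (mem s') ρ'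
        (Function.update a u fun h => a u h + δ * prefVec (2 ^ k + hi) 0 k h) (fun _ _ => False) ∧
      s'.wreg 18 ≤ s.wreg 18 + k := by
  have hnxg := D.nx_ge
  have hpk : k < 2 ^ k := Nat.lt_two_pow_self
  have hroot := D.root u hu
  have hrlt := D.lt_nx hu (h := 1) le_rfl (by omega)
  refine (Ok.seq (T := 10) (T' := (k * (90 + 7) + 3) + (k * (50 + 8) + 4 + 10))
    (Ok.line (by simp) ?_)).mono (by omega) fun _ => id
  simp [hu', hhi', hk, hN, hN2]
  refine ⟨by omega, by omega, by omega, by omega, ?_⟩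
  -- All the inner positions above the leaf `hi` count as stale from the beginning, so that
  -- additions may be made there.
  set bad0 : ℕ → ℕ → Prop := fun u' h => u' = u ∧ ∃ j < k, h = (2 ^ k + hi) / 2 ^ (j + 1)
    with hbad0
  have hbase := pow_div_bounds hhi (i := k) le_rfl
  simp only [Nat.sub_self, pow_zero] at hbase
  refine Ok.seq' (Ok.forDown (W := W) (fun i s' => ∃ ρ', Desc k base A u hi (s.wreg 18) i a δ bad0 s' ρ')
    (N := k) 90 (by decide) (by simp) (by omega) ⟨ρ, ?_⟩ ?_) ?_
  · refine ⟨?_, ?_, ?_, by simp, ?_, ?_, ?_⟩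
    · simp only [prefVec, Finset.Ico_self, Finset.sum_empty, mul_zero, add_zero,
        Function.update_eq_self]
      exact D.mono fun _ _ _ _ _ h => h.elim
    · simp [show (2 ^ k + hi) / 2 ^ k = 1 by omega, hroot]
    · simp
    · simp [Nat.mod_eq_of_lt hhi]
    · intro j h1 h2; omega
    · simp
  · rintro i s1 hik ⟨ρ1, hD⟩ hi1 hF
    have f19 := hF.wreg 19 (by decide)
    have f2 := hF.rreg 2 (by decide)
    simp [hN2, hδ] at f19 f2
    refine descBody_ok (ρ := ρ1) hik hu hhi ?_ ?_ (by simp) (by simpa using f2)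
      (by simpa using f19) hW
    · intro j _ hj; exact ⟨rfl, j, hj, rfl⟩
    · obtain ⟨D, hcur, hown, hhalf, hrem, hstk, hnx⟩ := hD
      exact ⟨by simpa [mem] using D, by simpa using hcur, by simpa using hown,
        by simpa using hhalf, by simpa using hrem, by simpa using hstk, by simpa using hnx⟩
  · rintro s1 ⟨⟨ρ1, hD⟩, h15⟩ hF
    have f16 := hF.wreg 16 (by decide)
    simp [hk] at f16
    obtain ⟨D1, -, -, -, -, hstk, hnx⟩ := hD
    refine (Ok.forUp (W := W) (fun i s' => s'.wreg 18 = s1.wreg 18 ∧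
        DS k base A (s1.wreg 18) (mem s') ρ1
      (Function.update a u fun h => a u h + δ * prefVec (2 ^ k + hi) 0 k h)
      (fun u' h => u' = u ∧ ∃ j < k, i ≤ j ∧ h = (2 ^ k + hi) / 2 ^ (j + 1))) (a := 0)
      (N := k) 50 (by decide) (by decide) (by decide) h15 f16 (by omega) (by omega) ?_ ?_).mono
      (by omega) ?_
    · exact ⟨rfl, D1.mono fun u' _ h _ _ hb => ⟨hb.1, by simpa using hb.2⟩⟩
    · rintro i s2 - hik ⟨i18, DI⟩ i15 hF2
      have f23 := hF2.warr 23 (by decide)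
      have hbd := pow_div_bounds hhi (i := i + 1) hik
      have hs := hstk i (by omega) hik
      have hlt := D1.lt_nx hu (h := (2 ^ k + hi) / 2 ^ (i + 1))
      have hh1 : 1 ≤ (2 ^ k + hi) / 2 ^ (i + 1) := le_trans Nat.one_le_two_pow hbd.1
      have hh2 : (2 ^ k + hi) / 2 ^ (i + 1) < 2 ^ k := by
        have := D1.own u hu
        have e1 : 2 ^ (k - (i + 1)) * 2 ^ (i + 1) = 2 ^ k := by rw [← pow_add]; congr 1; omega
        have : 2 * 2 ^ (k - (i + 1)) ≤ 2 ^ (k - (i + 1)) * 2 ^ (i + 1) := by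
          rw [mul_comm 2]; exact Nat.mul_le_mul_left _ (by rw [pow_succ]; have : 0 < 2 ^ i := by positivity
                                                           omega)
        omega
      have hlt := D1.lt_nx hu hh1 (by omega)
      refine (Ok.seq (T := 5) (T' := 40) (Ok.line (by simp) ?_)).mono (by omega) fun _ => id
      simp only [wp, WExp.eval, i15, f23, hs.1]
      refine ⟨by omega, ?_⟩
      refine (pull_ok (u := u) (h := (2 ^ k + hi) / 2 ^ (i + 1)) (W := W) (by simpa [mem, i18] using DI)
        hu hh1 hh2 (by rw [← hs.1]; exact hs.2) (by simp) (by simp; omega) ?_).fr.mono le_rfl ?_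
      · intro h' hh' hc
        -- The node pulled here has height `i + 1`, and its parent is the one pulled in the next
        -- round. If `i + 1 = k` the node is the root, which has no parent of index at least 1.
        refine ⟨rfl, i + 1, ?_, by omega, ?_⟩
        · by_contra hcon
          obtain rfl : k = i + 1 := by omega
          simp at hbd
          omega
        · rw [pow_succ _ (i + 1), ← Nat.div_div_eq_div_mul]; omega
      · rintro s3 ⟨D3, hF3⟩
        have f18 := hF3.wreg 18 (by decide)
        simp only [setW_wreg] at f18 D3
        norm_num at f18 D3
        simp only [setW_wreg]
        refine ⟨by norm_num; omega, ?_⟩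
        rw [i18] at D3
        refine DS.mono (bad := _) (by simpa [mem] using D3) ?_
        intro u' hu' h' h1 h2 hb
        by_cases he : u' = u
        · subst he
          simp only [Function.update_self] at hb
          obtain ⟨⟨j, hj, hij, rfl⟩, hne⟩ := hb
          refine ⟨rfl, j, hj, ?_, rfl⟩
          by_contra hcon
          obtain rfl : j = i := by omega
          exact hne rfl
        · rw [Function.update_of_ne he] at hb
          exact absurd hb.1 he
    · rintro s2 ⟨⟨i18, DI⟩, -⟩
      refine ⟨⟨ρ1, ?_⟩, by omega⟩
      rw [i18]
      exact DI.mono fun u' _ h _ _ hb => by obtain ⟨-, j, hj, hkj, -⟩ := hb; omega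

end RAM

/-! ## Ancestors, heavy paths, and adding to the ancestors of a vertex -/

/-- `u` is an ancestor of `x`, or `x` itself, in the tree on `0, 1, 2, …` with root `0`. -/
inductive Anc (par : ℕ → ℕ) (u : ℕ) : ℕ → Prop where
  | refl : Anc par u u
  | step {x : ℕ} : 0 < x → Anc par u (par x) → Anc par u x

theorem anc_iff {par : ℕ → ℕ} {u x : ℕ} : Anc par u x ↔ u = x ∨ (0 < x ∧ Anc par u (par x)) := by
  constructor
  · rintro (_ | ⟨h, h'⟩)
    · exact Or.inl rfl
    · exact Or.inr ⟨h, h'⟩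
  · rintro (rfl | ⟨h, h'⟩)
    · exact .refl
    · exact .step h h'

/-- A tree whose vertices are numbered such that parents come first, and heavy paths are
contiguous; `head` is the top of the heavy path of a vertex. -/
structure Layout (n : ℕ) (par head ld : ℕ → ℕ) : Prop where
  par_lt : ∀ i < n, 0 < i → par i < i
  head_zero : head 0 = 0
  head_step : ∀ i < n, 0 < i → head i = i ∨ (par i = i - 1 ∧ head i = head (i - 1))
  ld_lt : ∀ i < n, head i ≠ 0 → ld (par (head i)) < ld i

namespace Layout

variable {n : ℕ} {par head ld : ℕ → ℕ}

theorem anc_le (L : Layout n par head ld) {u x : ℕ} (hx : x < n) (h : Anc par u x) : u ≤ x := by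
  induction h with
  | refl => exact le_rfl
  | step h0 _ ih => have := L.par_lt _ hx h0; have := ih (by omega); omega

theorem head_le (L : Layout n par head ld) {x : ℕ} (hx : x < n) : head x ≤ x := by
  induction x using Nat.strong_induction_on with
  | _ x ih =>
    rcases Nat.eq_zero_or_pos x with rfl | h0
    · rw [L.head_zero]
    · rcases L.head_step x hx h0 with h | ⟨_, h⟩
      · omega
      · have := ih (x - 1) (by omega) (by omega); omega

/-- Along a heavy path the parent is the predecessor, so the part of the root path on the heavy path
of `x` is an interval ending at `x`. The rest starts at the parent of the head, unless the head is
the root. -/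
theorem anc_chain (L : Layout n par head ld) {u x : ℕ} (hx : x < n) :
    Anc par u x ↔ (head x ≤ u ∧ u ≤ x) ∨ (head x ≠ 0 ∧ Anc par u (par (head x))) := by
  induction x using Nat.strong_induction_on with
  | _ x ih =>
    rcases Nat.eq_zero_or_pos x with rfl | h0
    · rw [anc_iff, L.head_zero]; simp
    · rw [anc_iff]
      rcases L.head_step x hx h0 with h | ⟨hp, h⟩
      · rw [h]
        constructor
        · rintro (rfl | h)
          · simp
          · right; exact ⟨by omega, h.2⟩
        · rintro (h | h)
          · left; omega
          · right; exact ⟨h0, h.2⟩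
      · have hl := L.head_le (x := x - 1) (by omega)
        rw [hp, ih (x - 1) (by omega) (by omega), h]
        constructor
        · rintro (rfl | ⟨_, h | h⟩)
          · left; omega
          · left; omega
          · right; exact h
        · rintro (h | h)
          · by_cases hux : u = x
            · left; exact hux
            · right; exact ⟨h0, Or.inl (by omega)⟩
          · right; exact ⟨h0, Or.inr h⟩

/-- A heavy path has one head. -/
theorem head_eq (L : Layout n par head ld) {u x : ℕ} (hx : x < n) (h : head x ≤ u) (h' : u ≤ x) :
    head u = head x := by
  induction x using Nat.strong_induction_on with
  | _ x ih =>
    rcases Nat.eq_or_lt_of_le h' with rfl | h'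
    · rfl
    · rcases L.head_step x hx (by omega) with h2 | ⟨hp, h2⟩
      · omega
      · rw [h2, ih (x - 1) (by omega) (by omega) (by omega) (by omega)]

end Layout

/-! ### Leaf sums of prefix additions, and additions along root paths -/

namespace RAM

/-- The sum of the additions that concern the leaf `w`. -/
noncomputable def leafSum (k : ℕ) (a : ℕ → ℝ) (w : ℕ) : ℝ :=
  ∑ d ∈ Finset.range k, if (2 ^ k + w) / 2 ^ d % 2 = 0 then a ((2 ^ k + w) / 2 ^ (d + 1)) else 0

theorem leafSum_add (k : ℕ) (a b : ℕ → ℝ) (w : ℕ) :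
    leafSum k (fun h => a h + b h) w = leafSum k a w + leafSum k b w := by
  unfold leafSum
  rw [← Finset.sum_add_distrib]
  exact Finset.sum_congr rfl fun d _ => by split_ifs <;> simp

theorem leafSum_mul (k : ℕ) (c : ℝ) (b : ℕ → ℝ) (w : ℕ) :
    leafSum k (fun h => c * b h) w = c * leafSum k b w := by
  unfold leafSum
  rw [Finset.mul_sum]
  exact Finset.sum_congr rfl fun d _ => by split_ifs <;> simp

/-- If `x < y` agree beyond the lowest `k` bits, then exactly one bit is 0 in `x` and 1 in `y` with
all higher bits equal, namely the highest one where they differ; otherwise there is none. The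
induction splits off the lowest bit. -/
theorem sum_bits_lt (k x y : ℕ) (h : x / 2 ^ k = y / 2 ^ k) :
    (∑ d ∈ Finset.range k, if x / 2 ^ d % 2 = 0 ∧ y / 2 ^ d % 2 = 1 ∧
      x / 2 ^ (d + 1) = y / 2 ^ (d + 1) then (1 : ℝ) else 0) = if x < y then 1 else 0 := by
  induction k generalizing x y with
  | zero => simp at h; simp [h]
  | succ k ih =>
    have e : ∀ (z d : ℕ), z / 2 ^ (d + 1) = z / 2 / 2 ^ d := fun z d => by
      rw [pow_succ', Nat.div_div_eq_div_mul]
    rw [Finset.sum_range_succ']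
    have := ih (x / 2) (y / 2) (by rw [← e, ← e]; exact h)
    simp only [e] at this ⊢
    rw [this]
    simp only [pow_zero, Nat.div_one]
    split_ifs <;> first | omega | norm_num

/-- An addition made on the path to `hi` concerns the leaf `w` iff it sits where the two paths part,
with `w` on the left and `hi` on the right. This occurs once if `w < hi` and never otherwise, by
`sum_bits_lt`. -/
theorem leafSum_prefVec {k w hi : ℕ} (hw : w < 2 ^ k) (hhi : hi < 2 ^ k) :
    leafSum k (prefVec (2 ^ k + hi) 0 k) w = if w < hi then 1 else 0 := by
  have := sum_bits_lt k (2 ^ k + w) (2 ^ k + hi) (by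
    rw [Nat.add_div_left _ (by positivity), Nat.add_div_left _ (by positivity),
      Nat.div_eq_of_lt hw, Nat.div_eq_of_lt hhi])
  rw [show (if w < hi then (1 : ℝ) else 0) = if 2 ^ k + w < 2 ^ k + hi then 1 else 0 by simp,
    ← this]
  unfold leafSum prefVec
  refine Finset.sum_congr rfl fun d hd => ?_
  rw [Finset.mem_range] at hd
  by_cases h0 : (2 ^ k + w) / 2 ^ d % 2 = 0
  · simp only [h0, true_and, if_true]
    rw [Finset.sum_eq_single d]
    · simp only [and_comm]
    -- Ancestors of different heights lie on different levels, so only the term `j = d` survives.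
    · intro j hj hne
      rw [Finset.mem_Ico] at hj
      rw [if_neg]
      rintro ⟨h1, -⟩
      have b1 := pow_div_bounds hw (i := d + 1) hd
      have b2 := pow_div_bounds hhi (i := j + 1) hj.2
      rw [h1] at b1
      rcases lt_or_gt_of_ne hne with h | h
      · have : 2 * 2 ^ (k - (d + 1)) ≤ 2 ^ (k - (j + 1)) := by
          rw [← pow_succ']; exact Nat.pow_le_pow_right (by norm_num) (by omega)
        omega
      · have : 2 * 2 ^ (k - (j + 1)) ≤ 2 ^ (k - (d + 1)) := by
          rw [← pow_succ']; exact Nat.pow_le_pow_right (by norm_num) (by omega)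
        omega
    · intro h; simp at h; omega
  · simp [h0]

/-- Add the weight `reg 4` to the ancestors of `reg 22` in the tree `reg 10`. -/
def addAnc : Prog :=
  .seq (.wset 23 (.const 0))
  (.loop (.weq (.reg 23) (.const 0))
    (.seq (.seq (.wset 21 (.load 14 (.reg 22)))
      (.seq (.rset 2 (.reg 4)) (.wset 11 (.add (.reg 22) (.const 1)))))
    (.seq prefAdd
    (.seq (.seq (.rset 2 (.sub .zero (.reg 4))) (.wset 11 (.reg 21)))
    (.seq prefAdd
    (.ite (.weq (.reg 21) (.const 0)) (.wset 23 (.const 1)) (.wset 22 (.load 15 (.reg 21)))))))))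

variable {W k A n : ℕ} {base : ℕ → ℝ} {ρ : ℕ → ℕ → ℕ} {a : ℕ → ℕ → ℝ} {bad : ℕ → ℕ → Prop}
  {par head ld : ℕ → ℕ}

/-- The forest has the leaf sums `F u w`. -/
def Forest (k : ℕ) (base : ℕ → ℝ) (A : ℕ) (F : ℕ → ℕ → ℝ) (s : State) : Prop :=
  ∃ ρ a, DS k base A (s.wreg 18) (mem s) ρ a (fun _ _ => False) ∧
    ∀ u < A, ∀ w < 2 ^ k, leafSum k (a u) w = F u w

theorem Forest.congr {F : ℕ → ℕ → ℝ} {s s' : State} (h : Forest k base A F s)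
    (h18 : s'.wreg 18 = s.wreg 18) (hm : mem s' = mem s) : Forest k base A F s' := by
  unfold Forest at *; rw [h18, hm]; exact h

/-- From here on the trees are described by their leaf sums alone; the shape of the trees and the
places of the additions are forgotten. -/
theorem prefAdd_forest {s : State} {F : ℕ → ℕ → ℝ} {u hi : ℕ} (hF : Forest k base A F s)
    (hu : u < A) (hhi : hi < 2 ^ k) (hu' : s.wreg 10 = u) (hhi' : s.wreg 11 = hi)
    (hk : s.wreg 16 = k) (hk1 : 1 ≤ k) (hN : s.wreg 20 = 2 ^ k)
    (hN2 : s.wreg 19 = 2 * 2 ^ k) (hW : s.wreg 18 + k ≤ W) :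
    Ok W prefAdd s (160 * k + 30) fun s' =>
      Forest k base A (fun u' w => F u' w + if u' = u ∧ w < hi then s.rreg 2 else 0) s' ∧
      s'.wreg 18 ≤ s.wreg 18 + k := by
  obtain ⟨ρ, a, D, hS⟩ := hF
  refine (prefAdd_ok D hu hhi hu' hhi' rfl hk hk1 hN hN2 hW).mono le_rfl ?_
  rintro s' ⟨ρ', D', hnx⟩
  refine ⟨⟨ρ', _, D', fun u' hu' w hw => ?_⟩, hnx⟩
  by_cases he : u' = u
  · subst he
    rw [Function.update_self, leafSum_add, leafSum_mul, leafSum_prefVec hw hhi, hS _ hu w hw]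
    simp
  · rw [Function.update_of_ne he, hS _ (by assumption) w hw]
    simp [he]

set_option maxHeartbeats 1000000 in
open Classical in
-- Adding on the prefix up to `z` and subtracting on the prefix before `head z` leaves the interval
-- of the heavy path of `z`; the rest is done from the parent of the head. The light depth drops in
-- each round, so there are at most `ld z + 1` rounds, each with two prefix additions and at most `2
-- * k` new nodes.
theorem addAnc_ok {s : State} {F : ℕ → ℕ → ℝ} {u z : ℕ} (hF : Forest k base A F s)
    (L : Layout n par head ld) (hhead : ∀ i < n, s.warr 14 i = head i)
    (hpar : ∀ i < n, s.warr 15 i = par i)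
    (hu : u < A) (hz : z < n) (hn : n < 2 ^ k) (hu' : s.wreg 10 = u) (hz' : s.wreg 22 = z)
    (hk : s.wreg 16 = k) (hk1 : 1 ≤ k) (hN : s.wreg 20 = 2 ^ k)
    (hN2 : s.wreg 19 = 2 * 2 ^ k) (hW : s.wreg 18 + 2 * k * (ld z + 1) ≤ W) :
    Ok W addAnc s ((ld z + 1) * (320 * k + 120) + 10) fun s' =>
      Forest k base A (fun u' w => F u' w + if u' = u ∧ Anc par w z then s.rreg 4 else 0) s' ∧
      s'.wreg 18 ≤ s.wreg 18 + 2 * k * (ld z + 1) := by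
  have hnxg : 2 * 2 ^ k + A ≤ s.wreg 18 := by
    obtain ⟨ρ, a, D, hS⟩ := hF; exact D.nx_ge
  refine (Ok.seq (T := 2) (T' := (ld z + 1) * (320 * k + 120) + 8) (Ok.line (by simp) ?_)).mono
    (by omega) fun _ => id
  simp only [wp, WExp.eval]
  refine ⟨by omega, ?_⟩
  -- The ghost `r` bounds the rounds left. While register 23 is 0, the forest has received the
  -- ancestors of `z` except those of the current vertex in register 22; the value 1 says that the
  -- root has been passed.
  refine Ok.loop (fun (r : ℕ) s' => s'.wreg 18 + 2 * k * r ≤ s.wreg 18 + 2 * k * (ld z + 1) ∧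
    ((s'.wreg 23 = 0 ∧ r = ld (s'.wreg 22) + 1 ∧ s'.wreg 22 < n ∧ Forest k base A (fun u' w =>
      F u' w + if u' = u then (if Anc par w z then s.rreg 4 else 0) -
        (if Anc par w (s'.wreg 22) then s.rreg 4 else 0) else 0) s') ∨
    (s'.wreg 23 = 1 ∧ r = 0 ∧ Forest k base A (fun u' w =>
      F u' w + if u' = u ∧ Anc par w z then s.rreg 4 else 0) s')))
    (fun r => r * (320 * k + 120) + 8) (ld z + 1) ?_ ?_ ?_
  · refine ⟨by simp, Or.inl ⟨by simp, by simp [hz'], by simp [hz', hz], ?_⟩⟩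
    refine Forest.congr (s := s) ?_ (by simp) (by simp [mem])
    simpa [hz'] using hF
  · rintro r s' ⟨h18, ⟨h23, -⟩ | ⟨h23, rfl, hF'⟩⟩ - hb
    · simp [h23] at hb
    · refine ⟨by simp, hF', by omega⟩
  · rintro r s1 ⟨h18, ⟨h23, rfl, hzn, hF1⟩ | ⟨h23, -⟩⟩ hFr hb
    swap
    · simp [h23] at hb
    have f16 := hFr.wreg 16 (by decide)
    have f20 := hFr.wreg 20 (by decide)
    have f19 := hFr.wreg 19 (by decide)
    have f10 := hFr.wreg 10 (by decide)
    have f4 := hFr.rreg 4 (by decide)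
    have f14 := hFr.warr 14 (by decide)
    have f15 := hFr.warr 15 (by decide)
    simp [hk, hN, hN2, hu'] at f16 f20 f19 f10 f14 f15 f4
    generalize hz1 : s1.wreg 22 = z1 at *
    have hh1 := L.head_le hzn
    have hnx1 : 2 * 2 ^ k + A ≤ s1.wreg 18 := by
      obtain ⟨ρ, a, D, hS⟩ := hF1; exact D.nx_ge
    have hm1 : 2 * k ≤ 2 * k * (ld z1 + 1) := Nat.le_mul_of_pos_right _ (Nat.succ_pos _)
    have hm2 : 320 * k + 120 ≤ (ld z1 + 1) * (320 * k + 120) :=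
      Nat.le_mul_of_pos_left _ (Nat.succ_pos _)
    have hx1 : s1.wreg 18 + 2 * k ≤ W := by omega
    refine ⟨320 * k + 110, ?_⟩
    refine (Ok.seq (T := 9) (T' := 320 * k + 100) (Ok.line (by simp) ?_)).mono (by omega)
      fun _ => id
    simp only [wp, WExp.eval, RExp.eval, setW_wreg, setW_rreg, setR_wreg, hz1, f14, hhead _ hzn, f4]
    refine ⟨by omega, by norm_num; omega, ?_⟩
    refine (Ok.seq' (T := 160 * k + 30) (T' := 160 * k + 70) (prefAdd_forest (F := _) (u := u)
      (hi := z1 + 1) (W := W) (Forest.congr hF1 (by simp) (by simp [mem])) hu (by omega) (by simp [f10])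
      (by simp) (by simp [f16]) hk1 (by simp [f20]) (by simp [f19]) (by simp; omega)) ?_).mono
      (by omega) fun _ => id
    rintro s2 ⟨hF2, g18⟩ hFr2
    have i22 := hFr2.wreg 22 (by decide)
    have i21 := hFr2.wreg 21 (by decide)
    have i16 := hFr2.wreg 16 (by decide)
    have i20 := hFr2.wreg 20 (by decide)
    have i19 := hFr2.wreg 19 (by decide)
    have i10 := hFr2.wreg 10 (by decide)
    have i4 := hFr2.rreg 4 (by decide)
    have i15 := hFr2.warr 15 (by decide)
    have i23 := hFr2.wreg 23 (by decide)
    simp [f16, f20, f19, f10, f15, f4, hz1, h23] at i22 i21 i16 i20 i19 i10 i4 i15 g18 hF2 i23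
    refine (Ok.seq (T := 6) (T' := 160 * k + 60) (Ok.line (by simp) ?_)).mono (by omega)
      fun _ => id
    simp only [wp, WExp.eval, RExp.eval, setR_wreg, i21, i4]
    refine ⟨by omega, ?_⟩
    refine (Ok.seq' (T := 160 * k + 30) (T' := 20) (prefAdd_forest (F := _) (u := u)
      (hi := head z1) (W := W) (Forest.congr hF2 (by simp) (by simp [mem])) hu (by omega)
      (by simp [i10]) (by simp) (by simp [i16]) hk1 (by simp [i20]) (by simp [i19])
      (by simp; omega)) ?_).mono (by omega) fun _ => id
    rintro s3 ⟨hF3, j18⟩ hFr3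
    have j22 := hFr3.wreg 22 (by decide)
    have j21 := hFr3.wreg 21 (by decide)
    have j15 := hFr3.warr 15 (by decide)
    have j23 := hFr3.wreg 23 (by decide)
    simp [i22, i21, i15, i23] at j22 j21 j15 j18 j23 hF3
    refine Ok.line (by simp) ?_
    have hchain := fun w => L.anc_chain (u := w) hzn
    simp only [wp, WExp.eval, Test.Holds, j21, j15]
    refine ⟨fun hc => ⟨by omega, 0, ⟨by simp; omega, Or.inr ⟨by simp, rfl, ?_⟩⟩, ?_⟩,
      fun hc => ?_⟩
    · refine Forest.congr (s := s3) ?_ (by simp) (by simp [mem])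
      convert hF3 using 3 with u' w
      rw [hchain w, hc]
      by_cases he : u' = u
      · by_cases hw : w ≤ z1
        · simp [he, hw]
          ring
        · simp [he, hw]
      · simp [he]
    · simp only [Test.cost, WExp.cost]; omega
    · have hld := L.ld_lt z1 hzn hc
      have hhn : head z1 < n := by omega
      have hpl := L.par_lt (head z1) hhn (by omega)
      rw [hpar _ hhn]
      refine ⟨by omega, ld (par (head z1)) + 1, ⟨?_, Or.inl ⟨by simp [j23], by simp,
        by simp; omega, ?_⟩⟩, ?_⟩
      · simp
        have : 2 * k * (ld (par (head z1)) + 1 + 1) ≤ 2 * k * (ld z1 + 1) :=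
          Nat.mul_le_mul_left _ (by omega)
        rw [mul_add _ _ 1] at this
        omega
      · refine Forest.congr (s := s3) ?_ (by simp) (by simp [mem])
        convert hF3 using 3 with u' w
        rw [hchain w]
        simp only [setW_wreg, if_true]
        by_cases he : u' = u
        · by_cases hw : Anc par w (par (head z1))
          · have := L.anc_le (by omega) hw
            simp [he, hw, hc, show w ≤ z1 by omega, show w < head z1 by omega]
          · by_cases h1 : head z1 ≤ w
            · by_cases h2 : w ≤ z1
              · simp [he, hw, h1, h2, h1.not_gt]
                ring
              · simp [he, hw, h1, h2, h1.not_gt]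
            · simp [he, hw, h1, show w ≤ z1 by omega, show w < head z1 by omega]
        · simp [he]
      · simp only [Test.cost, WExp.cost]
        have : (ld (par (head z1)) + 1 + 1) * (320 * k + 120) ≤ (ld z1 + 1) * (320 * k + 120) :=
          Nat.mul_le_mul_right _ (by omega)
        rw [add_mul _ 1 (320 * k + 120)] at this
        omega

end RAM

/-! ## Merging two trees -/

namespace RAM

/-- Merge the children (in the array `X`) of the nodes `reg 28` and `reg 29`. -/
def mergeChild (X : ℕ) : Prog :=
  .ite (.wle (.reg 19) (.load X (.reg 29)))
    (.ite (.wle (.reg 19) (.load X (.reg 28)))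
      (.seq (.wstore 24 (.reg 27) (.load X (.reg 28)))
      (.seq (.wstore 25 (.reg 27) (.load X (.reg 29)))
      (.wset 27 (.add (.reg 27) (.const 1)))))
      (.wstore X (.reg 28) (.load X (.reg 29))))
    .skip

/-- Merge the nodes number `reg 26` of the work list. -/
def mergeBody : Prog :=
  .seq (.seq (.wset 28 (.load 24 (.reg 26)))
    (.seq (.wset 29 (.load 25 (.reg 26)))
    (.rstore 2 (.reg 28) (.add (.load 2 (.reg 28)) (.load 2 (.reg 29))))))
  (.seq (mergeChild 20) (.seq (mergeChild 21) (.wset 26 (.add (.reg 26) (.const 1)))))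

/-- Merge the tree `reg 24` into the tree `reg 25`. -/
def merge : Prog :=
  .seq (.seq (.wstore 24 (.const 0) (.add (.reg 19) (.reg 25)))
    (.seq (.wstore 25 (.const 0) (.add (.reg 19) (.reg 24)))
    (.seq (.wset 26 (.const 0)) (.wset 27 (.const 1)))))
  (.seq (.loop (.not (.wle (.reg 27) (.reg 26))) mergeBody)
    (forDown 27 (.seq (.wset 12 (.load 24 (.reg 27))) pullProg)))

variable {W k A nx p v : ℕ} {base : ℕ → ℝ} {M M' : Mem} {ρ : ℕ → ℕ → ℕ} {a : ℕ → ℕ → ℝ}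
  {bad : ℕ → ℕ → Prop}

/-- The heap positions owned by both trees. -/
def Both (k : ℕ) (ρ : ℕ → ℕ → ℕ) (p v h : ℕ) : Prop := 2 * 2 ^ k ≤ ρ p h ∧ 2 * 2 ^ k ≤ ρ v h

/-- The nodes of the merged tree. -/
def mrg (k : ℕ) (ρ : ℕ → ℕ → ℕ) (p v h : ℕ) : ℕ := if 2 * 2 ^ k ≤ ρ p h then ρ p h else ρ v h

/-- A static node has the same links in every view, and in the static view they lead to static
nodes. So the positions owned by a tree are closed under taking parents, and the part below a static
position is entirely static. -/
theorem DS.static_child (D : DS k base A nx M ρ a bad) {u h : ℕ} (hu : u < A) (h1 : 1 ≤ h)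
    (h2 : h < 2 ^ k) (hs : ρ u h = h) : ρ u (2 * h) = 2 * h ∧ ρ u (2 * h + 1) = 2 * h + 1 := by
  have V := D.view u hu
  have e1 := V.lc h h1 h2
  have e2 := V.rc h h1 h2
  rw [hs] at e1 e2
  have s1 := D.stat.lc h h1 h2
  have s2 := D.stat.rc h h1 h2
  omega

/-- At a position that is not owned twice one of the two trees is static, has addition 0 there and
is static below. The merged tree can then take over the node of the other tree with its links,
addition and minimum unchanged. Only the positions owned twice are modified, and only their minima
become stale. -/
theorem DS.mrg_merge (D : DS k base (v + 1) nx M ρ a fun _ _ => False) (hp : p < v)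
    (hB : ∀ h, 1 ≤ h → h < 2 ^ k → Both k ρ p v h → M'.LC (ρ p h) = mrg k ρ p v (2 * h) ∧
      M'.RC (ρ p h) = mrg k ρ p v (2 * h + 1) ∧ M'.AD (ρ p h) = a p h + a v h)
    (hN : ∀ i, (∀ h, 1 ≤ h → h < 2 ^ k → Both k ρ p v h → i ≠ ρ p h) →
      M'.LC i = M.LC i ∧ M'.RC i = M.RC i ∧ M'.AD i = M.AD i)
    (hM : M'.MN = M.MN) (hG : M'.ARG = M.ARG) :
    DS k base v nx M' (Function.update ρ p (mrg k ρ p v))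
      (Function.update a p fun h => a p h + a v h) (fun u h => u = p ∧ Both k ρ p v h) := by
  have hpA : p < v + 1 := by omega
  have hvA : v < v + 1 := by omega
  have hnx := D.nx_ge
  have Vp := D.view p hpA
  have Vv := D.view v hvA
  have hfr : ∀ u < v + 1, ∀ h, 1 ≤ h → h < 2 ^ k → (u = p → ¬ Both k ρ p v h) →
      M'.LC (ρ u h) = M.LC (ρ u h) ∧ M'.RC (ρ u h) = M.RC (ρ u h) ∧
        M'.AD (ρ u h) = M.AD (ρ u h) := by
    intro u hu h h1 h2 hne
    refine hN _ fun h' h1' h2' hb => ?_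
    refine D.ne hpA h1' h2' hu h1 (by omega) hb.1 ?_
    rintro ⟨rfl, rfl⟩
    exact hne rfl hb
  have own' : ∀ h, 1 ≤ h → h < 2 ^ k → ((2 * 2 ^ k ≤ ρ p h ∧ mrg k ρ p v h = ρ p h) ∨
      (ρ p h = h ∧ mrg k ρ p v h = ρ v h)) := by
    intro h h1 h2
    unfold mrg
    rcases D.own p hpA h h1 h2 with h | h
    · right; rw [if_neg (by omega)]; omega
    · left; rw [if_pos h.1]; omega
  have leafm : ∀ h, 2 ^ k ≤ h → h < 2 * 2 ^ k → mrg k ρ p v h = h := by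
    intro h h1 h2
    unfold mrg
    rw [(Vp.leaf h h1 h2).1, (Vv.leaf h h1 h2).1]; simp
  have anym : ∀ h, 1 ≤ h → h < 2 * 2 ^ k → ρ v h = h → mrg k ρ p v h = ρ p h := by
    intro h h1 h2 hv
    unfold mrg
    split_ifs with hh
    · rfl
    · rcases D.eq_or hpA h1 h2 with h | h <;> omega
  have anyp : ∀ h, ρ p h = h → h < 2 * 2 ^ k → mrg k ρ p v h = ρ v h := by
    intro h h1 h2
    unfold mrg
    rw [if_neg (by omega)]
  refine ⟨?_, ?_, ?_, by omega, ?_, ?_, ?_⟩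
  · refine D.stat.congr ?_ (fun h _ _ => by rw [hM, hG]; simp)
    intro h h1 h2
    exact hN _ fun h' _ _ hb => by have := hb.1; omega
  · intro u hu
    by_cases he : u = p
    · subst he
      simp only [Function.update_self, true_and]
      -- the fields of the merged tree at a position that is not owned twice
      have key : ∀ h, 1 ≤ h → h < 2 ^ k → ¬ Both k ρ u v h →
          (∃ u' < v + 1, (u' = u ∨ u' = v) ∧ mrg k ρ u v h = ρ u' h ∧
            mrg k ρ u v (2 * h) = ρ u' (2 * h) ∧ mrg k ρ u v (2 * h + 1) = ρ u' (2 * h + 1) ∧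
            M'.LC (ρ u' h) = M.LC (ρ u' h) ∧ M'.RC (ρ u' h) = M.RC (ρ u' h) ∧
            M'.AD (ρ u' h) = M.AD (ρ u' h) ∧ a u' h = a u h + a v h) := by
        intro h h1 h2 hnb
        rcases own' h h1 h2 with ⟨o1, o2⟩ | ⟨o1, o2⟩
        · have hvs : ρ v h = h := by
            rcases D.own v hvA h h1 h2 with h | h
            · exact h
            · exact absurd ⟨o1, h.1⟩ hnb
          have hvc := D.static_child hvA h1 h2 hvs
          have e1 := Vv.ad h h1 h2
          rw [hvs] at e1
          have e2 := D.stat.ad h h1 h2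
          refine ⟨u, hpA, Or.inl rfl, o2, anym _ (by omega) (by omega) hvc.1,
            anym _ (by omega) (by omega) hvc.2, ?_⟩
          have := hfr u hpA h h1 h2 fun _ => hnb
          refine ⟨this.1, this.2.1, this.2.2, ?_⟩
          rw [← e1, e2, add_zero]
        · have hpc := D.static_child hpA h1 h2 o1
          have e1 := Vp.ad h h1 h2
          rw [o1] at e1
          have e2 := D.stat.ad h h1 h2
          refine ⟨v, hvA, Or.inr rfl, o2, anyp _ hpc.1 (by omega), anyp _ hpc.2 (by omega), ?_⟩
          have := hfr v hvA h h1 h2 fun h => by omega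
          refine ⟨this.1, this.2.1, this.2.2, ?_⟩
          rw [← e1, e2, zero_add]
      refine ⟨fun h h1 h2 => ?_, fun h h1 h2 => ?_, fun h h1 h2 => ?_, fun h h1 h2 hb => ?_,
        fun h h1 h2 => ?_⟩
      · by_cases hb : Both k ρ u v h
        · rw [← (hB h h1 h2 hb).1, mrg, if_pos hb.1]
        · obtain ⟨u', hu', -, m1, m2, m3, m4, m5, m6, m7⟩ := key h h1 h2 hb
          rw [m1, m2, m4, (D.view u' hu').lc h h1 h2]
      · by_cases hb : Both k ρ u v h
        · rw [← (hB h h1 h2 hb).2.1, mrg, if_pos hb.1]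
        · obtain ⟨u', hu', -, m1, m2, m3, m4, m5, m6, m7⟩ := key h h1 h2 hb
          rw [m1, m3, m5, (D.view u' hu').rc h h1 h2]
      · by_cases hb : Both k ρ u v h
        · rw [← (hB h h1 h2 hb).2.2, mrg, if_pos hb.1]
        · obtain ⟨u', hu', -, m1, m2, m3, m4, m5, m6, m7⟩ := key h h1 h2 hb
          rw [m1, m6, (D.view u' hu').ad h h1 h2, m7]
      · obtain ⟨u', hu', -, m1, m2, m3, m4, m5, m6, m7⟩ := key h h1 h2 hb
        have := (D.view u' hu').mn h h1 h2 (by simp)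
        unfold Mem.PullEq at *
        rw [m1, m2, m3, m6, hM, hG]
        exact this
      · rw [hM, hG]
        exact ⟨leafm h h1 h2, (Vp.leaf h h1 h2).2⟩
    · rw [Function.update_of_ne he, Function.update_of_ne he]
      refine ((D.view u (by omega)).congr ?_ (fun h _ _ => by rw [hM, hG]; simp)).mono
        fun _ _ _ h => h.elim
      intro h h1 h2
      exact hfr u (by omega) h h1 h2 fun h => absurd h he
  · intro u hu
    by_cases he : u = p
    · subst he
      rw [Function.update_self, mrg, D.root u hpA, if_pos (by omega)]
    · rw [Function.update_of_ne he]; exact D.root u (by omega)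
  · intro u hu h h1 h2
    by_cases he : u = p
    · subst he
      rw [Function.update_self]
      have o1 := D.own u hpA h h1 h2
      have o2 := D.own v hvA h h1 h2
      rcases own' h h1 h2 with ⟨o1, o2⟩ | ⟨o1, o2⟩ <;> omega
    · rw [Function.update_of_ne he]; exact D.own u (by omega) h h1 h2
  -- Every node of the new forest stood at the same position in the old one, possibly in the tree
  -- `v` if it is now in `p`. Since `v` itself has disappeared, injectivity is inherited.
  · have gen : ∀ u < v, ∀ h, 1 ≤ h → h < 2 ^ k → ∃ u' < v + 1,
        Function.update ρ p (mrg k ρ p v) u h = ρ u' h ∧ (u' = u ∨ (u = p ∧ u' = v)) := by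
      intro u hu h h1 h2
      by_cases he : u = p
      · subst he
        rcases own' h h1 h2 with ⟨o1, o2⟩ | ⟨o1, o2⟩
        · exact ⟨u, hpA, by simpa using o2, Or.inl rfl⟩
        · exact ⟨v, hvA, by simpa using o2, Or.inr ⟨rfl, rfl⟩⟩
      · exact ⟨u, by omega, by simp [he], Or.inl rfl⟩
    intro u hu u' hu' h h' h1 h2 h1' h2' ho heq
    obtain ⟨w, hw, e, hc⟩ := gen u hu h h1 h2
    obtain ⟨w', hw', e', hc'⟩ := gen u' hu' h' h1' h2'
    rw [e] at ho heq
    rw [e'] at heq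
    have := D.inj w hw w' hw' h h' h1 h2 h1' h2' ho heq
    omega
  · intro i; rw [hG]; exact D.arg i

/-- The heap positions owned by a tree. -/
noncomputable def owned (k : ℕ) (r : ℕ → ℕ) : Finset ℕ :=
  (Finset.Ico 1 (2 ^ k)).filter fun h => 2 * 2 ^ k ≤ r h

/-- The state of the first pass of a merge. -/
structure MInv (k : ℕ) (ρ : ℕ → ℕ → ℕ) (p v : ℕ) (s0 : State) (iA : ℕ) (ic : ℕ → ℕ) (q b : ℕ)
    (H : ℕ → ℕ) (s : State) : Prop where
  q_eq : s.wreg 27 = q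
  lists : ∀ j < q, s.warr 24 j = ρ p (H j) ∧ s.warr 25 j = ρ v (H j) ∧ 1 ≤ H j ∧ H j < 2 ^ k ∧
    Both k ρ p v (H j)
  mono : ∀ j j', j < j' → j' < q → H j < H j'
  top : ∀ j < q, H j ≤ b
  closed : ∀ e < 2, ∀ j < ic e, Both k ρ p v (2 * H j + e) → ∃ j' < q, H j' = 2 * H j + e
  child : ∀ e < 2, ∀ j < ic e, s.warr (20 + e) (ρ p (H j)) = mrg k ρ p v (2 * H j + e)
  child' : ∀ e < 2, ∀ x, (∀ j < ic e, x ≠ ρ p (H j)) → s.warr (20 + e) x = s0.warr (20 + e) x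
  ad : ∀ j < iA, s.rarr 2 (ρ p (H j)) = s0.rarr 2 (ρ p (H j)) + s0.rarr 2 (ρ v (H j))
  ad' : ∀ x, (∀ j < iA, x ≠ ρ p (H j)) → s.rarr 2 x = s0.rarr 2 x
  mn : s.rarr 3 = s0.rarr 3
  arg : s.warr 22 = s0.warr 22

/-- The listed positions increase, hence are distinct, and both trees own them. So the length of the
work list, and with it the time of the merge, is bounded by the number of positions owned twice. -/
theorem MInv.q_le {s0 s : State} {iA q b : ℕ} {ic H : ℕ → ℕ}
    (I : MInv k ρ p v s0 iA ic q b H s) : q ≤ (owned k (ρ p) ∩ owned k (ρ v)).card := by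
  rw [← Finset.card_range q]
  refine Finset.card_le_card_of_injOn H ?_ ?_
  · intro j hj
    have := I.lists j (by simpa using hj)
    simp [owned, this.2.2.1, this.2.2.2.1, this.2.2.2.2.1, this.2.2.2.2.2]
  · intro i hi j hj hij
    simp at hi hj
    rcases lt_trichotomy i j with h | h | h
    · have := I.mono i j h hj; omega
    · exact h
    · have := I.mono j i h hi; omega

theorem DS.child_eq {s0 : State} (D : DS k base A nx (mem s0) ρ a bad) {u h e : ℕ}
    (hu : u < A) (h1 : 1 ≤ h) (h2 : h < 2 ^ k) (he : e < 2) :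
    s0.warr (20 + e) (ρ u h) = ρ u (2 * h + e) := by
  interval_cases e
  · exact (D.view u hu).lc h h1 h2
  · exact (D.view u hu).rc h h1 h2

/-- If the child in `v` is static, that of `p` is kept; if only the child in `p` is static, the
whole subtree of `v` is adopted by one link; only if both are owned does the pair enter the work
list. Children are met in the order of their positions, so the list stays increasing, with `b`
bounding what it contains. -/
theorem mergeChild_ok {s0 s : State} {i q b iA e : ℕ} {ic H : ℕ → ℕ} (he : e < 2)
    (D : DS k base (v + 1) nx (mem s0) ρ a bad) (hp : p < v) (hW : nx ≤ W)
    (I : MInv k ρ p v s0 iA ic q b H s) (hiq : i < q) (hic : ic e = i) (hiA : iA ≤ q)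
    (hice : ∀ e < 2, ic e ≤ q)
    (hb : b < 2 * H i + e) (h28 : s.wreg 28 = ρ p (H i)) (h29 : s.wreg 29 = ρ v (H i))
    (h19 : s.wreg 19 = 2 * 2 ^ k) :
    Ok W (mergeChild (20 + e)) s 30 fun s' => ∃ q' H', q ≤ q' ∧ (∀ j < q, H' j = H j) ∧
      MInv k ρ p v s0 iA (Function.update ic e (i + 1)) q' (2 * H i + e) H' s' := by
  have hpA : p < v + 1 := by omega
  have hvA : v < v + 1 := by omega
  have hnx := D.nx_ge
  have hqle := I.q_le
  have hcard : (owned k (ρ p) ∩ owned k (ρ v)).card ≤ 2 ^ k := by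
    refine (Finset.card_le_card Finset.inter_subset_left).trans ?_
    refine (Finset.card_filter_le _ _).trans ?_
    simp
  obtain ⟨-, -, h1, h2, hB⟩ := I.lists i hiq
  -- Earlier rounds wrote links only into nodes of `p` at other listed positions. Both nodes at the
  -- present position therefore still have their original links.
  have hinj : ∀ j < q, j ≠ i → ρ p (H i) ≠ ρ p (H j) := by
    intro j hj hji
    have hl := I.lists j hj
    refine D.ne hpA hl.2.2.1 hl.2.2.2.1 hpA h1 (by omega) hl.2.2.2.2.1 ?_
    rintro ⟨-, h⟩
    rcases lt_or_gt_of_ne hji with h' | h'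
    · have := I.mono _ _ h' hiq; omega
    · have := I.mono _ _ h' hj; omega
  have hpv : ∀ j < q, ρ v (H i) ≠ ρ p (H j) := by
    intro j hj
    have hl := I.lists j hj
    exact D.ne hpA hl.2.2.1 hl.2.2.2.1 hvA h1 (by omega) hl.2.2.2.2.1 (by omega)
  have e29 : s.warr (20 + e) (ρ v (H i)) = ρ v (2 * H i + e) := by
    rw [I.child' e he _ fun j hj => hpv j (by omega), D.child_eq hvA h1 h2 he]
  have e28 : s.warr (20 + e) (ρ p (H i)) = ρ p (2 * H i + e) := by
    rw [I.child' e he _ fun j hj => hinj j (by omega) (by omega), D.child_eq hpA h1 h2 he]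
  have hl1 := D.lt_nx hpA h1 (by omega)
  have hl2 := D.lt_nx hvA (h := 2 * H i + e) (by omega) (by omega)
  have hl3 := D.lt_nx hpA (h := 2 * H i + e) (by omega) (by omega)
  have o1 := D.eq_or hpA (h := 2 * H i + e) (by omega) (by omega)
  have o2 := D.eq_or hvA (h := 2 * H i + e) (by omega) (by omega)
  have n24 : 24 ≠ 20 + e := by omega
  have n25 : 25 ≠ 20 + e := by omega
  have n22 : 22 ≠ 20 + e := by omega
  refine Ok.line (by simp [mergeChild]) ?_
  simp only [mergeChild, wp, WExp.eval, Test.Holds, h28, h29, e28, e29, h19, I.q_eq, storeW_wreg,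
    storeW_warr, n24.symm, if_false, not_le]
  refine ⟨fun c1 => ⟨fun c2 => ⟨by omega, by omega, by omega, by omega, by omega, ?_⟩,
    fun c2 => ⟨by omega, by omega, ?_⟩⟩, fun c1 => ?_⟩
  · have hck : 2 * H i + e < 2 ^ k := by omega
    have hlow : ∀ j < q, Function.update H q (2 * H i + e) j = H j := by
      intro j hj; rw [Function.update_of_ne (by omega)]
    refine ⟨q + 1, Function.update H q (2 * H i + e), by omega, hlow, ?_, ?_, ?_, ?_, ?_, ?_, ?_,
      ?_, ?_, by simp [I.mn], by simp [I.arg]⟩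
    · simp
    · intro j hj
      by_cases hjq : j = q
      · subst hjq
        simp only [setW_warr, storeW_warr, Function.update_self]
        norm_num
        exact ⟨by omega, hck, c2, c1⟩
      · simp [Function.update_of_ne hjq]
        have := I.lists j (by omega)
        exact this
    · intro j j' hjj hj
      rw [hlow j (by omega)]
      by_cases hjq : j' = q
      · subst hjq
        rw [Function.update_self]
        have := I.top j hjj; omega
      · rw [hlow j' (by omega)]; exact I.mono j j' hjj (by omega)
    · intro j hj
      by_cases hjq : j = q
      · subst hjq; simp
      · rw [hlow j (by omega)]; have := I.top j (by omega); omega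
    · intro e' he' j hj hBj
      by_cases hee : e' = e
      · subst hee
        rw [Function.update_self] at hj
        by_cases hji : j = i
        · subst hji
          exact ⟨q, by omega, by rw [Function.update_self, hlow j hiq]⟩
        · rw [hlow j (by omega)] at hBj ⊢
          obtain ⟨j', hj', e'⟩ := I.closed e' he' j (by omega) hBj
          exact ⟨j', by omega, by rw [hlow j' hj', e']⟩
      · rw [Function.update_of_ne hee] at hj
        have := hice e' he'
        rw [hlow j (by omega)] at hBj ⊢
        obtain ⟨j', hj', e'⟩ := I.closed e' he' j (by omega) hBj
        exact ⟨j', by omega, by rw [hlow j' hj', e']⟩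
    · intro e' he' j hj
      have m24 : 20 + e' ≠ 24 := by omega
      have m25 : 20 + e' ≠ 25 := by omega
      simp only [setW_warr, storeW_warr, m24, m25, if_false]
      by_cases hee : e' = e
      · subst hee
        rw [Function.update_self] at hj
        rw [hlow j (by omega)]
        by_cases hji : j = i
        · subst hji
          rw [e28, mrg, if_pos c2]
        · exact I.child e' he' j (by omega)
      · rw [Function.update_of_ne hee] at hj
        have := hice e' he'
        rw [hlow j (by omega)]
        exact I.child e' he' j hj
    · intro e' he' x hx
      have m24 : 20 + e' ≠ 24 := by omega
      have m25 : 20 + e' ≠ 25 := by omega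
      simp only [setW_warr, storeW_warr, m24, m25, if_false]
      refine I.child' e' he' x fun j hj => ?_
      have hj2 : j < q := lt_of_lt_of_le hj (hice e' he')
      rw [← hlow j hj2]
      apply hx
      by_cases hee : e' = e
      · subst hee; rw [Function.update_self]; omega
      · rwa [Function.update_of_ne hee]
    · intro j hj
      rw [hlow j (by omega)]
      simpa using I.ad j hj
    · intro x hx
      have := I.ad' x fun j hj => by rw [← hlow j (by omega)]; exact hx j hj
      simpa using this
  · refine ⟨q, H, le_rfl, fun _ _ => rfl, by simp [I.q_eq], ?_, I.mono, ?_, ?_, ?_, ?_, I.ad, I.ad',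
      by simp [I.mn], by simp [n22, I.arg]⟩
    · intro j hj; simp [n24, n25]; exact I.lists j hj
    · intro j hj; have := I.top j hj; omega
    · intro e' he' j hj hBj
      by_cases hee : e' = e
      · subst hee
        rw [Function.update_self] at hj
        by_cases hji : j = i
        · subst hji; have := hBj.1; omega
        · exact I.closed e' he' j (by omega) hBj
      · rw [Function.update_of_ne hee] at hj
        exact I.closed e' he' j hj hBj
    · intro e' he' j hj
      by_cases hee : e' = e
      · subst hee
        rw [Function.update_self] at hj
        simp only [storeW_warr, if_true]
        by_cases hji : j = i
        · subst hji
          rw [Function.update_self, mrg, if_neg (by omega)]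
        · rw [Function.update_of_ne (hinj j (by omega) hji).symm]
          exact I.child e' he' j (by omega)
      · rw [Function.update_of_ne hee] at hj
        simp [hee]
        exact I.child e' he' j hj
    · intro e' he' x hx
      by_cases hee : e' = e
      · subst hee
        rw [Function.update_self] at hx
        simp only [storeW_warr, if_true]
        rw [Function.update_of_ne (hx i (by omega))]
        exact I.child' e' he' x fun j hj => hx j (by omega)
      · rw [Function.update_of_ne hee] at hx
        simp [hee]
        exact I.child' e' he' x hx
  · refine ⟨q, H, le_rfl, fun _ _ => rfl, I.q_eq, I.lists, I.mono, ?_, ?_, ?_, ?_, I.ad, I.ad',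
      I.mn, I.arg⟩
    · intro j hj; have := I.top j hj; omega
    · intro e' he' j hj hBj
      by_cases hee : e' = e
      · subst hee
        rw [Function.update_self] at hj
        by_cases hji : j = i
        · subst hji; have := hBj.2; omega
        · exact I.closed e' he' j (by omega) hBj
      · rw [Function.update_of_ne hee] at hj
        exact I.closed e' he' j hj hBj
    · intro e' he' j hj
      by_cases hee : e' = e
      · subst hee
        rw [Function.update_self] at hj
        by_cases hji : j = i
        · subst hji
          rw [e28, mrg]
          split_ifs <;> omega
        · exact I.child e' he' j (by omega)
      · rw [Function.update_of_ne hee] at hj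
        exact I.child e' he' j hj
    · intro e' he' x hx
      refine I.child' e' he' x fun j hj => hx j ?_
      by_cases hee : e' = e
      · subst hee; rw [Function.update_self]; omega
      · rwa [Function.update_of_ne hee]

theorem mergeBody_ok {s0 s : State} {i q b : ℕ} {H : ℕ → ℕ}
    (D : DS k base (v + 1) nx (mem s0) ρ a bad) (hp : p < v) (hW : nx ≤ W)
    (I : MInv k ρ p v s0 i (fun _ => i) q b H s) (hiq : i < q)
    (hb : b < 2 * H i) (h26 : s.wreg 26 = i)
    (h19 : s.wreg 19 = 2 * 2 ^ k) :
    Ok W mergeBody s 90 fun s' => ∃ q' H' b', q ≤ q' ∧ s'.wreg 26 = i + 1 ∧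
      (i + 1 < q' → b' < 2 * H' (i + 1)) ∧ H' 0 = H 0 ∧
      MInv k ρ p v s0 (i + 1) (fun _ => i + 1) q' b' H' s' := by
  have hpA : p < v + 1 := by omega
  have hvA : v < v + 1 := by omega
  have hnx := D.nx_ge
  obtain ⟨l1, l2, h1, h2, hB⟩ := I.lists i hiq
  have hl1 := D.lt_nx hpA h1 (by omega)
  have hl2 := D.lt_nx hvA h1 (by omega)
  have hinj : ∀ j < q, j ≠ i → ρ p (H i) ≠ ρ p (H j) := by
    intro j hj hji
    have hl := I.lists j hj
    refine D.ne hpA hl.2.2.1 hl.2.2.2.1 hpA h1 (by omega) hl.2.2.2.2.1 ?_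
    rintro ⟨-, h⟩
    rcases lt_or_gt_of_ne hji with h' | h'
    · have := I.mono _ _ h' hiq; omega
    · have := I.mono _ _ h' hj; omega
  have hpv : ∀ j < q, ρ v (H i) ≠ ρ p (H j) := by
    intro j hj
    have hl := I.lists j hj
    exact D.ne hpA hl.2.2.1 hl.2.2.2.1 hvA h1 (by omega) hl.2.2.2.2.1 (by omega)
  refine (Ok.seq (T := 20) (T' := 70) (Ok.line (by simp) ?_)).mono le_rfl fun _ => id
  simp only [wp, WExp.eval, RExp.eval, h26, l1, setW_wreg, setW_warr, setW_rarr]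
  norm_num [h26]
  rw [l2]
  refine ⟨by omega, by omega, by omega, ?_⟩
  have I1 : MInv k ρ p v s0 (i + 1) (fun _ => i) q b H
      (((s.setW 28 (ρ p (H i))).setW 29 (ρ v (H i))).storeR 2 (ρ p (H i))
        (s.rarr 2 (ρ p (H i)) + s.rarr 2 (ρ v (H i)))) := by
    refine ⟨by simp [I.q_eq], I.lists, I.mono, I.top, I.closed, I.child, I.child', ?_, ?_,
      by simp [I.mn], by simp [I.arg]⟩
    · intro j hj
      simp only [storeR_rarr, if_true, setW_rarr]
      by_cases hji : j = i
      · subst hji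
        rw [Function.update_self, I.ad' _ fun j' hj' => hinj j' (by omega) (by omega),
          I.ad' _ fun j' hj' => hpv j' (by omega)]
      · rw [Function.update_of_ne (hinj j (by omega) hji).symm]
        exact I.ad j (by omega)
    · intro x hx
      simp only [storeR_rarr, if_true, setW_rarr]
      rw [Function.update_of_ne (hx i (by omega))]
      exact I.ad' x fun j hj => hx j (by omega)
  refine (Ok.seq' (T := 30) (T' := 40) (mergeChild_ok (e := 0) (W := W) (by norm_num) D hp hW I1 hiq
    rfl (by omega) (fun _ _ => by omega) (by omega) (by simp) (by simp) (by simp [h19])) ?_).mono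
    le_rfl fun _ => id
  rintro s2 ⟨q2, H2, hq2, hH2, I2⟩ hF2
  have f28 := hF2.wreg 28 (by decide)
  have f29 := hF2.wreg 29 (by decide)
  have f19 := hF2.wreg 19 (by decide)
  have f26 := hF2.wreg 26 (by decide)
  simp [h19, h26] at f28 f29 f19 f26
  have hHi := hH2 i hiq
  refine (Ok.seq' (T := 30) (T' := 10) (mergeChild_ok (e := 1) (W := W) (by norm_num) D hp hW I2
    (i := i) (by omega) (by simp) (by omega) ?_ (by omega) (by rw [hHi, f28])
    (by rw [hHi, f29]) f19) ?_).mono le_rfl fun _ => id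
  · intro e' _
    by_cases he : e' = 0
    · subst he; simp; omega
    · simp [he]; omega
  rintro s3 ⟨q3, H3, hq3, hH3, I3⟩ hF3
  have g26 := hF3.wreg 26 (by decide)
  rw [f26] at g26
  refine Ok.line (by simp) ?_
  simp only [wp, WExp.eval, g26]
  have hi2 : i < 2 ^ k := by
    have := I.q_le
    have : (owned k (ρ p) ∩ owned k (ρ v)).card ≤ 2 ^ k := by
      refine (Finset.card_le_card Finset.inter_subset_left).trans ?_
      refine (Finset.card_filter_le _ _).trans ?_
      simp
    omega
  -- Everything listed so far is at most `2 * H i + 1`. The next position exceeds `H i`, so its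
  -- children lie beyond this bound.
  refine ⟨by omega, q3, by omega, by simp, H3, 2 * H2 i + 1, ?_, ?_, ?_⟩
  rotate_left
  · rw [hH3 0 (by omega), hH2 0 (by omega)]
  · have hic : ∀ e < 2, Function.update (Function.update (fun _ => i) 0 (i + 1)) 1 (i + 1) e =
        i + 1 := by
      intro e he
      interval_cases e <;> simp
    exact ⟨by simpa using I3.q_eq, I3.lists, I3.mono, I3.top,
      fun e he j hj => I3.closed e he j (by rw [hic e he]; exact hj),
      fun e he j hj => I3.child e he j (by rw [hic e he]; exact hj),
      fun e he x hx => I3.child' e he x (by rw [hic e he]; exact hx),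
      I3.ad, I3.ad', I3.mn, I3.arg⟩
  · intro h
    have := I3.mono i (i + 1) (by omega) h
    rw [hH3 i (by omega), hHi] at this
    rw [hHi]; omega

/-- A forest with the leaf sums `F` and `Φ` owned nodes. -/
def ForestP (k : ℕ) (base : ℕ → ℝ) (A : ℕ) (F : ℕ → ℕ → ℝ) (Φ : ℕ) (s : State) : Prop :=
  ∃ ρ a, DS k base A (s.wreg 18) (mem s) ρ a (fun _ _ => False) ∧
    (∀ u < A, ∀ w < 2 ^ k, leafSum k (a u) w = F u w) ∧
    ∑ u ∈ Finset.range A, (owned k (ρ u)).card = Φ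

theorem owned_mrg : owned k (mrg k ρ p v) = owned k (ρ p) ∪ owned k (ρ v) := by
  ext h
  simp only [owned, Finset.mem_filter, Finset.mem_union]
  by_cases hh : 2 * 2 ^ k ≤ ρ p h <;> simp [mrg, hh]
  tauto

/-- Inclusion and exclusion: a position owned by both trees was counted twice and is now counted
once. This loss of potential pays for the merge. -/
theorem sum_owned_mrg (hp : p < v) :
    ∑ u ∈ Finset.range v, (owned k (Function.update ρ p (mrg k ρ p v) u)).card +
      (owned k (ρ p) ∩ owned k (ρ v)).card =
    ∑ u ∈ Finset.range (v + 1), (owned k (ρ u)).card := by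
  rw [Finset.sum_range_succ]
  have h1 : ∑ u ∈ Finset.range v, (if u = p then (owned k (ρ p) ∩ owned k (ρ v)).card else 0) =
      (owned k (ρ p) ∩ owned k (ρ v)).card := by
    rw [Finset.sum_ite_eq' ]; simp [hp]
  have h2 : ∑ u ∈ Finset.range v, (if u = p then (owned k (ρ v)).card else 0) =
      (owned k (ρ v)).card := by
    rw [Finset.sum_ite_eq' ]; simp [hp]
  rw [← h1, ← h2, ← Finset.sum_add_distrib, ← Finset.sum_add_distrib]
  refine Finset.sum_congr rfl fun u _ => ?_
  by_cases he : u = p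
  · subst he
    simp only [Function.update_self, if_true, owned_mrg]
    exact Finset.card_union_add_card_inter _ _
  · simp [he]

/-- The number `len` of positions owned twice measures both the time and the decrease of the number
of owned nodes, which makes the cost of all the merges telescope. Leaf sums are linear in the
additions, so adding the additions adds the functions. -/
theorem merge_ok {s0 : State} {F : ℕ → ℕ → ℝ} {Φ : ℕ} (hF : ForestP k base (v + 1) F Φ s0)
    (hp : p < v) (h24 : s0.wreg 24 = v) (h25 : s0.wreg 25 = p) (h19 : s0.wreg 19 = 2 * 2 ^ k)
    (hk : 1 ≤ k) (hW : s0.wreg 18 ≤ W) :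
    ∃ len ≤ Φ, Ok W merge s0 (200 * len + 60) fun s' => s'.wreg 18 = s0.wreg 18 ∧
      ForestP k base v (fun u w => F u w + if u = p then F v w else 0) (Φ - len) s' := by
  obtain ⟨ρ, a, D, hS, hΦ⟩ := hF
  have hsum := sum_owned_mrg (k := k) (ρ := ρ) hp
  rw [hΦ] at hsum
  have hpA : p < v + 1 := by omega
  have hvA : v < v + 1 := by omega
  have hnx := D.nx_ge
  have hp1 : 1 < 2 ^ k := Nat.one_lt_two_pow (by omega)
  refine ⟨(owned k (ρ p) ∩ owned k (ρ v)).card, by omega, ?_⟩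
  set len := (owned k (ρ p) ∩ owned k (ρ v)).card with hlen
  have hlen2 : len ≤ 2 ^ k := by
    refine (Finset.card_le_card Finset.inter_subset_left).trans ?_
    refine (Finset.card_filter_le _ _).trans ?_
    simp
  have rp := D.root p hpA
  have rv := D.root v hvA
  have I0 : MInv k ρ p v s0 0 (fun _ => 0) 1 1 (fun _ => 1)
      ((((s0.storeW 24 0 (ρ p 1)).storeW 25 0 (ρ v 1)).setW 26 0).setW 27 1) := by
    refine ⟨by simp, ?_, by omega, by simp, by simp, by simp, ?_, by simp, by simp, by simp,
      by simp⟩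
    · intro j hj
      obtain rfl : j = 0 := by omega
      simp [Both, rp, rv]; omega
    · intro e he x _
      interval_cases e <;> simp
  refine (Ok.seq (T := 20) (T' := (len * 110 + 10) + (len * (70 + 7) + 3)) (Ok.line (by simp) ?_)).mono
    (by omega) fun _ => id
  simp only [wp, WExp.eval, storeW_wreg, h19, h24, h25, ← rp, ← rv]
  refine ⟨by omega, by omega, by omega, by omega, by omega, by omega, ?_⟩
  refine (Ok.seq' (R := fun s' => ∃ q H b, q ≤ len ∧ H 0 = 1 ∧ 0 < q ∧ MInv k ρ p v s0 q (fun _ => q) q b H s')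
    (Ok.mono (T := (len - 0) * 110 + 10) (Ok.loop (fun (g : ℕ) s' => ∃ q H b, g ≤ q ∧ 0 < q ∧ H 0 = 1 ∧
      s'.wreg 26 = g ∧ (g < q → b < 2 * H g) ∧ MInv k ρ p v s0 g (fun _ => g) q b H s')
      (fun g => (len - g) * 110 + 10) 0 ⟨1, _, 1, by omega, by omega, rfl, by simp, by simp, I0⟩
      ?_ ?_) (by omega) fun _ h => h) ?_).mono le_rfl fun _ => id
  · rintro g s ⟨q, H, b, hgq, hq, hH, h26, hb, I⟩ hFr hc
    simp [I.q_eq, h26] at hc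
    obtain rfl : g = q := by omega
    exact ⟨by simp, g, H, b, I.q_le, hH, hq, I⟩
  · rintro g s ⟨q, H, b, hgq, hq, hH, h26, hb, I⟩ hFr hc
    simp [I.q_eq, h26] at hc
    have f19 := hFr.wreg 19 (by decide)
    simp [h19] at f19
    refine ⟨90, (mergeBody_ok (W := W) D hp hW I hc (hb hc) h26 f19).mono le_rfl ?_⟩
    rintro s' ⟨q', H', b', hq', h26', hb', hH0, I'⟩
    have := I'.q_le
    refine ⟨g + 1, ⟨q', H', b', by omega, by omega, by omega, h26', hb', I'⟩, ?_⟩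
    have := I.q_le
    simp only [Test.cost, WExp.cost]
    omega
  · rintro s1 ⟨q, H, b, hq, hH0, hq0, I⟩ hFr1
    have f19 := hFr1.wreg 19 (by decide)
    have f18 := hFr1.wreg 18 (by decide)
    simp [h19] at f19 f18
    -- every position owned twice is in the list
    have hall : ∀ h, 1 ≤ h → h < 2 ^ k → Both k ρ p v h → ∃ j < q, H j = h := by
      intro h
      induction h using Nat.strong_induction_on with
      | _ h ih =>
        intro h1 h2 hB
        rcases Nat.eq_or_lt_of_le h1 with rfl | h1
        · exact ⟨0, hq0, hH0⟩
        · have hh : h = 2 * (h / 2) + h % 2 := by omega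
          have hst : ∀ u < v + 1, 2 * 2 ^ k ≤ ρ u h → 2 * 2 ^ k ≤ ρ u (h / 2) := by
            intro u hu ho
            rcases D.own u hu (h / 2) (by omega) (by omega) with e | e
            · have := D.static_child hu (by omega) (by omega) e
              rcases Nat.mod_two_eq_zero_or_one h with h' | h'
              · rw [h', add_zero] at hh; rw [← hh] at this; omega
              · rw [h'] at hh; rw [← hh] at this; omega
            · exact e.1
          obtain ⟨j, hj, e⟩ := ih (h / 2) (by omega) (by omega) (by omega)
            ⟨hst p hpA hB.1, hst v hvA hB.2⟩
          have := I.closed (h % 2) (by omega) j hj (by rw [e, ← hh]; exact hB)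
          rw [e, ← hh] at this
          exact this
    have D1 : DS k base v (s0.wreg 18) (mem s1) (Function.update ρ p (mrg k ρ p v))
        (Function.update a p fun h => a p h + a v h) (fun u h => u = p ∧ Both k ρ p v h) := by
      refine D.mrg_merge hp ?_ ?_ I.mn I.arg
      · intro h h1 h2 hB
        obtain ⟨j, hj, rfl⟩ := hall h h1 h2 hB
        refine ⟨I.child 0 (by norm_num) j hj, I.child 1 (by norm_num) j hj, ?_⟩
        rw [← (D.view p hpA).ad _ h1 h2, ← (D.view v hvA).ad _ h1 h2]
        exact I.ad j hj
      · intro x hx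
        have hx' : ∀ j < q, x ≠ ρ p (H j) := by
          intro j hj
          have hl := I.lists j hj
          exact hx _ hl.2.2.1 hl.2.2.2.1 hl.2.2.2.2
        exact ⟨I.child' 0 (by norm_num) x hx', I.child' 1 (by norm_num) x hx', I.ad' x hx'⟩
    have hm : ∀ j < q, mrg k ρ p v (H j) = ρ p (H j) := by
      intro j hj
      have hl := I.lists j hj
      rw [mrg, if_pos hl.2.2.2.2.1]
    refine (Ok.forDown (W := W) (fun i s' => s'.wreg 18 = s0.wreg 18 ∧
      DS k base v (s0.wreg 18) (mem s') (Function.update ρ p (mrg k ρ p v))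
        (Function.update a p fun h => a p h + a v h) (fun u h => u = p ∧ ∃ j < i, h = H j))
      (N := q) 70 (by decide) I.q_eq (by omega) ?_ ?_).mono ?_ ?_
    · refine ⟨f18, D1.mono ?_⟩
      rintro u hu h h1 h2 ⟨rfl, hB⟩
      obtain ⟨j, hj, rfl⟩ := hall h h1 h2 hB
      exact ⟨rfl, j, hj, rfl⟩
    · rintro i s2 hiq ⟨i18, D2⟩ - hFr2
      have f24 := hFr2.warr 24 (by decide)
      obtain ⟨l1, l2, h1, h2, hB⟩ := I.lists i hiq
      have hlt := D.lt_nx hpA h1 (by omega)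
      refine (Ok.seq (T := 5) (T' := 40) (Ok.line (by simp) ?_)).mono (by omega) fun _ => id
      simp only [wp, WExp.eval, setW_wreg, if_true, setW_warr, f24, l1]
      refine ⟨by omega, ?_⟩
      refine (pull_ok (u := p) (h := H i) (W := W) (by simpa [mem, i18] using D2)
        hp h1 h2 (by simp [hm i hiq]; exact hB.1) (by simp [hm i hiq]) (by simp; omega)
        ?_).fr.mono le_rfl ?_
      · intro h' hh' hc
        have hB' : Both k ρ p v h' := by
          have hst : ∀ u < v + 1, 2 * 2 ^ k ≤ ρ u (H i) → 2 * 2 ^ k ≤ ρ u h' := by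
            intro u hu ho
            rcases D.own u hu h' (by omega) (by omega) with e | e
            · have := D.static_child hu (by omega) (by omega) e
              rcases hc with hc | hc <;> rw [← hc] at this <;> omega
            · exact e.1
          exact ⟨hst p hpA hB.1, hst v hvA hB.2⟩
        -- The parent of a position owned twice is owned twice as well, hence listed; being smaller,
        -- it stands earlier in the list and is still to be pulled.
        obtain ⟨j, hj, e⟩ := hall h' hh' (by omega) hB'
        refine ⟨rfl, j, ?_, e.symm⟩
        by_contra hcon
        rcases Nat.eq_or_lt_of_le (show i ≤ j by omega) with rfl | h
        · omega
        · have := I.mono i j h hj; omega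
      · rintro s3 ⟨D3, hF3⟩
        have f18 := hF3.wreg 18 (by decide)
        simp at f18 D3
        refine ⟨by omega, ?_⟩
        rw [i18] at D3
        refine DS.mono D3 ?_
        intro u hu h h1 h2 hb
        by_cases he : u = p
        · subst he
          simp only [Function.update_self] at hb
          obtain ⟨⟨j, hj, rfl⟩, hne⟩ := hb
          refine ⟨rfl, j, ?_, rfl⟩
          by_contra hcon
          obtain rfl : j = i := by omega
          exact hne rfl
        · rw [Function.update_of_ne he] at hb
          exact absurd hb.1 he
    · have : q * (70 + 7) ≤ len * (70 + 7) := Nat.mul_le_mul_right _ hq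
      omega
    · rintro s2 ⟨⟨i18, D2⟩, -⟩
      have D3 := D2.mono (bad' := fun _ _ => False) fun u _ h _ _ hb => by
        obtain ⟨-, j, hj, -⟩ := hb
        omega
      refine ⟨i18, _, _, by rw [i18]; exact D3, ?_, by omega⟩
      intro u hu w hw
      by_cases he : u = p
      · subst he
        rw [Function.update_self, leafSum_add, hS _ hpA _ hw, hS _ hvA _ hw]
        simp
      · rw [Function.update_of_ne he, hS _ (by omega) _ hw]
        simp [he]

end RAM

/-! ## Prefix minima -/

namespace RAM

/-- One level of a query. -/
def queryBody : Prog :=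
  .seq (.wset 13 (.div (.reg 13) (.const 2)))
  (.ite (.wle (.reg 13) (.reg 14))
    (.seq (.rset 7 (.add (.add (.reg 6) (.load 2 (.reg 12))) (.load 3 (.load 20 (.reg 12)))))
    (.seq (.ite (.and (.not (.weq (.reg 30) (.const 0))) (.rle (.reg 5) (.reg 7))) .skip
      (.seq (.rset 5 (.reg 7))
      (.seq (.wset 30 (.reg 24)) (.wset 31 (.load 22 (.load 20 (.reg 12)))))))
    (.seq (.wset 14 (.sub (.reg 14) (.reg 13))) (.wset 12 (.load 21 (.reg 12))))))
    (.seq (.rset 6 (.add (.reg 6) (.load 2 (.reg 12)))) (.wset 12 (.load 20 (.reg 12)))))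

/-- Compare the best value so far (`reg 5`, at the pair `reg 30`, `reg 31`) with those of the
pairs of `reg 24` with a smaller vertex. -/
def query : Prog :=
  .seq (.seq (.wset 12 (.add (.reg 19) (.reg 24)))
    (.seq (.wset 13 (.reg 20))
    (.seq (.wset 14 (.reg 24))
    (.seq (.wset 15 (.reg 16)) (.rset 6 (.load 1 (.reg 24)))))))
  (forDown 15 queryBody)

/-! ### Minima of subtrees and prefix minima -/

/-- The part of `leafSum` that concerns the heap positions of height at most `j`. -/
noncomputable def lowSum (a : ℕ → ℝ) (x j : ℕ) : ℝ :=
  ∑ d ∈ Finset.range j, if x / 2 ^ d % 2 = 0 then a (x / 2 ^ (d + 1)) else 0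

/-- The part of `leafSum` that concerns the heap positions of height more than `j`. -/
noncomputable def highSum (a : ℕ → ℝ) (x j k : ℕ) : ℝ :=
  ∑ d ∈ Finset.Ico j k, if x / 2 ^ d % 2 = 0 then a (x / 2 ^ (d + 1)) else 0

theorem lowSum_succ (a : ℕ → ℝ) (x j : ℕ) :
    lowSum a x (j + 1) = lowSum a x j + if x / 2 ^ j % 2 = 0 then a (x / 2 ^ (j + 1)) else 0 := by
  unfold lowSum; rw [Finset.sum_range_succ]

theorem highSum_succ (a : ℕ → ℝ) {x j k : ℕ} (h : j < k) :
    highSum a x j k = (if x / 2 ^ j % 2 = 0 then a (x / 2 ^ (j + 1)) else 0) +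
      highSum a x (j + 1) k := by
  unfold highSum; rw [Finset.sum_eq_sum_Ico_succ_bot h]

theorem lowSum_add_highSum (a : ℕ → ℝ) {j k : ℕ} (w : ℕ) (h : j ≤ k) :
    lowSum a (2 ^ k + w) j + highSum a (2 ^ k + w) j k = leafSum k a w := by
  unfold lowSum highSum leafSum
  exact Finset.sum_range_add_sum_Ico _ h

theorem highSum_congr (a : ℕ → ℝ) {x y j k : ℕ} (h : x / 2 ^ j = y / 2 ^ j) :
    highSum a x j k = highSum a y j k := by
  unfold highSum
  refine Finset.sum_congr rfl fun d hd => ?_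
  have e : ∀ d, j ≤ d → x / 2 ^ d = y / 2 ^ d := by
    intro d hd
    obtain ⟨c, rfl⟩ := Nat.exists_eq_add_of_le hd
    rw [pow_add, ← Nat.div_div_eq_div_mul, ← Nat.div_div_eq_div_mul, h]
  rw [e d (Finset.mem_Ico.1 hd).1, e (d + 1) (by have := (Finset.mem_Ico.1 hd).1; omega)]

variable {W k A nx : ℕ} {base : ℕ → ℝ} {M : Mem} {ρ : ℕ → ℕ → ℕ} {a : ℕ → ℕ → ℝ}

/-- By induction on the height, the stored minimum accounts for the base values and for the
additions made at the node and below it, but for none above. Nothing is pushed down, so a query has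
to add the part from above, `highSum`. -/
theorem View.min {r : ℕ → ℕ} {b : ℕ → ℝ} (V : View k base M r b fun _ => False)
    {j : ℕ} (hj : j ≤ k) {h : ℕ} (h1 : 2 ^ (k - j) ≤ h) (h2 : h < 2 * 2 ^ (k - j)) :
    M.ARG (r h) < 2 ^ k ∧ (2 ^ k + M.ARG (r h)) / 2 ^ j = h ∧
      M.MN (r h) = base (M.ARG (r h)) + lowSum b (2 ^ k + M.ARG (r h)) j ∧
      ∀ w < 2 ^ k, (2 ^ k + w) / 2 ^ j = h → M.MN (r h) ≤ base w + lowSum b (2 ^ k + w) j := by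
  induction j generalizing h with
  | zero =>
    simp only [Nat.sub_zero] at h1 h2
    obtain ⟨e, e1, e2⟩ := V.leaf h h1 h2
    rw [e, e1, e2]
    refine ⟨by omega, by simp; omega, by simp [lowSum], fun w hw hwh => ?_⟩
    simp at hwh
    obtain rfl : w = h - 2 ^ k := by omega
    simp [lowSum]
  | succ j ih =>
    have hk2 : 2 ^ (k - j) = 2 * 2 ^ (k - (j + 1)) := by
      rw [← pow_succ']; congr 1; omega
    have h0 : 0 < 2 ^ (k - (j + 1)) := by positivity
    have hkk : 2 * 2 ^ (k - (j + 1)) ≤ 2 ^ k := by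
      rw [← hk2]; exact Nat.pow_le_pow_right (by norm_num) (by omega)
    obtain ⟨l1, l2, l3, l4⟩ := ih (by omega) (h := 2 * h) (by omega) (by omega)
    obtain ⟨r1, r2, r3, r4⟩ := ih (by omega) (h := 2 * h + 1) (by omega) (by omega)
    obtain ⟨m1, m2, m3⟩ := V.mn h (by omega) (by omega) (by simp)
    rw [V.ad h (by omega) (by omega)] at m1 m3
    have hdd : ∀ x : ℕ, x / 2 ^ (j + 1) = x / 2 ^ j / 2 := fun x => by
      rw [pow_succ, Nat.div_div_eq_div_mul]
    have low : ∀ x, x / 2 ^ j = 2 * h → lowSum b x (j + 1) = lowSum b x j + b h := by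
      intro x hx
      rw [lowSum_succ, hdd, hx, if_pos (by omega), show 2 * h / 2 = h by omega]
    have high : ∀ x, x / 2 ^ j = 2 * h + 1 → lowSum b x (j + 1) = lowSum b x j := by
      intro x hx
      rw [lowSum_succ, hx, if_neg (by omega), add_zero]
    have hmin : ∀ w < 2 ^ k, (2 ^ k + w) / 2 ^ (j + 1) = h →
        M.MN (r h) ≤ base w + lowSum b (2 ^ k + w) (j + 1) := by
      intro w hw hwh
      rw [hdd] at hwh
      rcases (show (2 ^ k + w) / 2 ^ j = 2 * h ∨ (2 ^ k + w) / 2 ^ j = 2 * h + 1 by omega)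
        with e | e
      · rw [low _ e]; linarith [l4 w hw e]
      · rw [high _ e]; linarith [r4 w hw e]
    rcases m3 with ⟨m3, m4⟩ | ⟨m3, m4⟩
    · rw [m4]
      refine ⟨l1, by rw [hdd, l2]; omega, ?_, hmin⟩
      rw [low _ l2, m3, l3]; ring
    · rw [m4]
      refine ⟨r1, by rw [hdd, r2]; omega, ?_, hmin⟩
      rw [high _ r2, m3, r3]

/-- The best value among those of the pairs in `dn` is stored. -/
def BestInv (val : ℕ → ℕ → ℝ) (dn : ℕ → ℕ → Prop) (s : State) : Prop :=
  (s.wreg 30 = 0 ∧ ∀ v w, ¬ dn v w) ∨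
  (s.wreg 30 ≠ 0 ∧ dn (s.wreg 30) (s.wreg 31) ∧ s.rreg 5 = val (s.wreg 30) (s.wreg 31) ∧
    ∀ v w, dn v w → s.rreg 5 ≤ val v w)

theorem BestInv.congr {val : ℕ → ℕ → ℝ} {dn : ℕ → ℕ → Prop} {s s' : State}
    (h : BestInv val dn s) (h30 : s'.wreg 30 = s.wreg 30) (h31 : s'.wreg 31 = s.wreg 31)
    (h5 : s'.rreg 5 = s.rreg 5) : BestInv val dn s' := by
  unfold BestInv at *; rw [h30, h31, h5]; exact h

/-- The prefix before `v` is the disjoint union of the left halves of the nodes where the path to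
the leaf `v` turns right. Register 6 accumulates `P v` and the additions from above, so each such
half yields its best value in constant time. At height `i` the treated cells are those with `w + v %
2 ^ i < v`. As `v` is positive, the value 0 of register 30 can mean that no pair has been seen. -/
theorem query_ok {s : State} {val : ℕ → ℕ → ℝ} {dn : ℕ → ℕ → Prop} {v : ℕ}
    (D : DS k base A nx (mem s) ρ a fun _ _ => False)
    (hv : v < A) (hv1 : 1 ≤ v) (hvk : v < 2 ^ k) (h24 : s.wreg 24 = v)
    (hval : ∀ w < 2 ^ k, val v w = s.rarr 1 v + (base w + leafSum k (a v) w))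
    (hB : BestInv val dn s) (hk : s.wreg 16 = k) (hN : s.wreg 20 = 2 ^ k)
    (hN2 : s.wreg 19 = 2 * 2 ^ k) (hW : nx ≤ W) :
    Ok W query s (100 * k + 30) fun s' =>
      BestInv val (fun v' w => dn v' w ∨ (v' = v ∧ w < v)) s' := by
  have V := D.view v hv
  have hnx := D.nx_ge
  have hroot := D.root v hv
  have hkk : k < 2 ^ k := Nat.lt_two_pow_self
  have hbase := pow_div_bounds hvk (i := k) le_rfl
  simp only [Nat.sub_self, pow_zero] at hbase
  refine (Ok.seq (T := 16) (T' := k * (90 + 7) + 3) (Ok.line (by simp) ?_)).mono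
    (by omega) fun _ => id
  simp [h24, hk, hN, hN2]
  refine ⟨by omega, by omega, by omega, by omega, ?_⟩
  refine (Ok.forDown (W := W) (fun i s' => BestInv val
      (fun v' w => dn v' w ∨ (v' = v ∧ w + v % 2 ^ i < v)) s' ∧
      s'.wreg 12 = ρ v ((2 ^ k + v) / 2 ^ i) ∧ s'.wreg 13 = 2 ^ i ∧ s'.wreg 14 = v % 2 ^ i ∧
      s'.rreg 6 = s.rarr 1 v + highSum (a v) (2 ^ k + v) i k)
    (N := k) 90 (by decide) (by simp) (by omega) ?_ ?_).mono le_rfl ?_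
  · refine ⟨?_, by simp [show (2 ^ k + v) / 2 ^ k = 1 by omega, hroot], by simp,
      by simp [Nat.mod_eq_of_lt hvk], by simp [highSum]⟩
    refine BestInv.congr (s := s) ?_ (by simp) (by simp) (by simp)
    simpa [Nat.mod_eq_of_lt hvk] using hB
  · rintro i s1 hik ⟨hB1, h12, h13, h14, h6⟩ h15 hFr
    have f24 := hFr.wreg 24 (by decide)
    have f20 := hFr.warr 20 (by decide)
    have f21 := hFr.warr 21 (by decide)
    have f22 := hFr.warr 22 (by decide)
    have g2 := hFr.rarr 2 (by decide)
    have g3 := hFr.rarr 3 (by decide)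
    simp [h24] at f24 f20 f21 f22 g2 g3
    have hp : 0 < 2 ^ i := by positivity
    have hpk : 2 ^ i < 2 ^ k := Nat.pow_lt_pow_right (by norm_num) hik
    have hbd := pow_div_bounds hvk (i := i + 1) hik
    have hdd : (2 ^ k + v) / 2 ^ (i + 1) = (2 ^ k + v) / 2 ^ i / 2 := by
      rw [pow_succ, Nat.div_div_eq_div_mul]
    have hmod : v % 2 ^ (i + 1) < 2 ^ (i + 1) := Nat.mod_lt _ (by positivity)
    have hmodi : v % 2 ^ i < 2 ^ i := Nat.mod_lt _ hp
    have hbit := div_pow_bit (hi := v) hik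
    have hmod2 : v % 2 ^ (i + 1) = v % 2 ^ i + 2 ^ i * (v / 2 ^ i % 2) := Nat.mod_pow_succ
    have hbit2 : v / 2 ^ i % 2 = v % 2 ^ (i + 1) / 2 ^ i := by
      rw [pow_succ, Nat.mod_mul_right_div_self]
    have hh1 : 1 ≤ (2 ^ k + v) / 2 ^ (i + 1) := le_trans Nat.one_le_two_pow hbd.1
    have e1 : 2 ^ (k - (i + 1)) * 2 ^ (i + 1) = 2 ^ k := by rw [← pow_add]; congr 1; omega
    have hk2 : 2 ^ (k - i) = 2 * 2 ^ (k - (i + 1)) := by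
      rw [← pow_succ']; congr 1; omega
    have hh2 : (2 ^ k + v) / 2 ^ (i + 1) < 2 ^ k := by
      have : 2 * 2 ^ (k - (i + 1)) ≤ 2 ^ (k - (i + 1)) * 2 ^ (i + 1) := by
        rw [mul_comm 2]; exact Nat.mul_le_mul_left _ (by rw [pow_succ]; omega)
      omega
    have hhalf2 : 2 ^ (i + 1) / 2 = 2 ^ i := by rw [pow_succ]; omega
    set h := (2 ^ k + v) / 2 ^ (i + 1) with hh
    have lc : s.warr 20 (ρ v h) = ρ v (2 * h) := V.lc h hh1 hh2
    have rc : s.warr 21 (ρ v h) = ρ v (2 * h + 1) := V.rc h hh1 hh2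
    have ad : s.rarr 2 (ρ v h) = a v h := V.ad h hh1 hh2
    have l1 := D.lt_nx hv (h := 2 * h) (by omega) (by omega)
    have l2 := D.lt_nx hv (h := 2 * h + 1) (by omega) (by omega)
    refine Ok.line (by simp [queryBody]) ?_
    simp only [queryBody, wp, WExp.eval, RExp.eval, Test.Holds, setW_wreg, h13, hhalf2, setW_rreg,
      setR_wreg, setR_rreg, setW_rarr, setW_warr, h12, h6, h14, f20, f21, f22, g2, g3, ad, lc, rc]
    norm_num [h14, h12, h13, hhalf2, f24, f20, f21, f22, g2, g3, ad, lc, rc, h6]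
    refine ⟨by omega, fun hc => ?_, fun hc => ?_⟩
    · have hq : v % 2 ^ (i + 1) / 2 ^ i = 1 := by
        rw [Nat.div_eq_iff hp, pow_succ] at *
        constructor <;> omega
      have hr : v % 2 ^ (i + 1) = v % 2 ^ i + 2 ^ i := by
        rw [hmod2, hbit2, hq, mul_one]
      have hch : (2 ^ k + v) / 2 ^ i = 2 * h + 1 := by omega
      have hyb := Nat.div_add_mod (2 ^ k + v) (2 ^ i)
      have hym : (2 ^ k + v) % 2 ^ i = v % 2 ^ i := by
        obtain ⟨d, rfl⟩ : ∃ d, k = i + d := ⟨k - i, by omega⟩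
        rw [pow_add, Nat.mul_add_mod]
      rw [hch, hym, Nat.mul_succ] at hyb
      -- The left child consists of the cells from `v - v % 2 ^ (i + 1)` up to, but excluding, `v -
      -- v % 2 ^ i`; the additive form avoids truncated subtraction.
      have hseg : ∀ w, (2 ^ k + w) / 2 ^ i = 2 * h ↔
          v ≤ w + v % 2 ^ (i + 1) ∧ w + v % 2 ^ i < v := by
        intro w
        rw [Nat.div_eq_iff hp, mul_comm (2 * h)]
        omega
      have hhs := highSum_succ (a v) (x := 2 ^ k + v) hik
      rw [hch, if_neg (by omega), zero_add] at hhs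
      obtain ⟨m1, m2, m3, m4⟩ := V.min (j := i) (by omega) (h := 2 * h) (by omega) (by omega)
      -- the value of a pair met at this level
      have hv' : ∀ w < 2 ^ k, (2 ^ k + w) / 2 ^ i = 2 * h → val v w =
          s.rarr 1 v + highSum (a v) (2 ^ k + v) (i + 1) k + a v h +
            (base w + lowSum (a v) (2 ^ k + w) i) := by
        intro w hw hwh
        have hww : (2 ^ k + w) / 2 ^ (i + 1) = h := by
          rw [pow_succ, ← Nat.div_div_eq_div_mul, hwh]; omega
        rw [hval w hw, ← lowSum_add_highSum (a v) w hik.le, highSum_succ _ hik, hwh,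
          if_pos (by omega), hww, highSum_congr (a v) (x := 2 ^ k + w) (y := 2 ^ k + v)
            (by rw [hww, hh])]
        ring
      have hc1 := hv' _ m1 m2
      rw [← m3] at hc1
      change val v (s.warr 22 (ρ v (2 * h))) = _ + s.rarr 3 (ρ v (2 * h)) at hc1
      have hc2 : ∀ w, v ≤ w + v % 2 ^ (i + 1) → w + v % 2 ^ i < v →
          val v (s.warr 22 (ρ v (2 * h))) ≤ val v w := by
        intro w hw1 hw2
        have hw := (hseg w).2 ⟨hw1, hw2⟩
        rw [hc1, hv' w (by omega) hw]
        have := m4 w (by omega) hw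
        change s.rarr 3 (ρ v (2 * h)) ≤ _ at this
        linarith
      have hc3 := (hseg _).1 m2
      change v ≤ s.warr 22 (ρ v (2 * h)) + v % 2 ^ (i + 1) ∧
        s.warr 22 (ρ v (2 * h)) + v % 2 ^ i < v at hc3
      have hgg : s.warr 22 (ρ v (2 * h)) < 2 ^ k := m1
      have hcov : ∀ w, w + v % 2 ^ i < v → w + v % 2 ^ (i + 1) < v ∨
          (v ≤ w + v % 2 ^ (i + 1) ∧ w + v % 2 ^ i < v) := by omega
      refine ⟨fun c1 c2 => ⟨by omega, by omega, ?_, by rw [hch], by omega, by rw [hhs]⟩, fun c1 =>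
        ⟨by omega, by omega, by omega, by omega, ?_, by rw [hch], by omega, by rw [hhs]⟩⟩
      · rcases hB1 with ⟨b1, -⟩ | ⟨b1, b2, b3, b4⟩
        · exact absurd b1 c1
        · right
          simp
          refine ⟨b1, ?_, b3, ?_⟩
          · rcases b2 with b2 | ⟨b2, b2'⟩
            · exact Or.inl b2
            · exact Or.inr ⟨b2, by omega⟩
          · rintro v' w (hd | ⟨rfl, hd⟩)
            · exact b4 _ _ (Or.inl hd)
            · rcases hcov w hd with hd | ⟨hd1, hd2⟩
              · exact b4 _ _ (Or.inr ⟨rfl, hd⟩)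
              · have := hc2 w hd1 hd2
                rw [hc1] at this
                linarith
      · right
        simp
        refine ⟨by omega, Or.inr hc3.2, hc1.symm, ?_⟩
        rw [← hc1]
        rw [← hc1] at c1
        have old : ∀ v' w, dn v' w ∨ (v' = v ∧ w + v % 2 ^ (i + 1) < v) →
            val v (s.warr 22 (ρ v (2 * h))) ≤ val v' w := by
          intro v' w hd
          rcases hB1 with ⟨b1, b2⟩ | ⟨b1, b2, b3, b4⟩
          · exact absurd hd (b2 _ _)
          · exact (c1 b1).le.trans (b4 _ _ hd)
        rintro v' w (hd | ⟨rfl, hd⟩)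
        · exact old _ _ (Or.inl hd)
        · rcases hcov w hd with hd | ⟨hd1, hd2⟩
          · exact old _ _ (Or.inr ⟨rfl, hd⟩)
          · exact hc2 w hd1 hd2
    · have hq : v % 2 ^ (i + 1) / 2 ^ i = 0 := Nat.div_eq_of_lt hc
      have hr : v % 2 ^ (i + 1) = v % 2 ^ i := by
        rw [hmod2, hbit2, hq, mul_zero, add_zero]
      have hch : (2 ^ k + v) / 2 ^ i = 2 * h := by omega
      have hhs := highSum_succ (a v) (x := 2 ^ k + v) hik
      rw [hch, if_pos (by omega), ← hh] at hhs
      refine ⟨by omega, ?_, by rw [hch], by omega, ?_⟩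
      · rw [← hr]
        exact hB1.congr (by simp) (by simp) (by simp)
      · rw [hhs]; ring
  · rintro s' ⟨⟨hB', -⟩, -⟩
    simpa [Nat.mod_one] using hB'

end RAM

/-! ## Sums over subtrees, and the main loop -/

open Classical in
/-- The sum of `f` over the descendants of `u`. -/
noncomputable def subSum {α : Type*} [AddCommMonoid α] (par : ℕ → ℕ) (n : ℕ) (f : ℕ → α) (u : ℕ) : α :=
  ∑ x ∈ Finset.range n, if Anc par u x then f x else 0

/-- The sum of `f u` and the sums over the subtrees of the children of `u` from `i` on. -/
noncomputable def accum {α : Type*} [AddCommMonoid α] (par : ℕ → ℕ) (n : ℕ) (f : ℕ → α) (i u : ℕ) : α :=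
  f u + ∑ c ∈ Finset.Ico i n, if par c = u then subSum par n f c else 0

section
variable {α : Type*} [AddCommMonoid α] {par : ℕ → ℕ} {n : ℕ}

theorem anc_le_of_par_lt (hpar : ∀ i < n, 0 < i → par i < i) {u x : ℕ} (hx : x < n)
    (h : Anc par u x) : u ≤ x := by
  induction h with
  | refl => exact le_rfl
  | step h0 _ ih => have := hpar _ hx h0; have := ih (by omega); omega

open Classical in
-- A proper descendant of `u` is below exactly one child of `u`, so the indicators add up. The
-- induction follows `x` to its parent; children are sought from `u + 1` on because they have larger
-- numbers.
theorem ite_anc_eq (hpar : ∀ i < n, 0 < i → par i < i) (m : α) (u : ℕ) {x : ℕ} (hx : x < n) :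
    (if Anc par u x then m else 0) = (if u = x then m else 0) +
      ∑ c ∈ Finset.Ico (u + 1) n, if par c = u then (if Anc par c x then m else 0) else 0 := by
  induction x using Nat.strong_induction_on with
  | _ x ih =>
    by_cases hux : u = x
    · subst hux
      rw [if_pos .refl, if_pos rfl, Finset.sum_eq_zero, add_zero]
      intro c hc
      rw [Finset.mem_Ico] at hc
      have : ¬ Anc par c u := fun h => by have := anc_le_of_par_lt hpar hx h; omega
      simp [this]
    · rw [if_neg hux, zero_add]
      rcases Nat.eq_zero_or_pos x with rfl | h0
      · rw [if_neg (by rw [anc_iff]; simp [hux]), Finset.sum_eq_zero]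
        intro c hc
        rw [Finset.mem_Ico] at hc
        have : ¬ Anc par c 0 := fun h => by have := anc_le_of_par_lt hpar hx h; omega
        simp [this]
      · have hp := hpar x hx h0
        have e : ∀ c, (if Anc par c x then m else 0) =
            (if c = x then m else 0) + if Anc par c (par x) then m else 0 := by
          intro c
          by_cases hc : c = x
          · subst hc
            have : ¬ Anc par c (par c) := fun h => by
              have := anc_le_of_par_lt hpar (by omega) h; omega
            simp [this, Anc.refl]
          · rw [anc_iff]; simp [hc, h0]
        rw [e u, if_neg hux, zero_add, ih (par x) hp (by omega)]
        have : ∀ c ∈ Finset.Ico (u + 1) n, (if par c = u then (if Anc par c x then m else 0) else 0)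
            = (if c = x then (if par x = u then m else 0) else 0) +
              if par c = u then (if Anc par c (par x) then m else 0) else 0 := by
          intro c _
          rw [e c]
          by_cases hcx : c = x
          · subst hcx; split_ifs <;> simp
          · simp [hcx]
        rw [Finset.sum_congr rfl this, Finset.sum_add_distrib]
        congr 1
        rw [Finset.sum_ite_eq']
        by_cases hpu : par x = u
        · subst hpu; simp [hx]; omega
        · simp [hpu, Ne.symm hpu]

/-- All the children of `u` have numbers beyond `u`, so once these have been absorbed nothing is
missing from the subtree sum. -/
theorem accum_self (hpar : ∀ i < n, 0 < i → par i < i) (f : ℕ → α) {u : ℕ} (hu : u < n) :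
    accum par n f (u + 1) u = subSum par n f u := by
  classical
  unfold accum
  conv_rhs => unfold subSum
  rw [Finset.sum_congr rfl fun x hx => ite_anc_eq hpar (f x) u (Finset.mem_range.1 hx),
    Finset.sum_add_distrib, Finset.sum_ite_eq, if_pos (Finset.mem_range.2 hu), Finset.sum_comm]
  congr 1
  refine Finset.sum_congr rfl fun c _ => ?_
  unfold subSum
  split_ifs <;> simp

/-- This is the effect of one merge: `v` hands what it has collected, by then its whole subtree sum,
to its parent. -/
theorem accum_step (f : ℕ → α) {u v : ℕ} (hv : v < n)
    (hs : accum par n f (v + 1) v = subSum par n f v) :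
    accum par n f v u = accum par n f (v + 1) u +
      if u = par v then accum par n f (v + 1) v else 0 := by
  rw [hs]
  unfold accum
  rw [Finset.sum_eq_sum_Ico_succ_bot hv, add_assoc, add_comm (∑ k ∈ _, _)]
  simp only [eq_comm]

theorem accum_top (f : ℕ → α) (u : ℕ) : accum par n f n u = f u := by
  simp [accum]

end

namespace RAM

/-- Query and merge the trees of all the vertices but the root, children first. -/
def mainLoop : Prog :=
  .seq (.wset 24 (.reg 0))
  (.loop (.wle (.const 2) (.reg 24))
    (.seq (.wset 24 (.sub (.reg 24) (.const 1)))
    (.seq query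
    (.seq (.wset 25 (.load 15 (.reg 24))) merge))))

variable {W k n : ℕ} {base : ℕ → ℝ} {par : ℕ → ℕ}

/-- The ghost is the pair of the number of trees left and the number of nodes owned. Each tree pays
for its query, and each owned node pays 200 operations towards the merge in which it disappears. By
`accum_self` the tree of `v` is complete when it is queried, so the query sees the true values `val
v w`. -/
theorem mainLoop_ok {s : State} {f : ℕ → ℕ → ℝ} {P : ℕ → ℝ} {val : ℕ → ℕ → ℝ} {Φ : ℕ}
    (hF : ForestP k base n f Φ s) (hn : s.wreg 0 = n) (hn2 : 2 ≤ n) (hnk : n ≤ 2 ^ k)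
    (hpar : ∀ i < n, 0 < i → par i < i) (h15 : ∀ i < n, s.warr 15 i = par i)
    (hP : ∀ i < n, s.rarr 1 i = P i) (h30 : s.wreg 30 = 0)
    (hval : ∀ v w, val v w = P v + (base w + subSum par n f v w))
    (hk : s.wreg 16 = k) (hN : s.wreg 20 = 2 ^ k) (hN2 : s.wreg 19 = 2 * 2 ^ k)
    (hW : s.wreg 18 ≤ W) :
    Ok W mainLoop s (n * (100 * k + 110) + 200 * Φ + 10) fun s' =>
      BestInv val (fun v w => 1 ≤ v ∧ v < n ∧ w < v) s' := by
  have hnx : 2 * 2 ^ k + n ≤ s.wreg 18 := by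
    obtain ⟨ρ, a, D, -⟩ := hF; exact D.nx_ge
  have hk1 : 1 ≤ k := by
    rcases Nat.eq_zero_or_pos k with rfl | h
    · simp at hnk; omega
    · exact h
  refine (Ok.seq (T := 2) (T' := n * (100 * k + 110) + 200 * Φ + 8) (Ok.line (by simp) ?_)).mono
    (by omega) fun _ => id
  simp only [wp, WExp.eval, hn]
  refine ⟨by omega, ?_⟩
  refine (Ok.loop (fun (g : ℕ × ℕ) s' => s'.wreg 24 = g.1 ∧ 1 ≤ g.1 ∧ g.1 ≤ n ∧
      s'.wreg 18 = s.wreg 18 ∧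
      ForestP k base g.1 (accum par n f g.1) g.2 s' ∧
      BestInv val (fun v w => g.1 ≤ v ∧ v < n ∧ w < v) s')
    (fun g => g.1 * (100 * k + 110) + 200 * g.2 + 8) (n, Φ) ?_ ?_ ?_)
  · refine ⟨by simp, by simp; omega, le_rfl, by simp, ?_, ?_⟩
    · obtain ⟨ρ, a, D, h1, h2⟩ := hF
      refine ⟨ρ, a, by simpa [mem] using D, fun u hu w hw => ?_, h2⟩
      rw [h1 u hu w hw, accum_top]
    · left
      refine ⟨by simp [h30], by simp; omega⟩
  · rintro ⟨i, Ψ⟩ s' ⟨h24, h1, h2, h18, hF', hB⟩ - hc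
    simp only [Test.Holds, WExp.eval, h24, not_le] at hc
    obtain rfl : i = 1 := by dsimp only at *; omega
    exact ⟨by simp, hB⟩
  · rintro ⟨i, Ψ⟩ s1 ⟨h24, h1, h2, h18, hF1, hB⟩ hFr hc
    simp only [Test.Holds, WExp.eval, h24] at hc
    dsimp only at *
    obtain ⟨v, rfl⟩ : ∃ v, i = v + 1 := ⟨i - 1, by omega⟩
    have hv1 : 1 ≤ v := by omega
    have f16 := hFr.wreg 16 (by decide)
    have f20 := hFr.wreg 20 (by decide)
    have f19 := hFr.wreg 19 (by decide)
    have f15 := hFr.warr 15 (by decide)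
    have r1 := hFr.rarr 1 (by decide)
    simp [hk, hN, hN2] at f16 f20 f19 f15 r1
    have hself := accum_self hpar f (u := v) (by omega)
    obtain ⟨ρ, a, D, hS, hΦ⟩ := hF1
    have hF2 : ForestP k base (v + 1) (accum par n f (v + 1)) Ψ (s1.setW 24 v) :=
      ⟨ρ, a, by simpa [mem] using D, hS, hΦ⟩
    -- the merge, from any memory with the right contents
    have hmerge : ∀ s2, (∀ x ∈ [16, 18, 19, 20, 24], s2.wreg x = (s1.setW 24 v).wreg x) →
        s2.warr 15 = s.warr 15 → mem s2 = mem s1 →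
        ∃ len ≤ Ψ, Ok W merge (s2.setW 25 (par v)) (200 * len + 60) fun s' =>
          s'.wreg 18 = s.wreg 18 ∧ ForestP k base v (accum par n f v) (Ψ - len) s' := by
      intro s2 hr h15' hm
      have e18 := hr 18 (by simp)
      have e19 := hr 19 (by simp)
      have e24 := hr 24 (by simp)
      simp at e18 e19 e24
      have hm' : mem (s2.setW 25 (par v)) = mem s1 := by rw [← hm]; simp [mem]
      obtain ⟨len, hlen, hok⟩ := merge_ok (W := W) (s0 := s2.setW 25 (par v)) (v := v) (p := par v)
        (k := k) (base := base) (F := accum par n f (v + 1)) (Φ := Ψ)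
        ⟨ρ, a, by rw [hm']; simpa [e18] using D, hS, hΦ⟩ (hpar v (by omega) hv1) (by simp [e24])
        (by simp) (by simp [e19, f19]) hk1 (by simp [e18]; omega)
      refine ⟨len, hlen, hok.mono le_rfl ?_⟩
      rintro s' ⟨g18, ρ', a', D', hS', hΦ'⟩
      refine ⟨by rw [g18]; simp [e18, h18], ρ', a', D', fun u hu w hw => ?_, hΦ'⟩
      rw [hS' u hu w hw, accum_step f (by omega) hself]
      by_cases he : u = par v <;> simp [he]
    have hq : Ok W query (s1.setW 24 v) (100 * k + 30) _ :=
      query_ok (k := k) (base := base) (A := v + 1) (nx := s1.wreg 18) (ρ := ρ) (a := a)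
        (val := val) (dn := fun v' w => v + 1 ≤ v' ∧ v' < n ∧ w < v') (v := v)
        (by simpa [mem] using D) (by omega) hv1 (by omega) (by simp)
        (fun w hw => by
          rw [hS v (by omega) w hw, hself, hval]; simp [r1, hP v (by omega)])
        (hB.congr (by simp) (by simp) (by simp)) (by simp [f16]) (by simp [f20]) (by simp [f19])
        (by omega)
    obtain ⟨s2, t2, hE, ht2, hB2⟩ := hq
    have hFr2 := hE.fr
    obtain ⟨len, hlen, hok⟩ := hmerge s2
      (by intro x hx; apply hFr2.wreg; fin_cases hx <;> decide)
      (by rw [hFr2.warr 15 (by decide)]; simp [f15])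
      (by simp only [mem, hFr2.warr 20 (by decide), hFr2.warr 21 (by decide),
            hFr2.warr 22 (by decide), hFr2.rarr 2 (by decide), hFr2.rarr 3 (by decide)]; simp)
    refine ⟨4 + ((100 * k + 30) + (3 + (200 * len + 60))), ?_⟩
    refine Ok.seq (Ok.line (by simp) ?_)
    simp only [wp, WExp.eval, h24, Nat.add_sub_cancel]
    refine ⟨by omega, Ok.seq ⟨s2, t2, hE, ht2, ?_⟩⟩
    have e24 := hFr2.wreg 24 (by decide)
    have e15 := hFr2.warr 15 (by decide)
    simp [f15] at e24 e15
    refine Ok.seq (Ok.line (by simp) ?_)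
    have hpv := hpar v (by omega) hv1
    simp only [wp, WExp.eval, e24, e15, h15 v (by omega)]
    refine ⟨by omega, hok.fr.mono le_rfl ?_⟩
    rintro s3 ⟨⟨g18, hF3⟩, hFr3⟩
    have g24 := hFr3.wreg 24 (by decide)
    simp [e24] at g24
    refine ⟨(v, Ψ - len), ⟨g24, hv1, by omega, g18, hF3, ?_⟩, ?_⟩
    · refine BestInv.congr (s := s2) ?_ (by rw [hFr3.wreg 30 (by decide)]; simp)
        (by rw [hFr3.wreg 31 (by decide)]; simp) (by rw [hFr3.rreg 5 (by decide)]; simp)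
      convert hB2 using 3 with v' w
      constructor
      · rintro ⟨a1, a2, a3⟩
        rcases Nat.eq_or_lt_of_le a1 with rfl | a1
        · exact Or.inr ⟨rfl, a3⟩
        · exact Or.inl ⟨a1, a2, a3⟩
      · rintro (⟨a1, a2, a3⟩ | ⟨rfl, a3⟩)
        · exact ⟨by dsimp only; omega, a2, a3⟩
        · exact ⟨le_rfl, by omega, a3⟩
    · simp only [Test.cost, WExp.cost, add_mul, one_mul]
      omega

end RAM

/-! ## The initial forest -/

namespace RAM

/-- Compute the size of the static tree. -/
def sizeProg : Prog :=
  .seq (.seq (.wset 16 (.const 0)) (.wset 20 (.const 1)))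
  (.seq (.loop (.wle (.reg 20) (.reg 0))
    (.seq (.wset 20 (.mul (.reg 20) (.const 2))) (.wset 16 (.add (.reg 16) (.const 1)))))
    (.seq (.wset 19 (.mul (.reg 20) (.const 2))) (.seq (.wset 18 (.add (.reg 19) (.reg 0)))
      (.wset 2 (.const 0)))))

/-- Make the leaves. -/
def leavesProg : Prog :=
  forUp 2 20 (.seq (.rstore 3 (.add (.reg 20) (.reg 2)) (.load 1 (.reg 2)))
    (.wstore 22 (.add (.reg 20) (.reg 2)) (.reg 2)))

/-- Make the inner nodes of the static tree. -/
def innerProg : Prog :=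
  forDown 2 (.seq (.seq (.wset 12 (.reg 2))
    (.seq (.wstore 20 (.reg 2) (.mul (.reg 2) (.const 2)))
    (.seq (.wstore 21 (.reg 2) (.add (.mul (.reg 2) (.const 2)) (.const 1)))
    (.rstore 2 (.reg 2) .zero)))) pullProg)

/-- Make the roots. -/
def rootsProg : Prog :=
  forUp 2 0 (.seq (.wstore 20 (.add (.reg 19) (.reg 2)) (.const 2))
    (.seq (.wstore 21 (.add (.reg 19) (.reg 2)) (.const 3))
    (.seq (.wstore 22 (.add (.reg 19) (.reg 2)) (.load 22 (.const 1)))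
    (.seq (.rstore 2 (.add (.reg 19) (.reg 2)) .zero)
      (.rstore 3 (.add (.reg 19) (.reg 2)) (.load 3 (.const 1)))))))

/-- Make the static tree and the roots of all the trees. -/
def build : Prog :=
  .seq sizeProg (.seq leavesProg (.seq innerProg rootsProg))

variable {W k n : ℕ} {base : ℕ → ℝ}

/-- The size `2 ^ k` has to exceed `n` strictly, since a prefix may end at `n` and this end is used
as the index of a leaf. -/
theorem sizeProg_ok {s : State} (hn : s.wreg 0 = n) (hn1 : 1 ≤ n) (hW : 5 * n ≤ W) :
    Ok W sizeProg s (20 * (Nat.log 2 n + 1) + 30) fun s' =>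
      s'.wreg 16 = Nat.log 2 n + 1 ∧ s'.wreg 20 = 2 ^ (Nat.log 2 n + 1) ∧
      s'.wreg 19 = 2 * 2 ^ (Nat.log 2 n + 1) ∧ s'.wreg 18 = 2 * 2 ^ (Nat.log 2 n + 1) + n ∧
      s'.wreg 2 = 0 := by
  set k := Nat.log 2 n + 1 with hk
  have hk2 : 2 ^ k ≤ 2 * n := by
    rw [hk, pow_succ]; have := Nat.pow_log_le_self 2 (x := n) (by omega); omega
  refine (Ok.seq (T := 4) (T' := 20 * k + 20) (Ok.line (by simp) ?_)).mono (by omega) fun _ => id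
  simp only [wp, WExp.eval]
  refine ⟨by omega, by omega, ?_⟩
  have hl : ∀ s1 : State, s1.wreg 0 = n → s1.wreg 16 = 0 → s1.wreg 20 = 1 →
      Ok W (.loop (.wle (.reg 20) (.reg 0))
        (.seq (.wset 20 (.mul (.reg 20) (.const 2))) (.wset 16 (.add (.reg 16) (.const 1))))) s1
        ((k - 0) * 20 + 4) fun s' => s'.wreg 16 = k ∧ s'.wreg 20 = 2 ^ k := by
    intro s1 h0 h16 h20
    refine Ok.loop (fun j s' => j ≤ k ∧ s'.wreg 16 = j ∧ s'.wreg 20 = 2 ^ j)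
      (fun j => (k - j) * 20 + 4) 0 ⟨by omega, h16, by simpa using h20⟩ ?_ ?_
    · rintro j s' ⟨h1, h2, h3⟩ hF hb
      have := hF.wreg 0 (by decide)
      simp only [Test.Holds, WExp.eval, this, h0, h3, not_le] at hb
      have : j = k := by
        have := (Nat.log_lt_iff_lt_pow (b := 2) (by norm_num) (by omega : n ≠ 0)).2 hb
        omega
      subst this
      exact ⟨by simp, h2, h3⟩
    · rintro j s' ⟨h1, h2, h3⟩ hF hb
      have := hF.wreg 0 (by decide)
      simp only [Test.Holds, WExp.eval, this, h0, h3] at hb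
      have hj := (Nat.le_log_iff_pow_le (b := 2) (by norm_num) (by omega : n ≠ 0)).2 hb
      refine ⟨8, Ok.line (by simp) ?_⟩
      simp only [wp, WExp.eval, setW_wreg, h2, h3]
      have hjW : j < 2 ^ j := Nat.lt_two_pow_self
      refine ⟨by omega, by norm_num [h2]; omega, j + 1, ⟨by omega, by simp [h2], by simp [pow_succ]⟩, ?_⟩
      simp only [Test.cost, WExp.cost]
      omega
  refine (Ok.seq' (T := (k - 0) * 20 + 4) (T' := 16) (hl _ (by simp [hn]) (by simp) (by simp)) ?_).mono
    (by omega) fun _ => id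
  rintro s' ⟨h16, h20⟩ hF
  have h0 := hF.wreg 0 (by decide)
  simp [hn] at h0
  refine Ok.line (by simp) ?_
  simp only [wp, WExp.eval, setW_wreg, h20, h0]
  norm_num [h16, h20, h0]
  omega

theorem leavesProg_ok {s : State} (h20 : s.wreg 20 = 2 ^ k) (h2 : s.wreg 2 = 0)
    (hW : 2 * 2 ^ k ≤ W) (h22 : ∀ i, s.warr 22 i < 2 ^ k) :
    Ok W leavesProg s (2 ^ k * 40 + 4) fun s' => s'.wreg 2 = 2 ^ k ∧
      (∀ h, 2 ^ k ≤ h → h < 2 * 2 ^ k → s'.rarr 3 h = s.rarr 1 (h - 2 ^ k) ∧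
        s'.warr 22 h = h - 2 ^ k) ∧ ∀ i, s'.warr 22 i < 2 ^ k := by
  refine (Ok.forUp (fun i s' => (∀ h, 2 ^ k ≤ h → h < 2 ^ k + i →
    s'.rarr 3 h = s.rarr 1 (h - 2 ^ k) ∧
        s'.warr 22 h = h - 2 ^ k) ∧ ∀ i, s'.warr 22 i < 2 ^ k) (a := 0) (N := 2 ^ k) 30 (by decide) (by decide) (by decide)
        h2 h20 (by omega) (by omega) ⟨by omega, h22⟩ ?_).mono (by omega) ?_
  · rintro i s' - hi ⟨hI, hA⟩ hx hF
    have f20 := hF.wreg 20 (by decide)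
    have f1 := hF.rarr 1 (by decide)
    rw [h20] at f20
    refine Ok.line (by simp) ?_
    simp only [wp, WExp.eval, RExp.eval, storeR_wreg, hx, f20, f1]
    refine ⟨by omega, by omega, by omega, ?_, ?_⟩
    · intro h h1 h2'
      by_cases he : h = 2 ^ k + i
      · subst he; simp
      · simpa [he] using hI h h1 (by omega)
    · intro j
      by_cases he : j = 2 ^ k + i
      · subst he; simpa using hi
      · simpa [he] using hA j
  · rintro s' ⟨⟨h1, h2⟩, h3⟩
    exact ⟨h3, fun h ha hb => h1 h ha (by omega), h2⟩

/-- The static tree is complete from the heap position `i` on. -/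
def InnerInv (k : ℕ) (base : ℕ → ℝ) (i : ℕ) (s' : State) : Prop :=
  (∀ h, 2 ^ k ≤ h → h < 2 * 2 ^ k → s'.rarr 3 h = base (h - 2 ^ k) ∧ s'.warr 22 h = h - 2 ^ k) ∧
  (∀ i, s'.warr 22 i < 2 ^ k) ∧
  ∀ h, i ≤ h → h < 2 ^ k → 1 ≤ h → s'.warr 20 h = 2 * h ∧ s'.warr 21 h = 2 * h + 1 ∧
    s'.rarr 2 h = 0 ∧ (mem s').PullEq h (2 * h) (2 * h + 1)

/-- Running downwards, the loop finds both children complete. It also visits the index 0, which is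
not a heap position and receives junk; hence the restriction to `1 ≤ h` in the invariant, while the
bound on array 22 is kept for all cells. -/
theorem innerProg_ok {s : State} (h2 : s.wreg 2 = 2 ^ k) (hW : 2 * 2 ^ k ≤ W)
    (hleaf : ∀ h, 2 ^ k ≤ h → h < 2 * 2 ^ k → s.rarr 3 h = base (h - 2 ^ k) ∧
        s.warr 22 h = h - 2 ^ k) (h22 : ∀ i, s.warr 22 i < 2 ^ k) :
    Ok W innerProg s (2 ^ k * 80 + 3) fun s' => s'.wreg 2 = 0 ∧
      View k base (mem s') (fun h => h) (fun _ => 0) (fun _ => False) ∧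
      ∀ i, s'.warr 22 i < 2 ^ k := by
  refine (Ok.forDown (InnerInv k base)
        (N := 2 ^ k) 73 (by decide) h2 (by omega) ⟨hleaf, h22, by omega⟩ ?_).mono (by omega) ?_
  · rintro i s1 hi ⟨hI, hA, hB⟩ hx hF
    refine Ok.line (by simp [pullProg]) ?_
    have key : ∀ (s' : State), (∀ h, h ≠ i → s'.rarr 3 h = s1.rarr 3 h ∧
        s'.warr 22 h = s1.warr 22 h ∧ s'.rarr 2 h = s1.rarr 2 h ∧ s'.warr 20 h = s1.warr 20 h ∧
        s'.warr 21 h = s1.warr 21 h) → s'.warr 22 i < 2 ^ k →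
        s'.warr 20 i = 2 * i → s'.warr 21 i = 2 * i + 1 → s'.rarr 2 i = 0 →
        (1 ≤ i → (mem s').PullEq i (2 * i) (2 * i + 1)) →
        InnerInv k base i s' := by
      intro s' hne c1 c2 c3 c4 c5
      refine ⟨fun h a b => ?_, fun j => ?_, fun h a b c => ?_⟩
      · rw [(hne h (by omega)).1, (hne h (by omega)).2.1]; exact hI h a b
      · by_cases hj : j = i
        · rw [hj]; exact c1
        · rw [(hne j hj).2.1]; exact hA j
      · by_cases hj : h = i
        · subst hj; exact ⟨c2, c3, c4, c5 c⟩
        · obtain ⟨d1, d2, d3, d4⟩ := hB h (by omega) b c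
          have e := hne h hj
          have e1 := hne (2 * h) (by omega)
          have e2 := hne (2 * h + 1) (by omega)
          refine ⟨by rw [e.2.2.2.1, d1], by rw [e.2.2.2.2, d2], by rw [e.2.2.1, d3], ?_⟩
          unfold Mem.PullEq mem at *
          dsimp only at *
          rw [e.1, e.2.1, e.2.2.1, e1.1, e1.2.1, e2.1, e2.2.1]
          exact d4
    have ne1 : 1 ≤ i → 2 * i ≠ i := by omega
    have ne2 : 2 * i + 1 ≠ i := by omega
    have hi2 : i * 2 = 2 * i := by omega
    simp [pullProg, hi2]
    refine ⟨by omega, by omega, by omega, by omega, by omega, fun hc => ⟨by omega, ?_, ?_⟩,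
      fun hc => ⟨by omega, ?_, ?_⟩⟩
    · have := hA (2 * i); omega
    · refine key _ (fun h hh => by simp [hh]) ?_ (by simp) (by simp) (by simp) fun h1 => ?_
      · simpa using hA (2 * i)
      · simp [Mem.PullEq, mem, ne1 h1, ne2]; simpa [ne2, ne1 h1] using hc
    · have := hA (2 * i + 1); omega
    · refine key _ (fun h hh => by simp [hh]) ?_ (by simp) (by simp) (by simp) fun h1 => ?_
      · simpa using hA (2 * i + 1)
      · simp [Mem.PullEq, mem, ne1 h1, ne2]; exact hc.le
  · rintro s' ⟨⟨h1, h2, h3⟩, h4⟩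
    refine ⟨h4, ⟨fun h a b => (h3 h (by omega) b a).1, fun h a b => (h3 h (by omega) b a).2.1,
      fun h a b => (h3 h (by omega) b a).2.2.1, fun h a b _ => (h3 h (by omega) b a).2.2.2,
      fun h a b => ⟨rfl, (h1 h a b).1, (h1 h a b).2⟩⟩, h2⟩

/-- Each vertex gets a private copy of the static root and shares everything else. So a descent
always starts at an owned node, where additions may be written at once. -/
theorem rootsProg_ok {s : State} (hk : 1 ≤ k) (h2 : s.wreg 2 = 0) (h0 : s.wreg 0 = n)
    (h19 : s.wreg 19 = 2 * 2 ^ k) (h18 : s.wreg 18 = 2 * 2 ^ k + n) (hW : 2 * 2 ^ k + n ≤ W)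
    (V : View k base (mem s) (fun h => h) (fun _ => 0) (fun _ => False))
    (h22 : ∀ i, s.warr 22 i < 2 ^ k) :
    Ok W rootsProg s (n * 60 + 4) fun s' => Forest k base n (fun _ _ => 0) s' := by
  have hp : 2 ≤ 2 ^ k := by
    calc 2 = 2 ^ 1 := by norm_num
      _ ≤ 2 ^ k := Nat.pow_le_pow_right (by norm_num) hk
  refine (Ok.forUp (fun i s' => (∀ h, h < 2 * 2 ^ k → s'.warr 20 h = s.warr 20 h ∧
    s'.warr 21 h = s.warr 21 h ∧ s'.warr 22 h = s.warr 22 h ∧ s'.rarr 2 h = s.rarr 2 h ∧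
    s'.rarr 3 h = s.rarr 3 h) ∧ (∀ u < i, s'.warr 20 (2 * 2 ^ k + u) = 2 ∧
    s'.warr 21 (2 * 2 ^ k + u) = 3 ∧ s'.warr 22 (2 * 2 ^ k + u) = s.warr 22 1 ∧
    s'.rarr 2 (2 * 2 ^ k + u) = 0 ∧ s'.rarr 3 (2 * 2 ^ k + u) = s.rarr 3 1) ∧
    (∀ i, s'.warr 22 i < 2 ^ k) ∧ s'.wreg 18 = 2 * 2 ^ k + n) (a := 0) (N := n) 50 (by decide) (by decide) (by decide)
    h2 h0 (by omega) (by omega) ⟨by simp, by omega, h22, h18⟩ ?_).mono (by omega) ?_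
  · rintro i s' - hi ⟨hI, hA, hB, hC⟩ hx hF
    have f19 := hF.wreg 19 (by decide)
    rw [h19] at f19
    refine Ok.line (by simp) ?_
    have e1 := hI 1 (by omega)
    simp [hx, f19, e1]
    have := h22 1
    refine ⟨by omega, by omega, by omega, by omega, by omega, by omega, by omega, fun h hh => ?_, fun u hu => ?_, fun j => ?_, hC⟩
    · simpa [show h ≠ 2 * 2 ^ k + i by omega] using hI h hh
    · by_cases he : u = i
      · subst he; simp
      · simpa [he] using hA u (by omega)
    · by_cases he : j = 2 * 2 ^ k + i
      · subst he; simpa using this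
      · simpa [he] using hB j
  · rintro s' ⟨⟨h1, h2, h3, hw⟩, -⟩
    have hst : View k base (mem s') (fun h => h) (fun _ => 0) (fun _ => False) := by
      refine V.congr (fun h a b => ?_) fun h a b => ?_
      · simp [mem, h1 h (by omega)]
      · simp [mem, h1 h b]
    refine ⟨fun u h => if h = 1 then 2 * 2 ^ k + u else h, fun _ _ => 0,
      ⟨hst, fun u hu => ?_, by simp, ?_, ?_, ?_, h3⟩, ?_⟩
    · obtain ⟨c1, c2, c3, c4, c5⟩ := h2 u hu
      have e1 := hst.lc 1 le_rfl (by omega)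
      have e3 := hst.mn 1 le_rfl (by omega) (by simp)
      have a1 := hst.ad 1 le_rfl (by omega)
      have o1 := h1 1 (by omega)
      refine ⟨fun h a b => ?_, fun h a b => ?_, fun h a b => ?_, fun h a b _ => ?_, fun h a b => ?_⟩
      · by_cases hh : h = 1
        · subst hh; simpa [mem] using c1
        · simpa [hh, show 2 * h ≠ 1 by omega] using hst.lc h a b
      · by_cases hh : h = 1
        · subst hh; simpa [mem] using c2
        · simpa [hh, show h ≠ 0 by omega] using hst.rc h a b
      · by_cases hh : h = 1
        · subst hh; simpa [mem] using c4
        · simpa [hh] using hst.ad h a b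
      · by_cases hh : h = 1
        · subst hh
          simp [mem, Mem.PullEq, c3, c4, c5] at e3 a1 ⊢
          rwa [o1.2.2.1, o1.2.2.2.2, a1, zero_add] at e3
        · simpa [hh, show h ≠ 0 by omega, show 2 * h ≠ 1 by omega] using
            hst.mn h a b (by simp)
      · simpa [show h ≠ 1 by omega] using hst.leaf h a b
    · have := hw; omega
    · intro u hu h a b
      have := hw
      split_ifs <;> omega
    · intro u hu u' hu' h h' a b a' b'
      split_ifs <;> omega
    · intro u hu w hw
      simp [leafSum]

theorem build_ok {s : State} (hn : s.wreg 0 = n) (hn1 : 1 ≤ n) (hW : 5 * n ≤ W)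
    (hk : k = Nat.log 2 n + 1) (h22 : s.warr 22 = fun _ => 0) :
    Ok W build s (500 * n + 100) fun s' => Forest k (s.rarr 1) n (fun _ _ => 0) s' ∧
      s'.wreg 16 = k ∧ s'.wreg 20 = 2 ^ k ∧ s'.wreg 19 = 2 * 2 ^ k ∧
      s'.wreg 18 = 2 * 2 ^ k + n := by
  have hk2 : 2 ^ k ≤ 2 * n := by
    rw [hk, pow_succ]; have := Nat.pow_log_le_self 2 (x := n) (by omega); omega
  have hkn : k < 2 ^ k := Nat.lt_two_pow_self
  refine (Ok.seq' (T := 20 * k + 30) (T' := 400 * n + 50)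
    (by rw [hk]; exact sizeProg_ok hn hn1 hW) ?_).mono (by omega) fun _ => id
  rw [← hk]
  rintro s1 ⟨a16, a20, a19, a18, a2⟩ hF1
  have a22 := hF1.warr 22 (by decide)
  have a1 := hF1.rarr 1 (by decide)
  have a0 := hF1.wreg 0 (by decide)
  refine (Ok.seq' (T := 2 ^ k * 40 + 4) (T' := 300 * n + 30)
    (leavesProg_ok a20 a2 (by omega) (by rw [a22, h22]; simp)) ?_).mono (by omega) fun _ => id
  rintro s2 ⟨b2, bl, b22⟩ hF2
  refine (Ok.seq' (T := 2 ^ k * 80 + 3) (T' := n * 60 + 4)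
    (innerProg_ok (base := s.rarr 1) b2 (by omega) (by rw [← a1]; exact bl) b22) ?_).mono (by omega)
    fun _ => id
  rintro s3 ⟨c2, V, c22⟩ hF3
  have e : ∀ x ∈ [0, 16, 18, 19, 20], s3.wreg x = s1.wreg x := by
    intro x hx
    rw [hF3.wreg x (by revert hx; revert x; decide), hF2.wreg x (by revert hx; revert x; decide)]
  simp only [List.mem_cons, List.not_mem_nil, or_false, forall_eq_or_imp, forall_eq] at e
  obtain ⟨e0, e16, e18, e19, e20⟩ := e
  refine (rootsProg_ok (by omega) c2 (by rw [e0, a0, hn]) (by rw [e19, a19]) (by rw [e18, a18])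
    (by omega) V c22).fr.mono le_rfl ?_
  rintro s4 ⟨hf, hF4⟩
  exact ⟨hf, by rw [hF4.wreg 16 (by decide), e16, a16], by rw [hF4.wreg 20 (by decide), e20, a20],
    by rw [hF4.wreg 19 (by decide), e19, a19], by rw [hF4.wreg 18 (by decide), e18, a18]⟩

/-- The trees of a forest own disjoint sets of nodes. -/
theorem Forest.forestP {s : State} {A : ℕ} {F : ℕ → ℕ → ℝ} (h : Forest k base A F s) :
    ∃ Φ, Φ ≤ s.wreg 18 - 2 * 2 ^ k ∧ ForestP k base A F Φ s := by
  obtain ⟨ρ, a, D, hS⟩ := h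
  refine ⟨_, ?_, ρ, a, D, hS, rfl⟩
  rw [← Finset.card_sigma, ← Nat.card_Ico]
  refine Finset.card_le_card_of_injOn (fun x => ρ x.1 x.2) ?_ ?_
  · rintro ⟨u, h⟩ hx
    simp [owned] at hx ⊢
    exact ⟨hx.2.2, D.lt_nx hx.1 hx.2.1.1 (by omega)⟩
  · rintro ⟨u, h⟩ hx ⟨u', h'⟩ hx' he
    simp [owned] at hx hx' he
    obtain ⟨rfl, rfl⟩ := D.inj u hx.1 u' hx'.1 h h' hx.2.1.1 hx.2.1.2 hx'.2.1.1 hx'.2.1.2 hx.2.2 he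
    rfl

end RAM

/-! ## Lowest common ancestors, and the contributions of the edges -/

namespace Layout

variable {n : ℕ} {par head ld : ℕ → ℕ}

/-- No common ancestor lies on the heavy path of `x`. A vertex there has head `head x`, while an
ancestor of `y` has head `head y` or comes before `head y`, which is smaller than `head x`. So `x`
may jump to the parent of its head. -/
theorem anc_climb (L : Layout n par head ld) {x y : ℕ} (hx : x < n) (hy : y < n)
    (h : head y < head x) (w : ℕ) :
    (Anc par w x ∧ Anc par w y) ↔ (Anc par w (par (head x)) ∧ Anc par w y) := by
  have h1 := L.head_le hx
  have h2 := L.head_le hy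
  rw [L.anc_chain hx]
  constructor
  · rintro ⟨h3 | h3, h4⟩
    · exfalso
      have e1 := L.head_eq hx h3.1 h3.2
      rcases (L.anc_chain hy).1 h4 with h5 | h5
      · have e2 := L.head_eq hy h5.1 h5.2
        omega
      · have hp := L.par_lt (head y) (by omega) (by omega)
        have := L.anc_le (by omega) h5.2
        omega
    · exact ⟨h3.2, h4⟩
  · rintro ⟨h3, h4⟩
    exact ⟨Or.inr ⟨by omega, h3⟩, h4⟩

theorem anc_meet (L : Layout n par head ld) {x y : ℕ} (hx : x < n) (hy : y < n)
    (h : head x = head y) (hxy : x ≤ y) (w : ℕ) :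
    Anc par w x ↔ (Anc par w x ∧ Anc par w y) := by
  rw [iff_self_and, L.anc_chain hx, L.anc_chain hy, h]
  rintro (h | h)
  · exact Or.inl ⟨h.1, h.2.trans hxy⟩
  · exact Or.inr h

/-- The climbing procedure itself is the proof: a jump by `anc_climb` lowers `x + y`, and on a
common heavy path the smaller vertex is the answer by `anc_meet`. -/
theorem exists_lca (L : Layout n par head ld) {x y : ℕ} (hx : x < n) (hy : y < n) :
    ∃ l < n, ∀ w, Anc par w l ↔ (Anc par w x ∧ Anc par w y) := by
  have key : ∀ t x y, x + y ≤ t → x < n → y < n →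
      ∃ l < n, ∀ w, Anc par w l ↔ (Anc par w x ∧ Anc par w y) := by
    intro t
    induction t with
    | zero =>
      intro x y h hx hy
      obtain rfl : x = 0 := by omega
      obtain rfl : y = 0 := by omega
      exact ⟨0, hx, by simp⟩
    | succ t ih =>
      intro x y h hx hy
      have h1 := L.head_le hx
      have h2 := L.head_le hy
      rcases lt_trichotomy (head x) (head y) with he | he | he
      · have hp := L.par_lt (head y) (by omega) (by omega)
        obtain ⟨l, hl, hw⟩ := ih x (par (head y)) (by omega) hx (by omega)
        refine ⟨l, hl, fun w => ?_⟩
        rw [hw, and_comm, ← L.anc_climb hy hx he, and_comm]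
      · rcases le_total x y with hxy | hxy
        · exact ⟨x, hx, L.anc_meet hx hy he hxy⟩
        · refine ⟨y, hy, fun w => ?_⟩
          rw [and_comm]; exact L.anc_meet hy hx he.symm hxy w
      · have hp := L.par_lt (head x) (by omega) (by omega)
        obtain ⟨l, hl, hw⟩ := ih (par (head x)) y (by omega) (by omega) hy
        exact ⟨l, hl, fun w => by rw [hw, ← L.anc_climb hx hy he]⟩
  exact key _ x y le_rfl hx hy

theorem anc_ext (L : Layout n par head ld) {l l' : ℕ} (hl : l < n) (hl' : l' < n)
    (h : ∀ w, Anc par w l ↔ Anc par w l') : l = l' :=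
  le_antisymm (L.anc_le hl' ((h l).1 .refl)) (L.anc_le hl ((h l').2 .refl))

end Layout

/-! ### Lowest common ancestors by climbing, and path differences of edges -/

namespace RAM

/-- Replace `reg 3` by the lowest common ancestor of `reg 3` and `reg 4`. -/
def lcaProg : Prog :=
  .seq (.loop (.not (.weq (.load 14 (.reg 3)) (.load 14 (.reg 4))))
    (.ite (.wle (.load 14 (.reg 4)) (.load 14 (.reg 3)))
      (.wset 3 (.load 15 (.load 14 (.reg 3))))
      (.wset 4 (.load 15 (.load 14 (.reg 4))))))
    (.ite (.wle (.reg 3) (.reg 4)) .skip (.wset 3 (.reg 4)))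

variable {W k n m B : ℕ} {base : ℕ → ℝ} {par head ld : ℕ → ℕ}

/-- The set of common ancestors is invariant, and each jump crosses a light edge, so `ld x + ld y`
bounds the number of rounds. The set determines the vertex by `Layout.anc_ext`. -/
theorem lcaProg_ok {s : State} {x y l : ℕ} (L : Layout n par head ld)
    (hhead : ∀ i < n, s.warr 14 i = head i) (hpar : ∀ i < n, s.warr 15 i = par i)
    (h3 : s.wreg 3 = x) (h4 : s.wreg 4 = y) (hx : x < n) (hy : y < n) (hW : n ≤ W) (hl : l < n)
    (hlw : ∀ w, Anc par w l ↔ (Anc par w x ∧ Anc par w y)) :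
    Ok W lcaProg s ((ld x + ld y) * 20 + 20) fun s' => s'.wreg 3 = l := by
  refine (Ok.seq' (T := (ld x + ld y) * 20 + 6) (T' := 10) (R := fun s' => s'.wreg 3 < n ∧
    s'.wreg 4 < n ∧ (∀ w, Anc par w l ↔ (Anc par w (s'.wreg 3) ∧ Anc par w (s'.wreg 4))) ∧
    head (s'.wreg 3) = head (s'.wreg 4)) ?_ ?_).mono (by omega) fun _ => id
  · refine Ok.loop (fun (g : ℕ × ℕ) s' => g.1 < n ∧ g.2 < n ∧ s'.wreg 3 = g.1 ∧ s'.wreg 4 = g.2 ∧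
      ∀ w, Anc par w l ↔ (Anc par w g.1 ∧ Anc par w g.2)) (fun g => (ld g.1 + ld g.2) * 20 + 6)
      (x, y) ⟨hx, hy, h3, h4, hlw⟩ ?_ ?_
    · rintro ⟨x, y⟩ s' ⟨hx, hy, h3, h4, hw⟩ hF hb
      have f14 := hF.warr 14 (by decide)
      dsimp only at *
      simp [h3, h4, f14, hhead x hx, hhead y hy] at hb
      simp [h3, h4, hx, hy, hw, hb]
    · rintro ⟨x, y⟩ s' ⟨hx, hy, h3, h4, hw⟩ hF hb
      have f14 := hF.warr 14 (by decide)
      have f15 := hF.warr 15 (by decide)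
      dsimp only at *
      simp [h3, h4, f14, hhead x hx, hhead y hy] at hb
      have h1 := L.head_le hx
      have h2 := L.head_le hy
      refine ⟨12, Ok.line (by simp) ?_⟩
      simp only [wp, WExp.eval, Test.Holds, h3, h4, f14, f15, hhead x hx, hhead y hy]
      refine ⟨fun hc => ?_, fun hc => ?_⟩
      · have hh : head x < n := by omega
        have hp := L.par_lt (head x) hh (by omega)
        have := L.ld_lt x hx (by omega)
        rw [hpar _ hh]
        refine ⟨by omega, (par (head x), y), ⟨by dsimp only; omega, hy, by simp, by simp [h4],
          fun w => ?_⟩, ?_⟩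
        · rw [hw, L.anc_climb hx hy (by omega)]
        · simp; omega
      · have hh : head y < n := by omega
        have hp := L.par_lt (head y) hh (by omega)
        have := L.ld_lt y hy (by omega)
        rw [hpar _ hh]
        refine ⟨by omega, (x, par (head y)), ⟨hx, by dsimp only; omega, by simp [h3], by simp,
          fun w => ?_⟩, ?_⟩
        · rw [hw, and_comm, L.anc_climb hy hx (by omega), and_comm]
        · simp; omega
  · rintro s' ⟨hx, hy, hw, he⟩ -
    refine Ok.line (by simp) ?_
    simp only [wp, WExp.eval, Test.Holds]
    refine ⟨fun hc => ?_, fun hc => ⟨by omega, ?_⟩⟩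
    · exact L.anc_ext hx hl fun w => by rw [hw]; exact L.anc_meet hx hy he hc w
    · rw [setW_wreg, if_pos rfl]
      refine L.anc_ext hy hl fun w => ?_
      rw [hw, and_comm]
      exact L.anc_meet hy hx he.symm (by omega) w

/-- Store the positions of the ends of the edge `reg 2` and of their lowest common ancestor,
and add the contribution of the edge to `rarr 1`. -/
def edgeProg : Prog :=
  .seq (.seq (.wset 3 (.load 16 (.load 0 (.reg 2))))
    (.seq (.wset 4 (.load 16 (.load 1 (.reg 2))))
    (.seq (.wstore 17 (.reg 2) (.reg 3))
    (.seq (.wstore 18 (.reg 2) (.reg 4))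
    (.seq (.rstore 1 (.reg 3) (.add (.load 1 (.reg 3)) (.load 0 (.reg 2))))
      (.rstore 1 (.reg 4) (.add (.load 1 (.reg 4)) (.load 0 (.reg 2)))))))))
  (.seq lcaProg
    (.seq (.wstore 19 (.reg 2) (.reg 3))
      (.rstore 1 (.reg 3) (.sub (.load 1 (.reg 3))
        (.add (.load 0 (.reg 2)) (.load 0 (.reg 2)))))))

/-- The contribution of an edge with weight `1` to the cell `u`: the difference operator of the
path between its ends `x` and `y`, with lowest common ancestor `l`. -/
noncomputable def pathDiff (x y l u : ℕ) : ℝ :=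
  (if u = x then 1 else 0) + (if u = y then 1 else 0) - 2 * (if u = l then 1 else 0)

theorem update_add (f : ℕ → ℝ) (a : ℕ) (c : ℝ) (u : ℕ) :
    Function.update f a (f a + c) u = f u + if u = a then c else 0 := by
  by_cases h : u = a
  · subst h; simp
  · simp [h]

/-- The cells `x`, `y` and `l` may coincide. The three updates are made one after the other, and
`update_add` turns each into an additive increment, so coincidences need no separate treatment. -/
theorem edgeProg_ok {s : State} {e x y l : ℕ} (L : Layout n par head ld) (hB : ∀ i < n, ld i ≤ B)
    (hhead : ∀ i < n, s.warr 14 i = head i) (hpar : ∀ i < n, s.warr 15 i = par i)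
    (h2 : s.wreg 2 = e) (hX : s.warr 16 (s.warr 0 e) = x) (hY : s.warr 16 (s.warr 1 e) = y)
    (hx : x < n) (hy : y < n) (hW : n ≤ W) (hl : l < n) (he : e ≤ W)
    (hlw : ∀ w, Anc par w l ↔ (Anc par w x ∧ Anc par w y)) :
    Ok W edgeProg s (40 * B + 100) fun s' => s'.warr 17 = Function.update (s.warr 17) e x ∧
      s'.warr 18 = Function.update (s.warr 18) e y ∧
      s'.warr 19 = Function.update (s.warr 19) e l ∧
      ∀ u, s'.rarr 1 u = s.rarr 1 u + s.rarr 0 e * pathDiff x y l u := by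
  have b1 := hB x hx
  have b2 := hB y hy
  refine (Ok.seq (T := 40) (T' := 40 * B + 50) (Ok.line (by simp) ?_)).mono (by omega) fun _ => id
  simp only [wp, WExp.eval, h2, hX, setW_warr, setW_wreg]
  norm_num [h2, hX, hY]
  iterate 8 refine ⟨by omega, ?_⟩
  refine (Ok.seq' (T := (ld x + ld y) * 20 + 20) (T' := 30) (lcaProg_ok (x := x) (y := y) (l := l) L
    (by simpa using hhead) (by simpa using hpar) (by simp) (by simp) hx hy hW hl hlw) ?_).mono
    (by omega) fun _ => id
  rintro s' h3 hF
  have f2 := hF.wreg 2 (by decide)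
  have f17 := hF.warr 17 (by decide)
  have f18 := hF.warr 18 (by decide)
  have f19 := hF.warr 19 (by decide)
  have g1 := hF.rarr 1 (by decide)
  have g0 := hF.rarr 0 (by decide)
  simp [h2] at f2 f17 f18 f19 g1 g0
  refine Ok.line (by simp) ?_
  simp [f2, h3, f17, f18, f19, g0]
  refine ⟨he, by omega, ?_⟩
  intro u
  rw [sub_eq_add_neg, update_add, g1, update_add, update_add]
  unfold pathDiff
  split_ifs <;> ring

/-- The contributions of all the edges. -/
def edgesProg : Prog := .seq (.wset 2 (.const 0)) (forUp 2 1 edgeProg)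

theorem edgesProg_ok {s : State} {X Y Lc : ℕ → ℕ} (L : Layout n par head ld)
    (hB : ∀ i < n, ld i ≤ B) (hm : s.wreg 1 = m)
    (hhead : ∀ i < n, s.warr 14 i = head i) (hpar : ∀ i < n, s.warr 15 i = par i)
    (hX : ∀ e < m, s.warr 16 (s.warr 0 e) = X e) (hY : ∀ e < m, s.warr 16 (s.warr 1 e) = Y e)
    (hx : ∀ e < m, X e < n) (hy : ∀ e < m, Y e < n) (hW : n + m ≤ W) (hl : ∀ e < m, Lc e < n)
    (hlw : ∀ e < m, ∀ w, Anc par w (Lc e) ↔ (Anc par w (X e) ∧ Anc par w (Y e)))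
    (h0 : ∀ u, s.rarr 1 u = 0) :
    Ok W edgesProg s (m * (40 * B + 110) + 10) fun s' =>
      (∀ e < m, s'.warr 17 e = X e ∧ s'.warr 18 e = Y e ∧ s'.warr 19 e = Lc e) ∧
      ∀ u, s'.rarr 1 u = ∑ e ∈ Finset.range m, s.rarr 0 e * pathDiff (X e) (Y e) (Lc e) u := by
  refine (Ok.seq (T := 2) (T' := m * (40 * B + 108) + 4) (Ok.line (by simp) ?_)).mono
    (by rw [mul_add, mul_add]; omega) fun _ => id
  simp only [wp, WExp.eval]
  refine ⟨by omega, ?_⟩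
  refine (Ok.forUp (fun i s' => (∀ e < i, s'.warr 17 e = X e ∧ s'.warr 18 e = Y e ∧
      s'.warr 19 e = Lc e) ∧
      ∀ u, s'.rarr 1 u = ∑ e ∈ Finset.range i, s.rarr 0 e * pathDiff (X e) (Y e) (Lc e) u)
    (a := 0) (N := m) (40 * B + 100) (by decide) (by decide) (by decide) (by simp) (by simp [hm])
    (by omega) (by omega) ⟨by simp, by simpa using h0⟩ ?_).mono (by simp) fun s' h => h.1
  rintro i s' - hi ⟨hI, hV⟩ h2 hF
  have f14 := hF.warr 14 (by decide)
  have f15 := hF.warr 15 (by decide)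
  have f16 := hF.warr 16 (by decide)
  have f0 := hF.warr 0 (by decide)
  have f1 := hF.warr 1 (by decide)
  have g0 := hF.rarr 0 (by decide)
  simp at f14 f15 f16 f0 f1 g0
  refine (edgeProg_ok (e := i) L hB (by rwa [f14]) (by rwa [f15]) h2 (by rw [f16, f0, hX i hi])
    (by rw [f16, f1, hY i hi]) (hx i hi) (hy i hi) (by omega) (hl i hi) (by omega)
    (hlw i hi)).mono le_rfl ?_
  rintro s'' ⟨a1, a2, a3, a4⟩
  refine ⟨fun e he => ?_, fun u => ?_⟩
  · simp only [setW_warr, a1, a2, a3]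
    by_cases h : e = i
    · subst h; simp
    · simpa [h] using hI e (by omega)
  · simp only [setW_rarr, a4, Finset.sum_range_succ, hV, g0]

/-! ### Subtree sums in place -/

/-- Replace `rarr 1` by its sums over subtrees. -/
def sumProg : Prog :=
  .seq (.wset 2 (.sub (.reg 0) (.const 1)))
  (forDown 2 (.rstore 1 (.load 15 (.add (.reg 2) (.const 1)))
    (.add (.load 1 (.load 15 (.add (.reg 2) (.const 1)))) (.load 1 (.add (.reg 2) (.const 1))))))

/-- The recursion is that of the merges, applied to numbers: cells beyond the counter already hold
full subtree sums, the others hold what their treated children have handed over. -/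
theorem sumProg_ok {s : State} (hn : s.wreg 0 = n) (hn1 : 1 ≤ n) (hW : n ≤ W)
    (hp : ∀ i < n, 0 < i → par i < i) (hpar : ∀ i < n, s.warr 15 i = par i) :
    Ok W sumProg s (n * 40 + 10) fun s' => ∀ u < n, s'.rarr 1 u = subSum par n (s.rarr 1) u := by
  refine (Ok.seq (T := 5) (T' := (n - 1) * (30 + 7) + 3) (Ok.line (by simp) ?_)).mono
    (by omega) fun _ => id
  simp only [wp, WExp.eval, hn]
  refine ⟨by omega, ?_⟩
  refine (Ok.forDown (fun i s' => ∀ u < n, s'.rarr 1 u = if u ≤ i then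
    accum par n (s.rarr 1) (i + 1) u else subSum par n (s.rarr 1) u)
    (N := n - 1) 30 (by decide) (by simp) (by omega) ?_ ?_).mono le_rfl ?_
  · intro u hu
    rw [if_pos (by omega), show n - 1 + 1 = n by omega, accum_top]; simp
  · intro i s' hi hI h2 hF
    have f15 := hF.warr 15 (by decide)
    simp at f15
    have hpi := hp (i + 1) (by omega) (by omega)
    refine Ok.line (by simp) ?_
    simp only [wp, WExp.eval, RExp.eval, setW_wreg, setW_warr, f15, if_true, hpar (i + 1) (by omega)]
    refine ⟨by omega, fun u hu => ?_⟩
    simp only [storeR_rarr, if_true, setW_rarr]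
    have hself := accum_self hp (s.rarr 1) (u := i + 1) (by omega)
    have hstep := accum_step (par := par) (n := n) (s.rarr 1) (u := u) (v := i + 1) (by omega) hself
    by_cases h1 : u = par (i + 1)
    · rw [h1] at hstep ⊢
      rw [Function.update_self, if_pos (by omega), hI _ (by omega), if_pos (by omega),
        hI _ (by omega), if_pos (by omega), hstep, if_pos rfl]
    · rw [Function.update_of_ne h1, hI u hu]
      rw [if_neg h1, add_zero] at hstep
      by_cases h2 : u ≤ i
      · rw [if_pos (by omega), if_pos h2, hstep]
      · rw [if_neg h2]
        by_cases h3 : u = i + 1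
        · subst h3; rw [if_pos le_rfl, hself]
        · rw [if_neg (by omega)]
  · rintro s' ⟨hI, -⟩ u hu
    rw [hI u hu]
    split_ifs with h
    · obtain rfl : u = 0 := by omega
      rw [accum_self hp _ hu]
    · rfl

/-! ### The nine ancestor additions of an edge -/

/-- Add the weight `reg r` in the tree of the vertex `X[reg 2]` to the ancestors of `Y[reg 2]`. -/
def addPair (X Y r : ℕ) : Prog :=
  .seq (.seq (.wset 10 (.load X (.reg 2))) (.seq (.wset 22 (.load Y (.reg 2))) (.rset 4 (.reg r))))
    addAnc

/-- The arrays of `addPairs` are variables, so their preservation is argued by ranges: additions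
write word arrays from 20 on and weight registers up to 4, whereas the operands are in arrays up to
19 and registers from 8 on. -/
theorem addPair_wa (X Y r a : ℕ) (h : a ∈ (addPair X Y r).wa) : 20 ≤ a := by
  have h1 : ∀ x ∈ addAnc.wa, 20 ≤ x := by decide
  exact h1 a (by simpa [addPair, Prog.wa] using h)

theorem addPair_rw (X Y r a : ℕ) (h : a ∈ (addPair X Y r).rw) : a ≤ 4 := by
  have h1 : ∀ x ∈ addAnc.rw, x ≤ 4 := by decide
  simp only [addPair, Prog.rw, List.nil_append, List.mem_append, List.mem_singleton] at h
  rcases h with h | h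
  · omega
  · exact h1 a h

/-- A sequence of additions. -/
def addPairs : List (ℕ × ℕ × ℕ) → Prog
  | [] => .skip
  | t :: l => .seq (addPair t.1 t.2.1 t.2.2) (addPairs l)

open Classical in
theorem addPairs_ok (l : List (ℕ × ℕ × ℕ)) {s : State} {F : ℕ → ℕ → ℝ} {e : ℕ}
    (hF : Forest k base n F s) (L : Layout n par head ld) (hB : ∀ i < n, ld i ≤ B)
    (hhead : ∀ i < n, s.warr 14 i = head i) (hpar : ∀ i < n, s.warr 15 i = par i)
    (hn : n < 2 ^ k) (hk : s.wreg 16 = k) (hk1 : 1 ≤ k) (hN : s.wreg 20 = 2 ^ k)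
    (hN2 : s.wreg 19 = 2 * 2 ^ k) (he : s.wreg 2 = e)
    (hl : ∀ t ∈ l, (t.1 ≤ 19 ∧ t.2.1 ≤ 19 ∧ 8 ≤ t.2.2) ∧ s.warr t.1 e < n ∧ s.warr t.2.1 e < n)
    (hW : s.wreg 18 + l.length * (2 * k * (B + 1)) ≤ W) :
    Ok W (addPairs l) s (l.length * ((B + 1) * (320 * k + 120) + 20) + 1) fun s' =>
      Forest k base n (fun u w => F u w + (l.map fun t =>
        if u = s.warr t.1 e ∧ Anc par w (s.warr t.2.1 e) then s.rreg t.2.2 else 0).sum) s' ∧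
      s'.wreg 18 ≤ s.wreg 18 + l.length * (2 * k * (B + 1)) := by
  induction l generalizing s F with
  | nil =>
    refine Ok.line (by simp [addPairs]) ?_
    simpa [addPairs] using hF
  | cons t l ih =>
    obtain ⟨X, Y, r⟩ := t
    obtain ⟨⟨hX, hY, hr⟩, hx, hy⟩ := hl _ List.mem_cons_self
    dsimp only at hX hY hr hx hy
    have hld := hB _ hy
    have m1 : 2 * k * (ld (s.warr Y e) + 1) ≤ 2 * k * (B + 1) := Nat.mul_le_mul_left _ (by omega)
    have m2 : (ld (s.warr Y e) + 1) * (320 * k + 120) ≤ (B + 1) * (320 * k + 120) :=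
      Nat.mul_le_mul_right _ (by omega)
    have hnx : 2 * 2 ^ k + n ≤ s.wreg 18 := by
      obtain ⟨ρ, a, D, -⟩ := hF; exact D.nx_ge
    have hs : ∀ c, (l.length + 1) * c = l.length * c + c := fun c => by ring
    simp only [List.length_cons, hs] at hW ⊢
    have h1 : Ok W (addPair X Y r) s ((B + 1) * (320 * k + 120) + 20) fun s' =>
        Forest k base n (fun u w => F u w + if u = s.warr X e ∧ Anc par w (s.warr Y e)
          then s.rreg r else 0) s' ∧ s'.wreg 18 ≤ s.wreg 18 + 2 * k * (B + 1) := by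
      refine (Ok.seq (T := 10) (T' := (ld (s.warr Y e) + 1) * (320 * k + 120) + 10)
        (Ok.line (by simp) ?_)).mono (by omega) fun _ => id
      simp only [wp, WExp.eval, RExp.eval, setW_wreg, he, setW_warr, setW_rreg]
      norm_num [he]
      refine ⟨by omega, by omega, ?_⟩
      refine (addAnc_ok (F := F) (u := s.warr X e) (z := s.warr Y e) (W := W) (hF.congr (by simp)
        (by simp [mem])) L (by simpa using hhead) (by simpa using hpar) hx hy hn (by simp)
        (by simp) (by simp [hk]) hk1 (by simp [hN]) (by simp [hN2]) (by simp; omega)).mono le_rfl ?_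
      rintro s' ⟨h1, h2⟩
      simp at h1 h2
      exact ⟨h1, by omega⟩
    refine (Ok.seq' (T' := l.length * ((B + 1) * (320 * k + 120) + 20) + 1) h1 ?_).mono
      (by omega) fun _ => id
    rintro s' ⟨hF', h18⟩ hFr
    have f14 := hFr.warr 14 (by simp +decide [addPair, Prog.wa])
    have f15 := hFr.warr 15 (by simp +decide [addPair, Prog.wa])
    have fa : ∀ a ≤ 19, s'.warr a = s.warr a := fun a ha =>
      hFr.warr a fun h => by have := addPair_wa X Y r a h; omega
    have fr : ∀ a, 8 ≤ a → s'.rreg a = s.rreg a := fun a ha =>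
      hFr.rreg a fun h => by have := addPair_rw X Y r a h; omega
    have f16 := hFr.wreg 16 (by simp +decide [addPair, Prog.ww])
    have f20 := hFr.wreg 20 (by simp +decide [addPair, Prog.ww])
    have f19 := hFr.wreg 19 (by simp +decide [addPair, Prog.ww])
    have f2 := hFr.wreg 2 (by simp +decide [addPair, Prog.ww])
    have hl' : ∀ t ∈ l, (t.1 ≤ 19 ∧ t.2.1 ≤ 19 ∧ 8 ≤ t.2.2) ∧ s.warr t.1 e < n ∧
      s.warr t.2.1 e < n := fun t ht => hl t (List.mem_cons_of_mem _ ht)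
    refine (ih hF' (by rwa [f14]) (by rwa [f15]) (by rw [f16, hk]) (by rw [f20, hN])
      (by rw [f19, hN2]) (by rw [f2, he]) (fun t ht => ?_) (by omega)).mono le_rfl ?_
    · obtain ⟨a1, a2, a3⟩ := hl' t ht
      rw [fa _ a1.1, fa _ a1.2.1]
      exact ⟨a1, a2, a3⟩
    · rintro s'' ⟨hF'', h18'⟩
      refine ⟨?_, by omega⟩
      convert hF'' using 3 with u w
      rw [List.map_cons, List.sum_cons, add_assoc]
      congr 2
      refine congrArg _ (List.map_congr_left fun t ht => ?_)
      obtain ⟨a1, a2, a3⟩ := hl' t ht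
      rw [fa _ a1.1, fa _ a1.2.1, fr _ a1.2.2]

/-- The arrays of the two factors, and the register of the coefficient. -/
def pairs : List (ℕ × ℕ × ℕ) :=
  [(17, 17, 8), (17, 18, 8), (17, 19, 9), (18, 17, 8), (18, 18, 8), (18, 19, 9), (19, 17, 9),
    (19, 18, 9), (19, 19, 10)]

/-- The additions of one edge. -/
def contribProg : Prog :=
  .seq (.seq (.rset 8 (.sub .zero (.add (.load 0 (.reg 2)) (.load 0 (.reg 2)))))
    (.seq (.rset 9 (.sub .zero (.add (.reg 8) (.reg 8)))) (.rset 10 (.sub .zero (.add (.reg 9) (.reg 9))))))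
    (addPairs pairs)

/-- The additions of all the edges. -/
def contribsProg : Prog := .seq (.wset 2 (.const 0)) (forUp 2 1 contribProg)

open Classical in
/-- The indicator of the path between `x` and `y` at `u`, with lowest common ancestor `l`. -/
noncomputable def pathInd (par : ℕ → ℕ) (x y l u : ℕ) : ℝ :=
  (if Anc par u x then 1 else 0) + (if Anc par u y then 1 else 0) -
    2 * (if Anc par u l then 1 else 0)

set_option maxHeartbeats 1000000 in
-- The product of `pathDiff` at `u` and `pathInd` at `w` expands into nine terms, one for each pair
-- from `x`, `y`, `l`, with coefficients 1, -2 and 4. The factor -2 of the mixed term makes them -2,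
-- 4 and -8 times the weight, as held in registers 8, 9, 10. Nine additions with at most `2 * k * (B
-- + 1)` new nodes each give the constant 18.
theorem contribProg_ok {s : State} {F : ℕ → ℕ → ℝ} {e x y l : ℕ}
    (hF : Forest k base n F s) (L : Layout n par head ld) (hB : ∀ i < n, ld i ≤ B)
    (hhead : ∀ i < n, s.warr 14 i = head i) (hpar : ∀ i < n, s.warr 15 i = par i)
    (hn : n < 2 ^ k) (hk : s.wreg 16 = k) (hk1 : 1 ≤ k) (hN : s.wreg 20 = 2 ^ k)
    (hN2 : s.wreg 19 = 2 * 2 ^ k) (he : s.wreg 2 = e)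
    (h17 : s.warr 17 e = x) (h18 : s.warr 18 e = y) (h19 : s.warr 19 e = l)
    (hx : x < n) (hy : y < n) (hl : l < n) (hW : s.wreg 18 + 18 * k * (B + 1) ≤ W) :
    Ok W contribProg s (9 * ((B + 1) * (320 * k + 120) + 20) + 40) fun s' =>
      Forest k base n (fun u w => F u w +
        -2 * s.rarr 0 e * pathDiff x y l u * pathInd par x y l w) s' ∧
      s'.wreg 18 ≤ s.wreg 18 + 18 * k * (B + 1) := by
  refine (Ok.seq (T := 30) (T' := 9 * ((B + 1) * (320 * k + 120) + 20) + 1) (Ok.line (by simp) ?_)).mono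
    (by omega) fun _ => id
  simp only [wp, WExp.eval, RExp.eval, setR_rreg, setR_wreg, setR_rarr, he]
  have hm : 9 * (2 * k * (B + 1)) = 18 * k * (B + 1) := by ring
  have key : ∀ s1 : State, s1.wreg = s.wreg → s1.warr = s.warr → mem s1 = mem s →
      s1.rreg 8 = -2 * s.rarr 0 e → s1.rreg 9 = 4 * s.rarr 0 e → s1.rreg 10 = -8 * s.rarr 0 e →
      Ok W (addPairs pairs) s1 (9 * ((B + 1) * (320 * k + 120) + 20) + 1) fun s' =>
        Forest k base n (fun u w => F u w +
          -2 * s.rarr 0 e * pathDiff x y l u * pathInd par x y l w) s' ∧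
        s'.wreg 18 ≤ s.wreg 18 + 18 * k * (B + 1) := by
    intro s1 e1 e2 e3 e4 e5 e6
    refine (addPairs_ok pairs (e := e) (F := F) (W := W) (hF.congr (by rw [e1]) e3) L hB
      (by rwa [e2]) (by rwa [e2]) hn (by rw [e1, hk]) hk1 (by rw [e1, hN]) (by rw [e1, hN2])
      (by rw [e1, he]) ?_ ?_).mono (by simp [pairs]) ?_
    · simp [pairs, e2, h17, h18, h19, hx, hy, hl]
    · simp [pairs, e1]; omega
    · rintro s' ⟨h1, h2⟩
      refine ⟨?_, by simp [pairs, e1] at h2; omega⟩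
      convert h1 using 3 with u w
      obtain rfl : s1.warr 17 e = x := by rw [e2, h17]
      obtain rfl : s1.warr 18 e = y := by rw [e2, h18]
      obtain rfl : s1.warr 19 e = l := by rw [e2, h19]
      simp only [pairs, List.map_cons, List.map_nil, List.sum_cons, List.sum_nil, e4, e5, e6]
      have hi : ∀ (p q : Prop) [Decidable p] [Decidable q] (c : ℝ), (if p ∧ q then c else 0) =
          c * ((if p then 1 else 0) * (if q then 1 else 0)) := by
        intro p q _ _ c; by_cases hp : p <;> by_cases hq : q <;> simp [hp, hq]
      simp only [hi, pathDiff, pathInd]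
      ring
  refine key _ rfl rfl rfl ?_ ?_ ?_ <;> norm_num <;> ring

theorem contribsProg_ok {s : State} {X Y Lc : ℕ → ℕ} {F : ℕ → ℕ → ℝ}
    (hF : Forest k base n F s) (L : Layout n par head ld) (hB : ∀ i < n, ld i ≤ B)
    (hm : s.wreg 1 = m)
    (hhead : ∀ i < n, s.warr 14 i = head i) (hpar : ∀ i < n, s.warr 15 i = par i)
    (hn : n < 2 ^ k) (hk : s.wreg 16 = k) (hk1 : 1 ≤ k) (hN : s.wreg 20 = 2 ^ k)
    (hN2 : s.wreg 19 = 2 * 2 ^ k)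
    (hXY : ∀ e < m, s.warr 17 e = X e ∧ s.warr 18 e = Y e ∧ s.warr 19 e = Lc e)
    (hx : ∀ e < m, X e < n) (hy : ∀ e < m, Y e < n) (hl : ∀ e < m, Lc e < n) (hmW : m ≤ W)
    (hW : s.wreg 18 + m * (18 * k * (B + 1)) ≤ W) :
    Ok W contribsProg s (m * (9 * ((B + 1) * (320 * k + 120) + 20) + 50) + 10) fun s' =>
      Forest k base n (fun u w => F u w + ∑ e ∈ Finset.range m,
        -2 * s.rarr 0 e * pathDiff (X e) (Y e) (Lc e) u * pathInd par (X e) (Y e) (Lc e) w) s' ∧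
      s'.wreg 18 ≤ s.wreg 18 + m * (18 * k * (B + 1)) := by
  refine (Ok.seq (T := 2) (T' := m * (9 * ((B + 1) * (320 * k + 120) + 20) + 48) + 4)
    (Ok.line (by simp) ?_)).mono (by rw [mul_add m _ 50, mul_add m _ 48]; omega) fun _ => id
  simp only [wp, WExp.eval]
  refine ⟨by omega, ?_⟩
  refine (Ok.forUp (fun i s' => Forest k base n (fun u w => F u w + ∑ e ∈ Finset.range i,
        -2 * s.rarr 0 e * pathDiff (X e) (Y e) (Lc e) u * pathInd par (X e) (Y e) (Lc e) w) s' ∧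
      s'.wreg 18 ≤ s.wreg 18 + i * (18 * k * (B + 1)))
    (a := 0) (N := m) (9 * ((B + 1) * (320 * k + 120) + 20) + 40) (by decide)
    (by simp +decide [contribProg, addPairs, pairs, addPair, Prog.ww])
    (by simp +decide [contribProg, addPairs, pairs, addPair, Prog.ww]) (by simp) (by simp [hm])
    (by omega) hmW ⟨?_, by simp⟩ ?_).mono (by simp) fun s' h => h.1
  · simp only [Finset.range_zero, Finset.sum_empty, add_zero]
    exact hF.congr (by simp) (by simp [mem])
  rintro i s' - hi ⟨hF', h18⟩ h2 hFr
  have f : ∀ a ∈ [14, 15, 17, 18, 19], s'.warr a = s.warr a := by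
    intro a ha
    refine hFr.warr a ?_
    revert ha
    revert a
    simp +decide [contribProg, addPairs, pairs, addPair, Prog.wa]
  have g0 := hFr.rarr 0 (by simp +decide [contribProg, addPairs, pairs, addPair, Prog.ra])
  have fw : ∀ a ∈ [16, 19, 20], s'.wreg a = s.wreg a := by
    intro a ha
    refine (hFr.wreg a ?_).trans ?_
    · revert ha
      revert a
      simp +decide [contribProg, addPairs, pairs, addPair, Prog.ww]
    · simp; rintro rfl; simp at ha
  simp only [List.mem_cons, List.not_mem_nil, or_false, forall_eq_or_imp, forall_eq] at f fw
  obtain ⟨f14, f15, f17, f18, f19⟩ := f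
  obtain ⟨f16, f19', f20⟩ := fw
  simp at g0
  obtain ⟨a1, a2, a3⟩ := hXY i hi
  have m1 : (i + 1) * (18 * k * (B + 1)) ≤ m * (18 * k * (B + 1)) := Nat.mul_le_mul_right _ hi
  rw [add_mul, one_mul] at m1
  refine (contribProg_ok hF' L hB (by rwa [f14]) (by rwa [f15]) hn (by rw [f16, hk]) hk1
    (by rw [f20, hN]) (by rw [f19', hN2]) h2 (by rw [f17, a1]) (by rw [f18, a2]) (by rw [f19, a3])
    (hx i hi) (hy i hi) (hl i hi) (by omega)).mono le_rfl ?_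
  rintro s'' ⟨b1, b2⟩
  refine ⟨?_, ?_⟩
  · refine Forest.congr (s := s'') ?_ (by simp) (by simp [mem])
    convert b1 using 3 with u w
    rw [Finset.sum_range_succ, add_assoc, g0]
  · simp only [setW_wreg]; norm_num; rw [add_mul, one_mul]; omega

/-- A unit mass at `z` lies in the subtree of `u` iff `u` is an ancestor of `z`. This is what lets
the merging of trees produce the mixed term in its first variable. -/
theorem subSum_pathDiff {x y l : ℕ} (hx : x < n) (hy : y < n) (hl : l < n) (u : ℕ) :
    subSum par n (pathDiff x y l) u = pathInd par x y l u := by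
  classical
  unfold subSum pathDiff pathInd
  have h : ∀ z < n, ∑ v ∈ Finset.range n, (if Anc par u v then (if v = z then (1 : ℝ) else 0) else 0) =
      if Anc par u z then 1 else 0 := by
    intro z hz
    rw [Finset.sum_eq_single z]
    · simp
    · intro b _ hb; simp [hb]
    · simp [hz]
  rw [← h x hx, ← h y hy, ← h l hl, Finset.mul_sum, ← Finset.sum_add_distrib,
    ← Finset.sum_sub_distrib]
  exact Finset.sum_congr rfl fun v _ => by split_ifs <;> simp

theorem subSum_sum {ι : Type*} (S : Finset ι) (f : ι → ℕ → ℝ) (c : ι → ℝ) (u : ℕ) :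
    subSum par n (fun v => ∑ e ∈ S, c e * f e v) u = ∑ e ∈ S, c e * subSum par n (f e) u := by
  classical
  unfold subSum
  simp only [Finset.mul_sum]
  rw [Finset.sum_comm]
  refine Finset.sum_congr rfl fun v _ => ?_
  split_ifs <;> simp

theorem subSum_apply (f : ℕ → ℕ → ℝ) (u w : ℕ) :
    subSum par n f u w = subSum par n (fun v => f v w) u := by
  classical
  unfold subSum
  rw [Finset.sum_apply]
  exact Finset.sum_congr rfl fun v _ => by split_ifs <;> simp

end RAM

/-! ## The cuts that 2-respect a spanning tree -/

theorem anc_zero {par : ℕ → ℕ} {n : ℕ} (hp : ∀ i < n, 0 < i → par i < i) {i : ℕ} (hi : i < n) :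
    Anc par 0 i := by
  induction i using Nat.strong_induction_on with
  | _ i ih =>
    rcases Nat.eq_zero_or_pos i with rfl | h
    · exact .refl
    · exact .step h (ih _ (hp i hi h) ((hp i hi h).trans hi))

theorem anc_iff_par {par : ℕ → ℕ} {v i : ℕ} (hi : 0 < i) (h : v ≠ i) :
    Anc par v i ↔ Anc par v (par i) := by
  rw [anc_iff]; simp [h, hi]

theorem not_anc_par {par : ℕ → ℕ} {n i : ℕ} (hp : ∀ i < n, 0 < i → par i < i) (hi : i < n)
    (h0 : 0 < i) : ¬ Anc par i (par i) := by
  intro h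
  have h1 := hp i hi h0
  have := anc_le_of_par_lt hp (by omega) h
  omega

/-- Two ways of colouring the vertices that agree up to a global exchange of colours separate the
same pairs; `o` and `d` are the colours of the root. -/
theorem not_iff_aux {a b c d e o : Prop} (h : (a ↔ o) ↔ (c ↔ d)) (h' : (b ↔ o) ↔ (e ↔ d)) :
    ¬ (a ↔ b) ↔ ¬ (¬ c ↔ ¬ e) := by
  by_cases ha : a <;> by_cases hb : b <;> by_cases ho : o <;> by_cases hc : c <;>
    by_cases hd : d <;> by_cases he : e <;> simp_all

/-- A function on a rooted tree is determined by its value at the root, and by the edges along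
which it changes. -/
theorem iff_of_changes {par : ℕ → ℕ} {n : ℕ} (hp : ∀ i < n, 0 < i → par i < i)
    {p q : ℕ → Prop} (h : ∀ i < n, 0 < i → ((p i ↔ p (par i)) ↔ (q i ↔ q (par i)))) {i : ℕ} (hi : i < n) :
    (p i ↔ p 0) ↔ (q i ↔ q 0) := by
  induction i using Nat.strong_induction_on with
  | _ i ih =>
    rcases Nat.eq_zero_or_pos i with rfl | h0
    · simp
    · have h1 := hp i hi h0
      have := ih _ h1 (by omega)
      have := h i hi h0
      tauto

namespace WGraph

variable {n m : ℕ} {G : WGraph n m} {T : Finset (Fin m)} {pos par : ℕ → ℕ}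

theorem IsSpanningTree.card (h : G.IsSpanningTree T) : T.card + 1 = n := by
  classical
  obtain ⟨h1, h2, h3⟩ := h
  have := h3.card_edgeFinset
  rw [Fintype.card_fin] at this
  rw [← this]
  congr 1
  rw [← Finset.card_image_of_injOn h2]
  congr 1
  ext x
  rw [SimpleGraph.mem_edgeFinset, SimpleGraph.edgeSet_fromEdgeSet]
  simp only [Finset.mem_image, Set.mem_sdiff, Set.mem_image, Finset.mem_coe]
  constructor
  · rintro ⟨e, he, rfl⟩
    refine ⟨⟨e, he, rfl⟩, ?_⟩
    simpa [ends] using h1 e he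
  · rintro ⟨h, -⟩; exact h

/-- A numbering `pos` of the vertices by `0, …, n-1`, such that the tree `T` consists of an edge
from each number but `0` to its parent. -/
structure TreePos (G : WGraph n m) (T : Finset (Fin m)) (pos par : ℕ → ℕ) : Prop where
  pos_lt : ∀ v < n, pos v < n
  pos_inj : ∀ u < n, ∀ v < n, pos u = pos v → u = v
  par_lt : ∀ i < n, 0 < i → par i < i
  edge : ∀ i < n, 0 < i → ∃ e ∈ T, s(pos (G.src e), pos (G.dst e)) = s(i, par i)

theorem TreePos.surj (H : TreePos G T pos par) {i : ℕ} (hi : i < n) : ∃ v < n, pos v = i := by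
  have hinj : Function.Injective fun v : Fin n => (⟨pos v, H.pos_lt v v.2⟩ : Fin n) := by
    intro u v h
    exact Fin.ext (H.pos_inj u u.2 v v.2 (by simpa using h))
  obtain ⟨v, hv⟩ := (Finite.injective_iff_surjective.1 hinj) ⟨i, hi⟩
  exact ⟨v, v.2, by simpa using hv⟩

theorem TreePos.eq_of_edge (H : TreePos G T pos par) {i j : ℕ} (hi : i < n) (hj : j < n)
    (h0 : 0 < i) (h1 : 0 < j) (h : s(i, par i) = s(j, par j)) : i = j := by
  have := H.par_lt i hi h0
  have := H.par_lt j hj h1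
  rw [Sym2.eq_iff] at h
  omega

/-- Counting: the edges from the `n - 1` positive positions to their parents are distinct members of
`T`, and `T` has only `n - 1` edges. -/
theorem TreePos.edge_of_mem (H : TreePos G T pos par) (hT : G.IsSpanningTree T) {e : Fin m}
    (he : e ∈ T) : ∃ i < n, 0 < i ∧ s(pos (G.src e), pos (G.dst e)) = s(i, par i) := by
  classical
  have : Nonempty (Fin m) := ⟨e⟩
  choose! f hf hf' using H.edge
  have hsub : (Finset.Ico 1 n).image f ⊆ T := by
    intro e he
    obtain ⟨i, hi, rfl⟩ := Finset.mem_image.1 he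
    rw [Finset.mem_Ico] at hi
    exact hf i hi.2 hi.1
  have hcard : ((Finset.Ico 1 n).image f).card = n - 1 := by
    rw [Finset.card_image_of_injOn, Nat.card_Ico]
    intro i hi j hj h
    simp only [Finset.coe_Ico, Set.mem_Ico] at hi hj
    refine H.eq_of_edge hi.2 hj.2 hi.1 hj.1 ?_
    rw [← hf' i hi.2 hi.1, ← hf' j hj.2 hj.1, h]
  have hTc := hT.card
  have := Finset.eq_of_subset_of_card_le hsub (by omega)
  rw [← this] at he
  obtain ⟨i, hi, rfl⟩ := Finset.mem_image.1 he
  rw [Finset.mem_Ico] at hi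
  exact ⟨i, hi.2, hi.1, hf' i hi.2 hi.1⟩

open Classical in
/-- The vertices below exactly one of `v` and `w`. -/
noncomputable def side (n : ℕ) (pos par : ℕ → ℕ) (v w : ℕ) : Finset (Fin n) :=
  Finset.univ.filter fun u => ¬ (Anc par v (pos u) ↔ Anc par w (pos u))

/-- The vertex at `w` is inside, being below `w` but not below the larger `v`. Outside is the vertex
at `v` if `w` is the root, since it is below both, and otherwise the root, which is below neither.
-/
theorem TreePos.isCut_side (H : TreePos G T pos par) {v w : ℕ} (hv : v < n) (hwv : w < v) :
    IsCut (side n pos par v w) := by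
  obtain ⟨u, hu, hpu⟩ := H.surj hv
  obtain ⟨u', hu', hpu'⟩ := H.surj (i := w) (by omega)
  obtain ⟨u0, hu0, hpu0⟩ := H.surj (i := 0) (by omega)
  have hvw : ¬ Anc par v w := fun h => by
    have := anc_le_of_par_lt H.par_lt (by omega) h; omega
  have hnv : ¬ Anc par v 0 := fun h => by
    have := anc_le_of_par_lt H.par_lt (by omega) h; omega
  refine ⟨⟨⟨u', hu'⟩, by simp [side, hpu', hvw, Anc.refl]⟩, ?_⟩
  rcases Nat.eq_zero_or_pos w with rfl | h0
  · exact ⟨⟨u, hu⟩, by simp [side, hpu, Anc.refl, anc_zero H.par_lt hv]⟩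
  · have hnw : ¬ Anc par w 0 := fun h => by
      have := anc_le_of_par_lt H.par_lt (by omega) h; omega
    exact ⟨⟨u0, hu0⟩, by simp [side, hpu0, hnv, hnw]⟩

/-- Passing from `i` to its parent changes the property of being below `v` only if `i = v`, and
likewise for `w`. So a crossing tree edge is the parent edge of `v` or of `w`, and `T` has no
parallel edges. -/
theorem TreePos.respects_side (H : TreePos G T pos par) (hT : G.IsSpanningTree T) {v w : ℕ} :
    G.Respects 2 T (side n pos par v w) := by
  classical
  unfold Respects
  have hc : ∀ e ∈ T ∩ G.crossing (side n pos par v w),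
      s(pos (G.src e), pos (G.dst e)) = s(v, par v) ∨ s(pos (G.src e), pos (G.dst e)) = s(w, par w) := by
    intro e he
    rw [Finset.mem_inter] at he
    obtain ⟨i, hi, h0, h⟩ := H.edge_of_mem hT he.1
    have hcr := he.2
    rw [h]
    by_contra hne
    push Not at hne
    have hv : v ≠ i := by rintro rfl; exact hne.1 rfl
    have hw : w ≠ i := by rintro rfl; exact hne.2 rfl
    simp only [crossing, side, Finset.mem_filter, Finset.mem_univ, true_and] at hcr
    have e1 := anc_iff_par (par := par) h0 hv
    have e2 := anc_iff_par (par := par) h0 hw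
    rw [Sym2.eq_iff] at h
    rcases h with ⟨h1, h2⟩ | ⟨h1, h2⟩ <;> rw [h1, h2] at hcr <;> tauto
  calc _ ≤ ({s(v, par v), s(w, par w)} : Finset (Sym2 ℕ)).card := by
        refine Finset.card_le_card_of_injOn (fun e => s(pos (G.src e), pos (G.dst e))) ?_ ?_
        · intro e he
          have := hc e he
          simpa using this
        · intro e he e' he' h
          simp only [Finset.coe_inter, Set.mem_inter_iff, Finset.mem_coe] at he he'
          refine hT.2.1 he.1 he'.1 ?_
          unfold ends
          have hp : ∀ {a b : Fin n}, pos a = pos b → a = b := fun h =>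
            Fin.ext (H.pos_inj _ (Fin.is_lt _) _ (Fin.is_lt _) h)
          dsimp only at h
          rw [Sym2.eq_iff] at h ⊢
          rcases h with h | h
          · exact Or.inl ⟨hp h.1, hp h.2⟩
          · exact Or.inr ⟨hp h.1, hp h.2⟩
    _ ≤ 2 := Finset.card_le_two

/-- Every cut that 2-respects the tree has the crossing edges of a `side`. -/
theorem TreePos.exists_side (H : TreePos G T pos par) (hn : 1 < n) {S : Finset (Fin n)}
    (hS : IsCut S) (hR : G.Respects 2 T S) :
    ∃ v w, v < n ∧ w < v ∧ G.crossing S = G.crossing (side n pos par v w) := by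
  classical
  have : Nonempty (Fin m) := ⟨(H.edge 1 hn Nat.one_pos).choose⟩
  choose! e he he' using H.edge
  set q : ℕ → Prop := fun i => ∃ u ∈ S, pos u = i with hq
  have hqpos : ∀ u : Fin n, q (pos u) ↔ u ∈ S := by
    intro u
    refine ⟨fun ⟨u', h, h'⟩ => ?_, fun h => ⟨u, h, rfl⟩⟩
    rwa [← Fin.ext (H.pos_inj _ u'.2 _ u.2 h')]
  -- The lower ends of the tree edges that cross `S`; by hypothesis there are at most two.
  set D := (Finset.Ico 1 n).filter fun i => ¬ (q i ↔ q (par i)) with hD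
  have hmem : ∀ i, i ∈ D ↔ (1 ≤ i ∧ i < n) ∧ ¬ (q i ↔ q (par i)) := by intro i; simp [hD]
  have hcard : D.card ≤ 2 := by
    refine le_trans (Finset.card_le_card_of_injOn e ?_ ?_) hR
    · intro i hi
      obtain ⟨⟨h1, h2⟩, h3⟩ := (hmem i).1 hi
      simp only [Finset.coe_inter, Set.mem_inter_iff, Finset.mem_coe]
      refine ⟨he i h2 h1, ?_⟩
      have h := he' i h2 h1
      simp only [crossing, Finset.mem_filter, Finset.mem_univ, true_and]
      rw [← hqpos, ← hqpos]
      rw [Sym2.eq_iff] at h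
      rcases h with ⟨h4, h5⟩ | ⟨h4, h5⟩ <;> rw [h4, h5]
      · exact h3
      · exact fun h => h3 h.symm
    · intro i hi j hj h
      obtain ⟨⟨h1, h2⟩, h3⟩ := (hmem i).1 hi
      obtain ⟨⟨h1', h2'⟩, h3'⟩ := (hmem j).1 hj
      refine H.eq_of_edge h2 h2' h1 h1' ?_
      rw [← he' i h2 h1, ← he' j h2' h1', h]
  -- it suffices to find a side with the same changes
  have key : ∀ v w, (∀ i < n, 0 < i → ((q i ↔ q (par i)) ↔ (i ≠ v ∧ i ≠ w))) → v < n → w < v →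
      ∃ v w, v < n ∧ w < v ∧ G.crossing S = G.crossing (side n pos par v w) := by
    intro v w hvw hv hw
    refine ⟨v, w, hv, hw, ?_⟩
    -- Both `S` and the side of `v` and `w` change exactly along the parent edges of `v` and `w`, so
    -- they agree up to complement.
    have hch : ∀ i < n, ((q i ↔ q 0) ↔ ((Anc par v i ↔ Anc par w i) ↔ (Anc par v 0 ↔ Anc par w 0))) := by
      intro i hi
      refine iff_of_changes (q := fun i => (Anc par v i ↔ Anc par w i)) H.par_lt ?_ hi
      intro i hi h0
      rw [hvw i hi h0]
      by_cases h1 : i = v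
      · subst h1
        have a1 := not_anc_par H.par_lt hi h0
        have a2 := anc_iff_par (par := par) (v := w) h0 (by omega)
        have a3 : Anc par i i := .refl
        simp [a1, a2, a3]
      · by_cases h2 : i = w
        · subst h2
          have a1 := not_anc_par H.par_lt hi h0
          have a2 := anc_iff_par (par := par) (v := v) h0 (by omega)
          have a3 : Anc par i i := .refl
          simp [a1, a2, a3]
        · have a1 := anc_iff_par (par := par) h0 (Ne.symm h1)
          have a2 := anc_iff_par (par := par) h0 (Ne.symm h2)
          simp [h1, h2, a1, a2]
    ext f
    simp only [crossing, side, Finset.mem_filter, Finset.mem_univ, true_and]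
    rw [← hqpos, ← hqpos]
    have a1 := hch _ (H.pos_lt (G.src f) (Fin.is_lt _))
    have a2 := hch _ (H.pos_lt (G.dst f) (Fin.is_lt _))
    exact not_iff_aux a1 a2
  -- If no tree edge crossed `S`, all the vertices would be on the side of the root.
  have hne : D.Nonempty := by
    by_contra hD0
    rw [Finset.not_nonempty_iff_eq_empty] at hD0
    have hall : ∀ i < n, (q i ↔ q 0) := by
      intro i hi
      have := iff_of_changes (p := q) (q := fun _ => True) H.par_lt (by
        intro j hj h0
        have : j ∉ D := by rw [hD0]; simp
        rw [hmem] at this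
        simp only [iff_self, iff_true]
        by_contra h
        exact this ⟨⟨h0, hj⟩, h⟩) hi
      simpa using this
    obtain ⟨⟨u, hu⟩, ⟨u', hu'⟩⟩ := hS
    rw [Finset.mem_compl] at hu'
    have a1 := hall _ (H.pos_lt u u.2)
    have a2 := hall _ (H.pos_lt u' u'.2)
    rw [hqpos] at a1 a2
    exact hu' (a2.2 (a1.1 hu))
  have h12 : D.card = 1 ∨ D.card = 2 := by
    have := hne.card_pos; omega
  rcases h12 with h | h
  · obtain ⟨v, hv⟩ := Finset.card_eq_one.1 h
    have hv' := (hmem v).1 (by rw [hv]; simp)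
    -- A single crossing tree edge: `v` is paired with the root, which has no parent edge and adds
    -- no change.
    refine key v 0 (fun i hi h0 => ?_) hv'.1.2 hv'.1.1
    have := hmem i
    rw [hv, Finset.mem_singleton] at this
    have h2 : i ≠ 0 := by omega
    rw [iff_comm, and_iff_left h2, Ne, this, not_and, not_not]
    exact ⟨fun h => h ⟨h0, hi⟩, fun h _ => h⟩
  · obtain ⟨v, w, hne, hv⟩ := Finset.card_eq_two.1 h
    have hv' := (hmem v).1 (by rw [hv]; simp)
    have hw' := (hmem w).1 (by rw [hv]; simp)
    have hi : ∀ i < n, 0 < i → ((q i ↔ q (par i)) ↔ (i ≠ v ∧ i ≠ w)) := by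
      intro i hi h0
      have := hmem i
      rw [hv, Finset.mem_insert, Finset.mem_singleton] at this
      rw [iff_comm, ← not_or, this, not_and, not_not]
      exact ⟨fun h => h ⟨h0, hi⟩, fun h _ => h⟩
    rcases lt_or_gt_of_ne hne with h | h
    · exact key w v (fun i a b => by rw [hi i a b, and_comm]) hw'.1.2 h
    · exact key v w hi hv'.1.2 h

theorem TreePos.isMin (H : TreePos G T pos par) (hT : G.IsSpanningTree T) {v w : ℕ}
    (hv : v < n) (hw : w < v)
    (hmin : ∀ v' w', v' < n → w' < v' →
      G.cutValue (side n pos par v w) ≤ G.cutValue (side n pos par v' w')) :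
    G.IsMinRespectingCut 2 T (side n pos par v w) := by
  refine ⟨H.isCut_side hv hw, H.respects_side hT, fun S hS hR => ?_⟩
  obtain ⟨v', w', h1, h2, h3⟩ := H.exists_side (by omega) hS hR
  unfold cutValue at *
  rw [h3]
  exact hmin v' w' h1 h2

end WGraph

namespace RAM

/-- Being above the lowest common ancestor means being above both ends, so `pathInd` is 1 iff
exactly one end is below the vertex. An edge crosses the side iff the indicators a and b for `v` and
`w` differ, and the indicator of this is a + b - 2ab. The identity is checked edge by edge. -/
theorem cutValue_side {n m : ℕ} {G : WGraph n m} {pos par X Y Lc : ℕ → ℕ} {wt : ℕ → ℝ}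
    (hwt : ∀ e : Fin m, wt e = G.wt e)
    (hX : ∀ e : Fin m, X e = pos (G.src e)) (hY : ∀ e : Fin m, Y e = pos (G.dst e))
    (hl : ∀ e < m, ∀ w, Anc par w (Lc e) ↔ (Anc par w (X e) ∧ Anc par w (Y e))) (v w : ℕ) :
    G.cutValue (WGraph.side n pos par v w) =
      (∑ e ∈ Finset.range m, wt e * pathInd par (X e) (Y e) (Lc e) v) +
      ((∑ e ∈ Finset.range m, wt e * pathInd par (X e) (Y e) (Lc e) w) +
      ∑ e ∈ Finset.range m, -2 * wt e * pathInd par (X e) (Y e) (Lc e) v *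
        pathInd par (X e) (Y e) (Lc e) w) := by
  classical
  rw [← Finset.sum_add_distrib, ← Finset.sum_add_distrib, Finset.sum_range]
  unfold WGraph.cutValue WGraph.crossing
  rw [Finset.sum_filter]
  refine Finset.sum_congr rfl fun e _ => ?_
  simp only [WGraph.side, Finset.mem_filter, Finset.mem_univ, true_and]
  rw [← hwt, ← hX, ← hY]
  unfold pathInd
  have h1 := hl e e.2 v
  have h2 := hl e e.2 w
  by_cases a1 : Anc par v (X e) <;> by_cases a2 : Anc par v (Y e) <;>
    by_cases a3 : Anc par w (X e) <;> by_cases a4 : Anc par w (Y e) <;>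
    simp only [h1, h2, a1, a2, a3, a4, if_true, if_false, and_true, and_false, and_self,
      not_true, not_false_iff, iff_true, iff_false, iff_self] <;> ring

end RAM

/-! ## Rooting a spanning tree by removing leaves -/

namespace WGraph

variable {n m : ℕ} {G : WGraph n m} {T E : Finset (Fin m)} {V : Finset ℕ}

/-- The edge `e` is incident to the vertex `u`. -/
def Inc (G : WGraph n m) (e : Fin m) (u : ℕ) : Prop := (G.src e : ℕ) = u ∨ (G.dst e : ℕ) = u

instance (e : Fin m) (u : ℕ) : Decidable (G.Inc e u) := by unfold Inc; infer_instance

/-- The number of edges in `E` at `u`. -/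
def deg (G : WGraph n m) (E : Finset (Fin m)) (u : ℕ) : ℕ := ∑ e ∈ E, if G.Inc e u then 1 else 0

/-- The sum of the neighbours of `u` by edges in `E`. -/
def nbr (G : WGraph n m) (E : Finset (Fin m)) (u : ℕ) : ℕ :=
  ∑ e ∈ E, if G.Inc e u then (G.src e : ℕ) + G.dst e - u else 0

theorem deg_erase {e : Fin m} (he : e ∈ E) (u : ℕ) :
    G.deg E u = G.deg (E.erase e) u + if G.Inc e u then 1 else 0 :=
  (Finset.sum_erase_add _ _ he).symm

theorem nbr_erase {e : Fin m} (he : e ∈ E) (u : ℕ) :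
    G.nbr E u = G.nbr (E.erase e) u + if G.Inc e u then (G.src e : ℕ) + G.dst e - u else 0 :=
  (Finset.sum_erase_add _ _ he).symm

theorem deg_le (u : ℕ) : G.deg E u ≤ m := by
  calc G.deg E u ≤ ∑ e ∈ E, 1 := Finset.sum_le_sum fun e _ => by split_ifs <;> simp
    _ ≤ m := by simpa using Finset.card_le_univ E

theorem nbr_le (u : ℕ) : G.nbr E u ≤ m * (2 * n) := by
  calc G.nbr E u ≤ ∑ e ∈ E, 2 * n := Finset.sum_le_sum fun e _ => by
        have := (G.src e).2
        have := (G.dst e).2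
        split_ifs <;> omega
    _ ≤ m * (2 * n) := by
        rw [Finset.sum_const, smul_eq_mul]
        exact Nat.mul_le_mul_right _ (by simpa using Finset.card_le_univ E)

/-- The edges `E` connect the vertices `V`, and are a tree on them. -/
structure Peel (G : WGraph n m) (E : Finset (Fin m)) (V : Finset ℕ) : Prop where
  loop : ∀ e ∈ E, G.src e ≠ G.dst e
  mem : ∀ e ∈ E, (G.src e : ℕ) ∈ V ∧ (G.dst e : ℕ) ∈ V
  lt : ∀ v ∈ V, v < n
  card : V.card = E.card + 1
  zero : 0 ∈ V
  conn : ∀ S : Set ℕ, 0 ∈ S → (∀ e ∈ E, ((G.src e : ℕ) ∈ S ↔ (G.dst e : ℕ) ∈ S)) → ∀ v ∈ V, v ∈ S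

/-- Connectivity is expressed by sets: a set containing 0 that no edge leaves or enters contains all
the vertices. This form passes to the tree without a leaf, with no need to handle walks. -/
theorem IsSpanningTree.peel (hT : G.IsSpanningTree T) (hn : 0 < n) : G.Peel T (Finset.range n) := by
  refine ⟨hT.1, fun e _ => by simp, fun v => by simp, by simpa using hT.card.symm, by simpa using hn,
    fun S h0 hS v hv => ?_⟩
  rw [Finset.mem_range] at hv
  have hc := hT.2.2.connected.preconnected ⟨0, hn⟩ ⟨v, hv⟩
  rw [SimpleGraph.reachable_iff_reflTransGen] at hc
  have : ∀ w : Fin n, Relation.ReflTransGen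
      (SimpleGraph.fromEdgeSet (G.ends '' (T : Set (Fin m)))).Adj ⟨0, hn⟩ w → (w : ℕ) ∈ S := by
    intro w hw
    induction hw with
    | refl => exact h0
    | tail _ h ih =>
      rw [SimpleGraph.fromEdgeSet_adj] at h
      obtain ⟨⟨e, he, h⟩, -⟩ := h
      have := hS e he
      unfold ends at h
      rw [Sym2.eq_iff] at h
      rcases h with ⟨h1, h2⟩ | ⟨h1, h2⟩ <;> rw [h1, h2] at this <;> tauto
  exact this _ hc

theorem deg_pos_iff {u : ℕ} : 0 < G.deg E u ↔ ∃ e ∈ E, G.Inc e u := by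
  unfold deg
  rw [Finset.sum_pos_iff]
  refine exists_congr fun e => and_congr_right fun _ => ?_
  by_cases h : G.Inc e u <;> simp [h]

/-- An isolated vertex would be separated from the others: by the set `{0}` if it is the root, by
its complement if it is not. -/
theorem Peel.deg_pos (P : G.Peel E V) (h2 : 2 ≤ V.card) {v : ℕ} (hv : v ∈ V) : 0 < G.deg E v := by
  rw [deg_pos_iff]
  by_contra hne
  push Not at hne
  rcases Nat.eq_zero_or_pos v with rfl | h0
  · have := P.conn {0} rfl (fun e he => by
      have := hne e he
      unfold Inc at this
      push Not at this
      simp [this])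
    have h3 : V ⊆ {0} := fun u hu => by simpa using this u hu
    have := Finset.card_le_card h3
    simp at this; omega
  · have := P.conn {v}ᶜ (by simp; omega) (fun e he => by
      have := hne e he
      unfold Inc at this
      push Not at this
      simp [this]) v hv
    simp at this

theorem Peel.sum_deg (P : G.Peel E V) : ∑ v ∈ V, G.deg E v = 2 * E.card := by
  unfold deg
  rw [Finset.sum_comm, Finset.card_eq_sum_ones, Finset.mul_sum]
  refine Finset.sum_congr rfl fun e he => ?_
  have h := P.mem e he
  have hl : (G.src e : ℕ) ≠ G.dst e := fun h => P.loop e he (Fin.ext h)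
  have : ∀ v : ℕ, (if G.Inc e v then 1 else 0) =
      (if (G.src e : ℕ) = v then 1 else 0) + if (G.dst e : ℕ) = v then 1 else 0 := by
    intro v
    by_cases h1 : (G.src e : ℕ) = v
    · have h2 : (G.dst e : ℕ) ≠ v := by omega
      simp [Inc, h1, h2]
    · by_cases h2 : (G.dst e : ℕ) = v <;> simp [Inc, h1, h2]
  simp only [this]
  rw [Finset.sum_add_distrib, Finset.sum_ite_eq, Finset.sum_ite_eq, if_pos h.1, if_pos h.2]
  rfl

/-- If every vertex but the root had degree at least 2, the degrees would sum to more than twice the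
number of edges, since the root has positive degree too. -/
theorem Peel.exists_leaf (P : G.Peel E V) (h2 : 2 ≤ V.card) : ∃ v ∈ V, v ≠ 0 ∧ G.deg E v = 1 := by
  by_contra hne
  push Not at hne
  have h1 := P.sum_deg
  rw [← Finset.add_sum_erase _ _ P.zero] at h1
  have h3 : ∑ v ∈ V.erase 0, 2 ≤ ∑ v ∈ V.erase 0, G.deg E v := by
    refine Finset.sum_le_sum fun v hv => ?_
    rw [Finset.mem_erase] at hv
    have := P.deg_pos h2 hv.2
    have := hne v hv.2 hv.1
    omega
  rw [Finset.sum_const, smul_eq_mul, Finset.card_erase_of_mem P.zero] at h3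
  have := P.deg_pos h2 P.zero
  have := P.card
  omega

/-- A leaf has one edge, so the sum of its neighbours is its neighbour `p`, and removing the leaf
changes the data of `p` only. Until the root is all that remains on the other side, `p` keeps
another edge: this is the reason for the bound on its degree when `p ≠ 0`. -/
theorem Peel.leaf (P : G.Peel E V) {v : ℕ} (hv : v ∈ V) (h0 : v ≠ 0) (h1 : G.deg E v = 1) :
    ∃ e ∈ E, ∃ p ∈ V, p ≠ v ∧ s((G.src e : ℕ), (G.dst e : ℕ)) = s(v, p) ∧ G.nbr E v = p ∧
      (p ≠ 0 → 2 ≤ G.deg E p) ∧ G.Peel (E.erase e) (V.erase v) ∧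
      (∀ u, u ≠ v → u ≠ p → G.deg (E.erase e) u = G.deg E u ∧ G.nbr (E.erase e) u = G.nbr E u) ∧
      G.deg E p = G.deg (E.erase e) p + 1 ∧ G.nbr E p = G.nbr (E.erase e) p + v := by
  obtain ⟨e, he, hi⟩ := deg_pos_iff.1 (by omega : 0 < G.deg E v)
  have hm := P.mem e he
  have hl : (G.src e : ℕ) ≠ G.dst e := fun h => P.loop e he (Fin.ext h)
  obtain ⟨p, hp, hpv, hs⟩ : ∃ p ∈ V, p ≠ v ∧ s((G.src e : ℕ), (G.dst e : ℕ)) = s(v, p) := by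
    rcases hi with h | h
    · exact ⟨_, hm.2, by omega, by rw [h]⟩
    · exact ⟨_, hm.1, by omega, by rw [h, Sym2.eq_swap]⟩
  have hinc : ∀ u, G.Inc e u ↔ u = v ∨ u = p := by
    intro u
    unfold Inc
    rw [Sym2.eq_iff] at hs
    omega
  have hsum : (G.src e : ℕ) + G.dst e = v + p := by
    rw [Sym2.eq_iff] at hs
    omega
  have hdv : G.deg (E.erase e) v = 0 := by
    have := deg_erase he v (G := G)
    rw [if_pos ((hinc v).2 (Or.inl rfl))] at this
    omega
  have hother : ∀ f ∈ E.erase e, ¬ G.Inc f v := by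
    intro f hf hi
    have := deg_pos_iff.2 ⟨f, hf, hi⟩
    omega
  refine ⟨e, he, p, hp, hpv, hs, ?_, ?_, ?_, ?_, ?_, ?_⟩
  · rw [nbr_erase he, if_pos ((hinc v).2 (Or.inl rfl)), hsum]
    have : G.nbr (E.erase e) v = 0 := by
      unfold nbr
      exact Finset.sum_eq_zero fun f hf => if_neg (hother f hf)
    omega
  · intro hp0
    by_contra hlt
    have hdp : G.deg (E.erase e) p = 0 := by
      have := deg_erase he p (G := G)
      rw [if_pos ((hinc p).2 (Or.inr rfl))] at this
      omega
    -- If `p` had no other edge, `v` and `p` together would be cut off from the root.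
    have := P.conn {u | u ≠ v ∧ u ≠ p} ⟨Ne.symm h0, Ne.symm hp0⟩ (fun f hf => by
      by_cases hfe : f = e
      · subst hfe
        have h1 := (hinc (G.src f)).1 (Or.inl rfl)
        have h2 := (hinc (G.dst f)).1 (Or.inr rfl)
        simp only [Set.mem_ofPred_eq]
        omega
      · have hf' : f ∈ E.erase e := Finset.mem_erase.2 ⟨hfe, hf⟩
        have h1 := hother f hf'
        have h2 : ¬ G.Inc f p := fun hi => by
          have := deg_pos_iff.2 ⟨f, hf', hi⟩
          omega
        unfold Inc at h1 h2
        simp only [Set.mem_ofPred_eq]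
        omega) v hv
    exact this.1 rfl
  · refine ⟨fun f hf => P.loop f (Finset.mem_of_mem_erase hf), fun f hf => ?_,
      fun u hu => P.lt u (Finset.mem_of_mem_erase hu), ?_, ?_, ?_⟩
    · have h1 := hother f hf
      have h2 := P.mem f (Finset.mem_of_mem_erase hf)
      unfold Inc at h1
      rw [Finset.mem_erase, Finset.mem_erase]
      tauto
    · rw [Finset.card_erase_of_mem hv, Finset.card_erase_of_mem he, P.card]
      have := Finset.card_pos.2 ⟨e, he⟩
      omega
    · exact Finset.mem_erase.2 ⟨Ne.symm h0, P.zero⟩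
    · intro S hS0 hS u hu
      rw [Finset.mem_erase] at hu
      -- The set is adjusted at `v` to treat it like its neighbour `p`, so the removed edge does not
      -- leave it either.
      have := P.conn {x | (x = v ∧ p ∈ S) ∨ (x ≠ v ∧ x ∈ S)} (Or.inr ⟨Ne.symm h0, hS0⟩)
        (fun f hf => ?_) u hu.2
      · simpa [hu.1] using this
      · by_cases hfe : f = e
        · subst hfe
          rw [Sym2.eq_iff] at hs
          simp only [Set.mem_ofPred_eq]
          rcases hs with ⟨h1, h2⟩ | ⟨h1, h2⟩ <;> rw [h1, h2] <;> simp [hpv]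
        · have hf' : f ∈ E.erase e := Finset.mem_erase.2 ⟨hfe, hf⟩
          have h1 := hother f hf'
          unfold Inc at h1
          push Not at h1
          simpa [h1] using hS f hf'
  · intro u h1 h2
    have : ¬ G.Inc e u := by rw [hinc]; tauto
    rw [deg_erase he u, nbr_erase he u, if_neg this, if_neg this]
    simp
  · rw [deg_erase he p, if_pos ((hinc p).2 (Or.inr rfl))]
  · rw [nbr_erase he p, if_pos ((hinc p).2 (Or.inr rfl)), hsum]
    simp

/-- The state of the removal of leaves, when `i` vertices besides the root remain: `d` and `b`
are the degrees and sums of neighbours, `q` holds the vertices removed (from `i + 1` on) and the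
leaves (from `t` to `i`). -/
structure PeelInv (G : WGraph n m) (T : Finset (Fin m)) (i : ℕ) (d b q : ℕ → ℕ) (t : ℕ)
    (E : Finset (Fin m)) (V : Finset ℕ) : Prop where
  peel : G.Peel E V
  sub : E ⊆ T
  card : E.card = i
  d_eq : ∀ u ∈ V, d u = G.deg E u + if u = 0 then 2 else 0
  b_eq : ∀ u ∈ V, b u = G.nbr E u
  t_pos : 1 ≤ t
  t_le : t ≤ i + 1
  leaf : ∀ j, t ≤ j → j ≤ i → q j ∈ V ∧ q j ≠ 0 ∧ G.deg E (q j) = 1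
  all : ∀ v ∈ V, v ≠ 0 → G.deg E v = 1 → ∃ j, t ≤ j ∧ j ≤ i ∧ q j = v
  inj : ∀ j j', t ≤ j → j < n → t ≤ j' → j' < n → q j = q j' → j = j'
  done : ∀ j, i < j → j < n → q j < n ∧ q j ≠ 0 ∧ q j ∉ V ∧ b (q j) < n ∧
    (∀ j', j ≤ j' → j' < n → q j' ≠ b (q j)) ∧
    ∃ e ∈ T, s((G.src e : ℕ), (G.dst e : ℕ)) = s(q j, b (q j))
  zero : q 0 = 0

/-- The vertex in slot `i + 1` is a leaf and its neighbour becomes its parent. The parent is still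
present, so it ends up in an earlier slot: the final array lists parents first. A parent that
becomes a leaf is queued in slot `t - 1`. -/
theorem PeelInv.step {i : ℕ} {d b q : ℕ → ℕ} {t : ℕ} (P : G.PeelInv T (i + 1) d b q t E V)
    (hi : i + 1 < n) :
    q (i + 1) < n ∧ b (q (i + 1)) < n ∧ ∃ p, p = b (q (i + 1)) ∧ ∃ E' V',
    (d p - 1 = 1 → 2 ≤ t ∧ G.PeelInv T i (Function.update d p (d p - 1))
      (Function.update b p (b p - q (i + 1))) (Function.update q (t - 1) p) (t - 1) E' V') ∧
    (d p - 1 ≠ 1 → G.PeelInv T i (Function.update d p (d p - 1))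
      (Function.update b p (b p - q (i + 1))) q t E' V') := by
  have hVc := P.peel.card
  rw [P.card] at hVc
  have ht : t ≤ i + 1 := by
    obtain ⟨v, hv, h0, h1⟩ := P.peel.exists_leaf (by omega)
    obtain ⟨j, h2, h3, -⟩ := P.all v hv h0 h1
    omega
  obtain ⟨hv, hv0, hv1⟩ := P.leaf (i + 1) ht le_rfl
  obtain ⟨e, he, p, hp, hpv, hs, hn, hp2, hP', hsame, hdp, hbp⟩ := P.peel.leaf hv hv0 hv1
  have hbv : b (q (i + 1)) = p := by rw [P.b_eq _ hv, hn]
  have hpn := P.peel.lt p hp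
  have ht1 := P.t_pos
  have hnq : ∀ j, t ≤ j → j ≤ i + 1 → q j ≠ p := by
    intro j h1 h2 h
    obtain ⟨h3, h4, h5⟩ := P.leaf j h1 h2
    rw [h] at h4 h5
    have := hp2 h4
    omega
  have hnv : ∀ j, t ≤ j → j ≤ i → q j ≠ q (i + 1) := by
    intro j h1 h2 h
    have := P.inj j (i + 1) h1 (by omega) ht (by omega) h
    omega
  have hdpv := P.d_eq p hp
  -- the common part, for any new queue
  have key : ∀ q' t', (∀ j, i < j → j < n → q' j = q j) → q' 0 = 0 → 1 ≤ t' → t' ≤ i + 1 →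
      (∀ j, t' ≤ j → j ≤ i → (q' j = p ∧ p ≠ 0 ∧ G.deg E p = 2) ∨ (t ≤ j ∧ q' j = q j)) →
      (∀ j, t ≤ j → j ≤ i → t' ≤ j ∧ q' j = q j) →
      (p ≠ 0 → G.deg E p = 2 → ∃ j, t' ≤ j ∧ j ≤ i ∧ q' j = p) →
      (∀ j j', t' ≤ j → j < n → t' ≤ j' → j' < n → q' j = q' j' → j = j') →
      G.PeelInv T i (Function.update d p (d p - 1)) (Function.update b p (b p - q (i + 1))) q' t'
        (E.erase e) (V.erase (q (i + 1))) := by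
    intro q' t' a1 a2 a3 a4 a5 a6 a7 a8
    refine ⟨hP', fun f hf => P.sub (Finset.mem_of_mem_erase hf), ?_, ?_, ?_, a3, a4, ?_, ?_, a8, ?_, a2⟩
    · rw [Finset.card_erase_of_mem he, P.card]; rfl
    · intro u hu
      rw [Finset.mem_erase] at hu
      by_cases hup : u = p
      · subst hup; rw [Function.update_self, hdpv, hdp]; omega
      · rw [Function.update_of_ne hup, P.d_eq u hu.2, (hsame u hu.1 hup).1]
    · intro u hu
      rw [Finset.mem_erase] at hu
      by_cases hup : u = p
      · subst hup; rw [Function.update_self, P.b_eq u hu.2, hbp]; omega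
      · rw [Function.update_of_ne hup, P.b_eq u hu.2, (hsame u hu.1 hup).2]
    · intro j h1 h2
      rcases a5 j h1 h2 with ⟨b1, b2, b3⟩ | ⟨b1, b2⟩
      · rw [b1]
        exact ⟨Finset.mem_erase.2 ⟨hpv, hp⟩, b2, by omega⟩
      · rw [b2]
        obtain ⟨c1, c2, c3⟩ := P.leaf j b1 (by omega)
        have hne := hnv j b1 h2
        exact ⟨Finset.mem_erase.2 ⟨hne, c1⟩, c2, by rw [(hsame _ hne (hnq j b1 (by omega))).1, c3]⟩
    · intro u hu hu0 hu1
      rw [Finset.mem_erase] at hu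
      by_cases hup : u = p
      · subst hup; exact a7 hu0 (by omega)
      · rw [(hsame u hu.1 hup).1] at hu1
        obtain ⟨j, h1, h2, h3⟩ := P.all u hu.2 hu0 hu1
        have : j ≠ i + 1 := by rintro rfl; exact hu.1 h3.symm
        exact ⟨j, (a6 j h1 (by omega)).1, by omega, by rw [(a6 j h1 (by omega)).2, h3]⟩
    · intro j h1 h2
      rw [a1 j h1 h2]
      have hj' : ∀ j', j ≤ j' → j' < n → q' j' = q j' := fun j' h3 h4 => a1 j' (by omega) h4
      rcases Nat.eq_or_lt_of_le (show i + 1 ≤ j from h1) with rfl | h3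
      · rw [Function.update_of_ne (Ne.symm hpv), hbv]
        refine ⟨P.peel.lt _ hv, hv0, by simp, hpn, fun j' h3 h4 => ?_, e, P.sub he, hs⟩
        rw [hj' j' h3 h4]
        rcases Nat.eq_or_lt_of_le h3 with rfl | h5
        · exact Ne.symm hpv
        · intro h
          have := (P.done j' h5 h4).2.2.1
          rw [h] at this
          exact this hp
      · obtain ⟨c1, c2, c3, c4, c5, c6⟩ := P.done j h3 h2
        have hne : q j ≠ p := fun h => c3 (by rw [h]; exact hp)
        rw [Function.update_of_ne hne]
        refine ⟨c1, c2, fun h => c3 (Finset.mem_of_mem_erase h), c4, fun j' h4 h5 => ?_, c6⟩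
        rw [hj' j' h4 h5]
        exact c5 j' h4 h5
  refine ⟨P.peel.lt _ hv, by rw [hbv]; exact hpn, p, hbv.symm, E.erase e, V.erase (q (i + 1)),
    fun h1 => ?_, fun h1 => ?_⟩
  · have hp0 : p ≠ 0 := by
      rintro rfl
      simp at hdpv
      omega
    rw [if_neg hp0] at hdpv
    -- The queued leaves, `p` and the root are distinct vertices among the `i + 2` that remain. So
    -- there is a free slot for `p`, and slot 0 stays with the root.
    have ht2 : 2 ≤ t := by
      have h3 : (Finset.Icc t (i + 1)).image q ⊆ (V.erase 0).erase p := by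
        intro u hu
        obtain ⟨j, hj, rfl⟩ := Finset.mem_image.1 hu
        rw [Finset.mem_Icc] at hj
        obtain ⟨c1, c2, c3⟩ := P.leaf j hj.1 hj.2
        exact Finset.mem_erase.2 ⟨hnq j hj.1 hj.2, Finset.mem_erase.2 ⟨c2, c1⟩⟩
      have h4 := Finset.card_le_card h3
      rw [Finset.card_image_of_injOn, Nat.card_Icc, Finset.card_erase_of_mem
        (Finset.mem_erase.2 ⟨hp0, hp⟩), Finset.card_erase_of_mem P.peel.zero] at h4
      · omega
      · intro j hj j' hj' h
        simp only [Finset.coe_Icc, Set.mem_Icc] at hj hj'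
        exact P.inj j j' hj.1 (by omega) hj'.1 (by omega) h
    have hnq' : ∀ j, t ≤ j → j < n → q j ≠ p := by
      intro j h2 h3
      rcases le_or_gt j (i + 1) with h4 | h4
      · exact hnq j h2 h4
      · intro h
        have := (P.done j h4 h3).2.2.1
        rw [h] at this
        exact this hp
    refine ⟨ht2, key _ _ (fun j h2 h3 => by rw [Function.update_of_ne (by omega)])
      (by rw [Function.update_of_ne (by omega), P.zero]) (by omega) (by omega) ?_ ?_ ?_ ?_⟩
    · intro j h2 h3
      by_cases hj : j = t - 1
      · left; subst hj; rw [Function.update_self]; exact ⟨rfl, hp0, by omega⟩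
      · right; rw [Function.update_of_ne hj]; exact ⟨by omega, rfl⟩
    · intro j h2 h3
      rw [Function.update_of_ne (by omega)]
      exact ⟨by omega, rfl⟩
    · intro _ _
      exact ⟨t - 1, le_rfl, by omega, by rw [Function.update_self]⟩
    · intro j j' h2 h3 h4 h5 h
      by_cases hj : j = t - 1 <;> by_cases hj' : j' = t - 1
      · omega
      · subst hj
        rw [Function.update_self, Function.update_of_ne hj'] at h
        exact absurd h.symm (hnq' j' (by omega) h5)
      · subst hj'
        rw [Function.update_self, Function.update_of_ne hj] at h
        exact absurd h (hnq' j (by omega) h3)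
      · rw [Function.update_of_ne hj, Function.update_of_ne hj'] at h
        exact P.inj j j' (by omega) h3 (by omega) h5 h
  · refine key q t (fun _ _ _ => rfl) P.zero ht1 ?_ (fun j h2 h3 => Or.inr ⟨h2, rfl⟩)
      (fun j h2 _ => ⟨h2, rfl⟩) (fun hp0 h => ?_) P.inj
    · omega
    · rw [if_neg hp0] at hdpv
      omega

end WGraph

/-! ### The removal of leaves as a program -/

namespace RAM

/-- Compute the degrees and the sums of the neighbours in the tree. -/
def degProg : Prog :=
  .seq (.wset 2 (.const 0))
  (forUp 2 1 (.ite (.weq (.load 2 (.reg 2)) (.const 1))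
    (.seq (.seq (.wset 3 (.load 0 (.reg 2))) (.wset 4 (.load 1 (.reg 2))))
    (.seq (.wstore 4 (.reg 3) (.add (.load 4 (.reg 3)) (.const 1)))
    (.seq (.wstore 4 (.reg 4) (.add (.load 4 (.reg 4)) (.const 1)))
    (.seq (.wstore 5 (.reg 3) (.add (.load 5 (.reg 3)) (.reg 4)))
    (.wstore 5 (.reg 4) (.add (.load 5 (.reg 4)) (.reg 3)))))))
    .skip))

/-- Put the leaves into the queue. -/
def leafProg : Prog :=
  .seq (.seq (.wstore 4 (.const 0) (.add (.load 4 (.const 0)) (.const 2)))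
    (.seq (.wset 3 (.reg 0)) (.wset 2 (.const 1))))
  (forUp 2 0 (.ite (.weq (.load 4 (.reg 2)) (.const 1))
    (.seq (.wset 3 (.sub (.reg 3) (.const 1))) (.wstore 6 (.reg 3) (.reg 2))) .skip))

/-- Remove the leaves one by one. -/
def peelProg : Prog :=
  .seq (.wset 2 (.sub (.reg 0) (.const 1)))
  (forDown 2 (.seq (.seq (.wset 4 (.load 6 (.add (.reg 2) (.const 1))))
    (.seq (.wset 5 (.load 5 (.reg 4)))
    (.seq (.wstore 4 (.reg 5) (.sub (.load 4 (.reg 5)) (.const 1)))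
    (.wstore 5 (.reg 5) (.sub (.load 5 (.reg 5)) (.reg 4))))))
    (.ite (.weq (.load 4 (.reg 5)) (.const 1))
      (.seq (.wset 3 (.sub (.reg 3) (.const 1))) (.wstore 6 (.reg 3) (.reg 5))) .skip)))

variable {W n m : ℕ} {G : WGraph n m} {T : Finset (Fin m)}

theorem degProg_ok {s : State} (hT : ∀ e ∈ T, G.src e ≠ G.dst e) (hm : s.wreg 1 = m)
    (h0 : ∀ e : Fin m, s.warr 0 e = G.src e) (h1 : ∀ e : Fin m, s.warr 1 e = G.dst e)
    (h2 : ∀ e : Fin m, s.warr 2 e = if e ∈ T then 1 else 0)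
    (h4 : ∀ u, s.warr 4 u = 0) (h5 : ∀ u, s.warr 5 u = 0) (hW : m * (2 * n) + n + m ≤ W) :
    Ok W degProg s (m * 60 + 10) fun s' => (∀ u, s'.warr 4 u = G.deg T u) ∧
      ∀ u, s'.warr 5 u = G.nbr T u := by
  classical
  refine (Ok.seq (T := 2) (T' := m * 60 + 4) (Ok.line (by simp) ?_)).mono
    (by omega) fun _ => id
  simp only [wp, WExp.eval]
  refine ⟨by omega, ?_⟩
  set E : ℕ → Finset (Fin m) := fun i => T.filter fun e => e.val < i with hE
  refine (Ok.forUp (fun i s' => (∀ u, s'.warr 4 u = G.deg (E i) u) ∧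
      ∀ u, s'.warr 5 u = G.nbr (E i) u) (a := 0) (N := m) 50 (by decide) (by decide) (by decide)
      (by simp) (by simpa using hm) (by omega) (by omega) ?_ ?_).mono (by omega) ?_
  · simp [E, WGraph.deg, WGraph.nbr, h4, h5]
  · rintro i s' - hi ⟨hd, hb⟩ hx hF
    have f0 := hF.warr 0 (by decide)
    have f1 := hF.warr 1 (by decide)
    have f2 := hF.warr 2 (by decide)
    simp at f0 f1 f2
    have g0 := h0 ⟨i, hi⟩
    have g1 := h1 ⟨i, hi⟩
    have g2 := h2 ⟨i, hi⟩
    dsimp only at g0 g1 g2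
    rw [← f0] at g0
    rw [← f1] at g1
    rw [← f2] at g2
    refine Ok.line (by simp) ?_
    simp only [wp, WExp.eval, Test.Holds, hx, g2, setW_warr, setW_wreg]
    by_cases hi' : (⟨i, hi⟩ : Fin m) ∈ T
    · have hE' : E (i + 1) = insert ⟨i, hi⟩ (E i) := by
        ext e
        simp only [E, Finset.mem_filter, Finset.mem_insert, Fin.ext_iff]
        constructor
        · rintro ⟨a, b⟩
          by_cases h : e.val = i
          · exact Or.inl h
          · exact Or.inr ⟨a, by omega⟩
        · rintro (h | ⟨a, b⟩)
          · exact ⟨by rwa [show e = ⟨i, hi⟩ from Fin.ext h], by omega⟩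
          · exact ⟨a, by omega⟩
      have hni : (⟨i, hi⟩ : Fin m) ∉ E i := by simp [E]
      have hne : (G.src ⟨i, hi⟩ : ℕ) ≠ G.dst ⟨i, hi⟩ := fun h => hT _ hi' (Fin.ext h)
      have hdd : ∀ u, G.deg (E (i + 1)) u = G.deg (E i) u + if G.Inc ⟨i, hi⟩ u then 1 else 0 := by
        intro u; unfold WGraph.deg; rw [hE', Finset.sum_insert hni, add_comm]
      have hbb : ∀ u, G.nbr (E (i + 1)) u = G.nbr (E i) u + if G.Inc ⟨i, hi⟩ u then
          (G.src ⟨i, hi⟩ : ℕ) + G.dst ⟨i, hi⟩ - u else 0 := by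
        intro u; unfold WGraph.nbr; rw [hE', Finset.sum_insert hni, add_comm]
      set a := (G.src ⟨i, hi⟩ : ℕ) with ha
      set b := (G.dst ⟨i, hi⟩ : ℕ) with hb'
      have hinc : ∀ u, G.Inc ⟨i, hi⟩ u ↔ a = u ∨ b = u := fun u => Iff.rfl
      have l1 := G.deg_le (E := E (i + 1))
      have l2 := G.nbr_le (E := E (i + 1))
      have ba : a < n := (G.src _).2
      have bb : b < n := (G.dst _).2
      have da := l1 a
      have db := l1 b
      have na := l2 a
      have nb := l2 b
      rw [hdd, if_pos ((hinc _).2 (Or.inl rfl))] at da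
      rw [hdd, if_pos ((hinc _).2 (Or.inr rfl))] at db
      rw [hbb, if_pos ((hinc _).2 (Or.inl rfl))] at na
      rw [hbb, if_pos ((hinc _).2 (Or.inr rfl))] at nb
      simp [hi', g0, g1, hx, hd, hb, Function.update_of_ne hne.symm]
      simp [Function.update_apply, hne, hne.symm]
      iterate 10 refine ⟨by omega, ?_⟩
      refine ⟨fun u => ?_, fun u => ?_⟩
      · simp only [hdd, hinc, hd]
        by_cases h1 : u = b
        · subst h1; simp
        · by_cases h2 : u = a
          · subst h2; simp [hne]
          · simp [h1, h2, Ne.symm h1, Ne.symm h2]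
      · simp only [hbb, hinc, hb]
        by_cases h1 : u = b
        · rw [h1]; simp
        · by_cases h2 : u = a
          · rw [h2]; simp [hne]
          · simp [h1, h2, Ne.symm h1, Ne.symm h2]
    · have hE' : E (i + 1) = E i := by
        ext e
        simp only [E, Finset.mem_filter]
        refine and_congr_right fun he => ⟨fun h => ?_, fun h => by omega⟩
        have : e.val ≠ i := by rintro rfl; exact hi' he
        omega
      simp [hi', hd, hb, hE']
  · rintro s' ⟨⟨hd, hb⟩, -⟩
    have : E m = T := by ext e; simp [E]
    rw [this] at hd hb
    exact ⟨hd, hb⟩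

/-- Leaves are stored downwards from slot `n - 1`. At most `v - 1` of them are found among the
positive numbers below `v`, which keeps the pointer positive: this is the clause `n + 1 ≤ s'.wreg 3
+ v` of the invariant. -/
theorem leafProg_ok {s : State} (hT : G.IsSpanningTree T) (hn : 1 ≤ n) (h0 : s.wreg 0 = n)
    (h4 : ∀ u, s.warr 4 u = G.deg T u) (h5 : ∀ u, s.warr 5 u = G.nbr T u)
    (h6 : ∀ u, s.warr 6 u = 0) (hW : m * (2 * n) + n + m + 2 ≤ W) :
    Ok W leafProg s (n * 40 + 20) fun s' =>
      (∀ u, s'.warr 4 u ≤ W ∧ s'.warr 5 u ≤ W) ∧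
      G.PeelInv T (n - 1) (s'.warr 4) (s'.warr 5) (s'.warr 6) (s'.wreg 3) T (Finset.range n) := by
  have hd0 := G.deg_le (E := T) 0
  refine (Ok.seq (T := 12) (T' := n * 40 + 4) (Ok.line (by simp) ?_)).mono
    (by omega) fun _ => id
  simp only [wp, WExp.eval, h4, storeW_wreg, h0]
  refine ⟨by omega, by omega, by omega, by omega, ?_⟩
  set d := Function.update (s.warr 4) 0 (G.deg T 0 + 2) with hd
  refine (Ok.forUp (fun v s' => n + 1 ≤ s'.wreg 3 + v ∧ s'.wreg 3 ≤ n ∧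
      (∀ j, s'.wreg 3 ≤ j → j < n → s'.warr 6 j < v ∧ s'.warr 6 j ≠ 0 ∧ d (s'.warr 6 j) = 1) ∧
      (∀ u < v, u ≠ 0 → d u = 1 → ∃ j, s'.wreg 3 ≤ j ∧ j < n ∧ s'.warr 6 j = u) ∧
      (∀ j j', s'.wreg 3 ≤ j → j < n → s'.wreg 3 ≤ j' → j' < n → s'.warr 6 j = s'.warr 6 j' →
        j = j') ∧ s'.warr 6 0 = 0) (a := 1) (N := n) 30 (by decide) (by decide) (by decide)
      (by simp) (by simpa using h0) (by omega) (by omega) ?_ ?_).fr.mono (by omega) ?_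
  · simp [h6]
    omega
  · rintro v s' h1 hv ⟨a1, a2, a3, a4, a5, a6⟩ hx hF
    have f4 := hF.warr 4 (by decide)
    have f4' : s'.warr 4 = d := by rw [f4]; simp [hd]
    refine Ok.line (by simp) ?_
    simp only [wp, WExp.eval, Test.Holds, hx, f4', setW_wreg]
    refine ⟨fun hc => ⟨by omega, by norm_num; omega, by norm_num [hx]; omega, ?_⟩, fun hc => ?_⟩
    · norm_num [hx]
      refine ⟨by omega, by omega, fun j h2 h3 => ?_, fun u h2 h3 h4 => ?_, fun j j' h2 h3 h4 h5 h => ?_, ?_⟩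
      · by_cases hj : j = s'.wreg 3 - 1
        · subst hj; simp; exact ⟨by omega, hc⟩
        · rw [Function.update_of_ne hj]
          have := a3 j (by omega) h3
          exact ⟨by omega, this.2⟩
      · by_cases hu : u = v
        · subst hu; exact ⟨s'.wreg 3 - 1, by omega, by omega, by simp⟩
        · obtain ⟨j, b1, b2, b3⟩ := a4 u (by omega) h3 h4
          exact ⟨j, by omega, b2, by rw [Function.update_of_ne (by omega), b3]⟩
      · by_cases hj : j = s'.wreg 3 - 1 <;> by_cases hj' : j' = s'.wreg 3 - 1
        · omega
        · subst hj
          rw [Function.update_self, Function.update_of_ne hj'] at h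
          have := (a3 j' (by omega) h5).1
          omega
        · subst hj'
          rw [Function.update_self, Function.update_of_ne hj] at h
          have := (a3 j (by omega) h3).1
          omega
        · rw [Function.update_of_ne hj, Function.update_of_ne hj'] at h
          exact a5 j j' (by omega) h3 (by omega) h5 h
      · rw [Function.update_of_ne (by omega), a6]
    · norm_num
      refine ⟨by omega, a2, fun j h2 h3 => ?_, fun u h2 h3 h4 => ?_, a5, a6⟩
      · have := a3 j (by omega) h3
        exact ⟨by omega, this.2⟩
      · have : u ≠ v := by rintro rfl; exact hc h4
        exact a4 u (by omega) h3 h4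
  · rintro s' ⟨⟨⟨a1, a2, a3, a4, a5, a6⟩, -⟩, hF⟩
    have f4 := hF.warr 4 (by decide)
    have f5 := hF.warr 5 (by decide)
    have f4' : s'.warr 4 = d := by rw [f4]; simp [hd]
    simp at f5
    have hdu : ∀ u, u ≠ 0 → d u = G.deg T u := by
      intro u hu; rw [hd, Function.update_of_ne hu, h4]
    refine ⟨fun u => ?_, hT.peel hn, subset_rfl, ?_, ?_, ?_, by omega, by omega, ?_, ?_, a5, by omega, a6⟩
    · have b1 := G.deg_le (E := T) u
      have b2 := G.nbr_le (E := T) u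
      rw [f4', f5, h5]
      refine ⟨?_, by omega⟩
      by_cases hu : u = 0
      · subst hu; simp [hd]; omega
      · rw [hdu u hu]; omega
    · have := hT.card; omega
    · intro u _
      rw [f4']
      by_cases hu : u = 0
      · subst hu; simp [hd]
      · rw [hdu u hu, if_neg hu]; rfl
    · intro u _; rw [f5, h5]
    · intro j h1 h2
      obtain ⟨b1, b2, b3⟩ := a3 j h1 (by omega)
      exact ⟨Finset.mem_range.2 b1, b2, by rw [← hdu _ b2, b3]⟩
    · intro v h1 h2 h3
      obtain ⟨j, b1, b2, b3⟩ := a4 v (Finset.mem_range.1 h1) h2 (by rw [hdu v h2, h3])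
      exact ⟨j, b1, by omega, b3⟩

theorem peelProg_ok {s : State} (hn : 1 ≤ n) (h0 : s.wreg 0 = n) (hW : m * (2 * n) + n + m + 2 ≤ W)
    (hb : ∀ u, s.warr 4 u ≤ W ∧ s.warr 5 u ≤ W)
    (hP : G.PeelInv T (n - 1) (s.warr 4) (s.warr 5) (s.warr 6) (s.wreg 3) T (Finset.range n)) :
    Ok W peelProg s (n * 60 + 20) fun s' => ∃ E V,
      G.PeelInv T 0 (s'.warr 4) (s'.warr 5) (s'.warr 6) (s'.wreg 3) E V := by
  refine (Ok.seq (T := 5) (T' := (n - 1) * 57 + 4) (Ok.line (by simp) ?_)).mono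
    (by omega) fun _ => id
  simp only [wp, WExp.eval, h0]
  refine ⟨by omega, ?_⟩
  refine (Ok.forDown (fun i s' => (∀ u, s'.warr 4 u ≤ W ∧ s'.warr 5 u ≤ W) ∧ ∃ E V,
      G.PeelInv T i (s'.warr 4) (s'.warr 5) (s'.warr 6) (s'.wreg 3) E V)
      (N := n - 1) 50 (by decide) (by simp) (by omega) ⟨by simpa using hb, _, _, by simpa using hP⟩ ?_).mono
      (by omega) fun s' h => h.1.2
  · rintro i s' hi ⟨hb, E, V, P⟩ hx hF
    obtain ⟨c1, c2, p, hp, E', V', c3, c4⟩ := P.step (by omega)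
    refine Ok.line (by simp) ?_
    simp only [wp, WExp.eval, Test.Holds, setW_wreg, setW_warr, storeW_warr]
    norm_num [← hp]
    have b4 := hb p
    have ht := P.t_le
    have b5 := (hb p).2
    have hpn : p < n := by rw [hp]; exact c2
    have hb' : ∀ u, Function.update (s'.warr 4) p (s'.warr 4 p - 1) u ≤ W ∧
        Function.update (s'.warr 5) p (s'.warr 5 p - s'.warr 6 (i + 1)) u ≤ W := by
      intro u
      by_cases hu : u = p
      · rw [hu, Function.update_self, Function.update_self]; omega
      · rw [Function.update_of_ne hu, Function.update_of_ne hu]; exact hb u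
    iterate 5 refine ⟨by omega, ?_⟩
    refine ⟨fun h => ⟨by omega, by omega, hb', E', V', (c3 (by omega)).2⟩,
      fun h => ⟨hb', E', V', c4 (by omega)⟩⟩

/-- Root the tree at `0`: the vertices `warr 6` come after their parents `warr 5`. -/
def rootProg : Prog := .seq degProg (.seq leafProg peelProg)

/-- The vertices are listed in the array `q`, parents first. -/
structure Rooted (G : WGraph n m) (T : Finset (Fin m)) (q b : ℕ → ℕ) : Prop where
  zero : q 0 = 0
  lt : ∀ j < n, q j < n
  inj : ∀ j < n, ∀ j' < n, q j = q j' → j = j'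
  par_lt : ∀ j < n, 0 < j → b (q j) < n
  par_ne : ∀ j j', 0 < j → j ≤ j' → j' < n → q j' ≠ b (q j)
  edge : ∀ j < n, 0 < j → ∃ e ∈ T, s((G.src e : ℕ), (G.dst e : ℕ)) = s(q j, b (q j))

theorem _root_.WGraph.PeelInv.rooted {d b q : ℕ → ℕ} {t : ℕ} {E : Finset (Fin m)} {V : Finset ℕ} (hn : 0 < n)
    (P : G.PeelInv T 0 d b q t E V) : Rooted G T q b := by
  have ht1 := P.t_pos
  have ht2 := P.t_le
  refine ⟨P.zero, fun j hj => ?_, fun j hj j' hj' h => ?_, fun j hj h0 => (P.done j h0 hj).2.2.2.1,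
    fun j j' h0 h1 h2 => (P.done j h0 (by omega)).2.2.2.2.1 j' h1 h2,
    fun j hj h0 => (P.done j h0 hj).2.2.2.2.2⟩
  · rcases Nat.eq_zero_or_pos j with rfl | h0
    · rw [P.zero]; exact hn
    · exact (P.done j h0 hj).1
  · rcases Nat.eq_zero_or_pos j with rfl | h0 <;> rcases Nat.eq_zero_or_pos j' with rfl | h0'
    · rfl
    · rw [P.zero] at h
      exact absurd h.symm (P.done j' h0' hj').2.1
    · rw [P.zero] at h
      exact absurd h (P.done j h0 hj).2.1
    · exact P.inj j j' (by omega) hj (by omega) hj' h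

theorem rootProg_ok {s : State} (hT : G.IsSpanningTree T) (hn1 : 1 ≤ n) (hn : s.wreg 0 = n)
    (hm : s.wreg 1 = m)
    (h0 : ∀ e : Fin m, s.warr 0 e = G.src e) (h1 : ∀ e : Fin m, s.warr 1 e = G.dst e)
    (h2 : ∀ e : Fin m, s.warr 2 e = if e ∈ T then 1 else 0)
    (h4 : ∀ u, s.warr 4 u = 0) (h5 : ∀ u, s.warr 5 u = 0) (h6 : ∀ u, s.warr 6 u = 0)
    (hW : m * (2 * n) + n + m + 2 ≤ W) :
    Ok W rootProg s (m * 60 + n * 100 + 50) fun s' => Rooted G T (s'.warr 6) (s'.warr 5) := by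
  refine (Ok.seq' (T := m * 60 + 10) (T' := n * 100 + 40)
    (degProg_ok hT.1 hm h0 h1 h2 h4 h5 (by omega)) ?_).mono (by omega) fun _ => id
  rintro s1 ⟨a4, a5⟩ hF
  have f6 := hF.warr 6 (by decide)
  have f0 := hF.wreg 0 (by decide)
  refine (Ok.seq' (T := n * 40 + 20) (T' := n * 60 + 20)
    (leafProg_ok hT hn1 (by rw [f0, hn]) a4 a5 (by rw [f6]; exact h6) hW) ?_).mono (by omega)
    fun _ => id
  rintro s2 ⟨hb, P⟩ hF2
  have g0 := hF2.wreg 0 (by decide)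
  refine (peelProg_ok hn1 (by rw [g0, f0, hn]) hW hb P).mono le_rfl ?_
  rintro s3 ⟨E, V, P'⟩
  exact P'.rooted hn1

end RAM

/-! ## Heavy paths -/

/-- A vertex on the same heavy path as its parent. -/
def IsHeavy (q hv : ℕ → ℕ) (i : ℕ) : Prop := 0 < i ∧ hv (q i) = i

/-- Vertices numbered parents first, with parents `q`, heavy children `hv`, lengths `len` of the
remaining heavy paths, positions `pos`, and positions `hd` of the heads of the heavy paths. -/
structure HeavyPaths (n : ℕ) (q hv len pos hd : ℕ → ℕ) : Prop where
  q_lt : ∀ i < n, 0 < i → q i < i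
  hv_ok : ∀ p < n, hv p ≠ 0 → hv p < n ∧ q (hv p) = p
  len_eq : ∀ p < n, len p = if hv p = 0 then 1 else len (hv p) + 1
  heavy : ∀ i < n, IsHeavy q hv i → pos i = pos (q i) + 1 ∧ hd i = hd (q i)
  light : ∀ i < n, ¬ IsHeavy q hv i → hd i = pos i ∧ ∀ j < i, pos j + len j ≤ pos i
  zero : pos 0 = 0
  cover : ∃ nf, (∀ i < n, pos i + len i ≤ nf) ∧ ∀ x < nf, ∃ j < n, pos j ≤ x ∧ x < pos j + len j
  size : ∃ sz : ℕ → ℕ, sz 0 ≤ n ∧ (∀ i < n, 1 ≤ sz i) ∧ ∀ i < n, 0 < i → sz i ≤ sz (q i) ∧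
    (¬ IsHeavy q hv i → 2 * sz i ≤ sz (q i))

theorem exists_rec {α : Type*} (q : ℕ → ℕ) (F : ℕ → α → α) (a : α) (n : ℕ)
    (hq : ∀ i < n, 0 < i → q i < i) :
    ∃ f : ℕ → α, f 0 = a ∧ ∀ i < n, 0 < i → f i = F i (f (q i)) := by
  induction n with
  | zero => exact ⟨fun _ => a, rfl, by omega⟩
  | succ n ih =>
    obtain ⟨f, h0, h⟩ := ih fun i hi => hq i (by omega)
    rcases Nat.eq_zero_or_pos n with rfl | hn
    · exact ⟨f, h0, by omega⟩
    · refine ⟨Function.update f n (F n (f (q n))), by rw [Function.update_of_ne (by omega), h0],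
        fun i hi hi0 => ?_⟩
      have := hq i hi hi0
      rw [Function.update_of_ne (a := q i) (by omega)]
      by_cases hin : i = n
      · subst hin; rw [Function.update_self]
      · rw [Function.update_of_ne hin, h i (by omega) hi0]

namespace HeavyPaths

variable {n : ℕ} {q hv len pos hd : ℕ → ℕ}

theorem len_pos (H : HeavyPaths n q hv len pos hd) {i : ℕ} (hi : i < n) : 1 ≤ len i := by
  rw [H.len_eq i hi]; split_ifs <;> omega

theorem len_heavy (H : HeavyPaths n q hv len pos hd) {i : ℕ} (hi : i < n) (h : IsHeavy q hv i) :
    len (q i) = len i + 1 := by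
  have := H.q_lt i hi h.1
  have h0 := h.1
  rw [H.len_eq (q i) (by omega), h.2, if_neg (by omega)]

/-- A step up a heavy edge lowers the position by one and lengthens the remaining path by one, so
the end of the block is unchanged. The climb stops at a light vertex, where `hd` is the position
itself. -/
theorem exists_head (H : HeavyPaths n q hv len pos hd) {ldl : ℕ → ℕ}
    (hl : ∀ i < n, IsHeavy q hv i → ldl i = ldl (q i)) {i : ℕ} (hi : i < n) :
    ∃ h ≤ i, ¬ IsHeavy q hv h ∧ pos h ≤ pos i ∧ pos h + len h = pos i + len i ∧ hd i = pos h ∧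
      ldl h = ldl i := by
  induction i using Nat.strong_induction_on with
  | _ i ih =>
    by_cases hh : IsHeavy q hv i
    · have hq := H.q_lt i hi hh.1
      obtain ⟨h, h1, h2, h3, h4, h5, h6⟩ := ih (q i) hq (by omega)
      have h7 := H.heavy i hi hh
      have h8 := H.len_heavy hi hh
      exact ⟨h, by omega, h2, by omega, by omega, by omega, by rw [h6, hl i hi hh]⟩
    · exact ⟨i, le_rfl, hh, le_rfl, rfl, (H.light i hi hh).1, rfl⟩

/-- For two light vertices, the block of the earlier one ends before the later one starts. A heavy
vertex lies strictly inside the block of its head, so it cannot meet the start of a block. For two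
heavy vertices the parents have equal positions, and induction on the position applies. -/
theorem inj (H : HeavyPaths n q hv len pos hd) : ∀ i < n, ∀ j < n, pos i = pos j → i = j := by
  have hmix : ∀ i < n, ∀ j < n, IsHeavy q hv i → ¬ IsHeavy q hv j → pos i ≠ pos j := by
    intro i hi j hj h1 h2 he
    have hq := H.q_lt i hi h1.1
    obtain ⟨h, a1, a2, a3, a4, -⟩ := H.exists_head (ldl := fun _ => 0) (by simp) (i := q i) (by omega)
    have b1 := H.heavy i hi h1
    have b2 := H.len_heavy hi h1
    have b3 := H.len_pos hi
    have b4 := H.len_pos hj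
    rcases lt_trichotomy h j with c | c | c
    · have := (H.light j hj h2).2 h c
      omega
    · subst c; omega
    · have := (H.light h (by omega) a2).2 j c
      omega
  have key : ∀ N, ∀ i < n, ∀ j < n, pos i = N → pos i = pos j → i = j := by
    intro N
    induction N using Nat.strong_induction_on with
    | _ N ih =>
      intro i hi j hj hN he
      by_cases h1 : IsHeavy q hv i <;> by_cases h2 : IsHeavy q hv j
      · have a1 := (H.heavy i hi h1).1
        have a2 := (H.heavy j hj h2).1
        have a3 := H.q_lt i hi h1.1
        have a4 := H.q_lt j hj h2.1
        have := ih (pos (q i)) (by omega) (q i) (by omega) (q j) (by omega) rfl (by omega)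
        rw [← h1.2, ← h2.2, this]
      · exact absurd he (hmix i hi j hj h1 h2)
      · exact absurd he.symm (hmix j hj i hi h2 h1)
      · have b3 := H.len_pos hi
        have b4 := H.len_pos hj
        rcases lt_trichotomy i j with c | c | c
        · have := (H.light j hj h2).2 i c
          omega
        · exact c
        · have := (H.light i hi h1).2 j c
          omega
  exact fun i hi j hj h => key _ i hi j hj rfl h

/-- The blocks cover all the numbers below `nf`, and walking down a heavy path meets every position
of its block. So `n` vertices fill `nf` positions, which forces `nf ≤ n`. -/
theorem pos_lt (H : HeavyPaths n q hv len pos hd) {i : ℕ} (hi : i < n) : pos i < n := by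
  have hblock : ∀ L, ∀ j < n, len j ≤ L → ∀ x, pos j ≤ x → x < pos j + len j → ∃ c < n, pos c = x := by
    intro L
    induction L with
    | zero =>
      intro j hj hL
      have := H.len_pos hj
      omega
    | succ L ih =>
      intro j hj hL x h1 h2
      rcases Nat.eq_or_lt_of_le h1 with h | h
      · exact ⟨j, hj, h⟩
      · have h3 := H.len_eq j hj
        by_cases hh : hv j = 0
        · rw [if_pos hh] at h3; omega
        · rw [if_neg hh] at h3
          obtain ⟨h4, h5⟩ := H.hv_ok j hj hh
          have h6 := (H.heavy (hv j) h4 ⟨by omega, by rw [h5]⟩).1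
          rw [h5] at h6
          exact ih (hv j) h4 (by omega) x (by omega) (by omega)
  obtain ⟨nf, h1, h2⟩ := H.cover
  have h3 : Finset.range nf ⊆ (Finset.range n).image pos := by
    intro x hx
    obtain ⟨j, hj, h4, h5⟩ := h2 x (Finset.mem_range.1 hx)
    obtain ⟨c, hc, rfl⟩ := hblock _ j hj le_rfl x h4 h5
    exact Finset.mem_image_of_mem _ (Finset.mem_range.2 hc)
  have h4 := (Finset.card_le_card h3).trans Finset.card_image_le
  rw [Finset.card_range, Finset.card_range] at h4
  have := h1 i hi
  have := H.len_pos hi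
  omega

/-- A light edge at least halves the size of the subtree, so `2 ^ ldl i * sz i ≤ n` persists from
the root downwards; since sizes are positive, the light depth is at most the logarithm. -/
theorem exists_depth (H : HeavyPaths n q hv len pos hd) :
    ∃ ldl : ℕ → ℕ, (∀ i < n, ldl i ≤ Nat.log 2 n) ∧ (∀ i < n, IsHeavy q hv i → ldl i = ldl (q i)) ∧
      ∀ i < n, 0 < i → ¬ IsHeavy q hv i → ldl (q i) < ldl i := by
  classical
  obtain ⟨ldl, h0, hl⟩ := exists_rec q (fun i d => if IsHeavy q hv i then d else d + 1) 0 n H.q_lt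
  obtain ⟨sz, s0, s1, s2⟩ := H.size
  have key : ∀ i < n, 2 ^ ldl i * sz i ≤ n := by
    intro i
    induction i using Nat.strong_induction_on with
    | _ i ih =>
      intro hi
      rcases Nat.eq_zero_or_pos i with rfl | hi0
      · rw [h0]; simpa using s0
      · have hq := H.q_lt i hi hi0
        have h1 := ih (q i) hq (by omega)
        obtain ⟨h2, h3⟩ := s2 i hi hi0
        rw [hl i hi hi0]
        split_ifs with hh
        · exact (Nat.mul_le_mul_left _ h2).trans h1
        · rw [pow_succ, mul_assoc]
          exact (Nat.mul_le_mul_left _ (h3 hh)).trans h1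
  refine ⟨ldl, fun i hi => ?_, fun i hi hh => ?_, fun i hi hi0 hh => ?_⟩
  · refine Nat.le_log_of_pow_le (by norm_num) ?_
    have := key i hi
    have := s1 i hi
    calc 2 ^ ldl i ≤ 2 ^ ldl i * sz i := Nat.le_mul_of_pos_right _ (by omega)
      _ ≤ n := key i hi
  · rw [hl i hi hh.1, if_pos hh]
  · rw [hl i hi hi0, if_neg hh]; omega

/-- The positions of the vertices make a layout. -/
theorem layout (H : HeavyPaths n q hv len pos hd) {par head : ℕ → ℕ} (hn : 0 < n)
    (hpar : ∀ i < n, 0 < i → par (pos i) = pos (q i)) (hhead : ∀ i < n, head (pos i) = hd i) :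
    ∃ ld, Layout n par head ld ∧ ∀ i < n, ld i ≤ Nat.log 2 n := by
  obtain ⟨ldl, hl1, hl2, hl3⟩ := H.exists_depth
  have hsurj : ∀ x < n, ∃ i < n, pos i = x := by
    intro x hx
    have hinj : Function.Injective fun v : Fin n => (⟨pos v, H.pos_lt v.2⟩ : Fin n) := by
      intro u v h
      exact Fin.ext (H.inj u u.2 v v.2 (by simpa using h))
    obtain ⟨v, hv⟩ := (Finite.injective_iff_surjective.1 hinj) ⟨x, hx⟩
    exact ⟨v, v.2, by simpa using hv⟩
  choose! lb hlb hlb' using hsurj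
  have hpos0 : ∀ i < n, 0 < pos i → 0 < i := by
    intro i hi h
    by_contra h0
    obtain rfl : i = 0 := by omega
    rw [H.zero] at h; omega
  have hlbp : ∀ i < n, lb (pos i) = i := fun i hi =>
    H.inj _ (hlb _ (H.pos_lt hi)) i hi (hlb' _ (H.pos_lt hi))
  have hnl : ¬ IsHeavy q hv 0 := fun h => by have := h.1; omega
  -- The layout is indexed by positions, so the light depth is transported along the inverse `lb` of
  -- `pos`.
  refine ⟨fun x => ldl (lb x), ⟨?_, ?_, ?_, ?_⟩, fun x hx => hl1 _ (hlb x hx)⟩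
  · intro x hx hx0
    obtain ⟨i, hi, rfl⟩ : ∃ i < n, pos i = x := ⟨lb x, hlb x hx, hlb' x hx⟩
    have hi0 := hpos0 i hi hx0
    rw [hpar i hi hi0]
    have hq := H.q_lt i hi hi0
    by_cases hh : IsHeavy q hv i
    · have := (H.heavy i hi hh).1; omega
    · have := (H.light i hi hh).2 (q i) hq
      have := H.len_pos (i := q i) (by omega)
      omega
  · have := hhead 0 hn
    rw [H.zero] at this
    rw [this, (H.light 0 hn hnl).1, H.zero]
  · intro x hx hx0
    obtain ⟨i, hi, rfl⟩ : ∃ i < n, pos i = x := ⟨lb x, hlb x hx, hlb' x hx⟩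
    have hi0 := hpos0 i hi hx0
    have hq := H.q_lt i hi hi0
    by_cases hh : IsHeavy q hv i
    · obtain ⟨h1, h2⟩ := H.heavy i hi hh
      right
      rw [hpar i hi hi0, hhead i hi, h1, h2]
      exact ⟨by omega, by rw [Nat.add_sub_cancel, hhead (q i) (by omega)]⟩
    · left
      rw [hhead i hi, (H.light i hi hh).1]
  · intro x hx hx0
    obtain ⟨i, hi, rfl⟩ : ∃ i < n, pos i = x := ⟨lb x, hlb x hx, hlb' x hx⟩
    -- The head has the light depth of the whole path, and the edge above it is light, so the depth
    -- of its parent is smaller.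
    obtain ⟨h, h1, h2, h3, h4, h5, h6⟩ := H.exists_head hl2 hi
    have hh : h < n := by omega
    rw [hhead i hi, h5] at hx0 ⊢
    have hh0 := hpos0 h hh (by omega)
    have hq := H.q_lt h hh hh0
    rw [hpar h hh hh0, hlbp _ (by omega), hlbp i hi, ← h6]
    exact hl3 h hh hh0 h2

end HeavyPaths

/-! ### Subtree sizes and heavy children -/

theorem accum_le {n : ℕ} {q : ℕ → ℕ} (hq : ∀ i < n, 0 < i → q i < i) {i u : ℕ} (hu : u < n)
    (hi : u < i) : accum q n (fun _ => 1) i u ≤ n := by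
  calc accum q n (fun _ => 1) i u ≤ accum q n (fun _ => 1) (u + 1) u := by
        unfold accum
        gcongr
        exact hi
    _ = subSum q n (fun _ => 1) u := accum_self hq _ hu
    _ ≤ ∑ x ∈ Finset.range n, 1 := by
        unfold subSum
        exact Finset.sum_le_sum fun x _ => by split_ifs <;> simp
    _ = n := by simp

theorem subSum_one_le {n : ℕ} {q : ℕ → ℕ} (hq : ∀ i < n, 0 < i → q i < i) {u : ℕ} (hu : u < n) :
    subSum q n (fun _ => 1) u ≤ n := by
  rw [← accum_self hq _ hu]
  exact accum_le hq hu (by omega)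

theorem subSum_one_pos {n : ℕ} {q : ℕ → ℕ} (hq : ∀ i < n, 0 < i → q i < i) {u : ℕ} (hu : u < n) :
    1 ≤ subSum q n (fun _ => 1) u := by
  rw [← accum_self hq _ hu]
  simp [accum]

/-- Siblings have disjoint subtrees inside that of the parent. Applied to a light vertex and its
heavy sibling, which is at least as large, this gives the halving of sizes along light edges. -/
theorem subSum_add_le {n : ℕ} {q : ℕ → ℕ} (hq : ∀ i < n, 0 < i → q i < i) {c h : ℕ} (hc : c < n)
    (hh : h < n) (hc0 : 0 < c) (hh0 : 0 < h) (hqq : q c = q h) (hne : c ≠ h) :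
    subSum q n (fun _ => 1) c + subSum q n (fun _ => 1) h ≤ subSum q n (fun _ => 1) (q c) := by
  have h1 := hq c hc hc0
  have h2 := hq h hh hh0
  rw [← accum_self hq _ (show q c < n by omega)]
  unfold accum
  have : ∑ x ∈ ({c, h} : Finset ℕ), (if q x = q c then subSum q n (fun _ => 1) x else 0) ≤
      ∑ x ∈ Finset.Ico (q c + 1) n, if q x = q c then subSum q n (fun _ => 1) x else 0 := by
    refine Finset.sum_le_sum_of_subset ?_
    intro x hx
    simp only [Finset.mem_insert, Finset.mem_singleton] at hx
    rw [Finset.mem_Ico]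
    omega
  rw [Finset.sum_pair hne, if_pos rfl, if_pos hqq.symm] at this
  omega

/-- The state of the computation of sizes and heavy children, when the vertices from `i` on have
been processed. -/
structure SizeInv (n : ℕ) (q : ℕ → ℕ) (i : ℕ) (sz hv len : ℕ → ℕ) : Prop where
  sz_eq : ∀ u < n, sz u = if u < i then accum q n (fun _ => 1) i u else subSum q n (fun _ => 1) u
  hv_ok : ∀ p < n, (hv p = 0 ∧ ∀ c, i ≤ c → c < n → 0 < c → q c ≠ p) ∨
    (0 < hv p ∧ i ≤ hv p ∧ hv p < n ∧ q (hv p) = p ∧ ∀ c, i ≤ c → c < n → 0 < c → q c = p →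
      subSum q n (fun _ => 1) c ≤ subSum q n (fun _ => 1) (hv p))
  len_eq : ∀ j, i ≤ j → j < n → len j = (if hv j = 0 then 1 else len (hv j) + 1) ∧ len j + j ≤ n

/-- A heavy child has a larger number than its parent, so its remaining path length is already
known. The bound `l + i ≤ n` comes from the same fact and keeps the lengths within the word size. -/
theorem SizeInv.len_step {n : ℕ} {q : ℕ → ℕ} (hq : ∀ i < n, 0 < i → q i < i) {i : ℕ}
    {sz hv len : ℕ → ℕ} (S : SizeInv n q (i + 1) sz hv len) (hi : i < n) {l : ℕ}
    (hl : l = if hv i = 0 then 1 else len (hv i) + 1) :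
    l + i ≤ n ∧ ∀ j, i ≤ j → j < n →
      Function.update len i l j = (if hv j = 0 then 1 else Function.update len i l (hv j) + 1) ∧
      Function.update len i l j + j ≤ n := by
  have hgt : ∀ j < n, hv j ≠ 0 → i < hv j ∧ hv j < n := by
    intro j hj h
    rcases S.hv_ok j hj with h' | h'
    · exact absurd h'.1 h
    · exact ⟨h'.2.1, h'.2.2.1⟩
  have hpc : ∀ j < n, hv j ≠ 0 → j < hv j := by
    intro j hj h
    rcases S.hv_ok j hj with h' | h'
    · exact absurd h'.1 h
    · have := hq (hv j) h'.2.2.1 h'.1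
      omega
  have hli : l + i ≤ n := by
    rw [hl]
    split_ifs with h
    · omega
    · have := hgt i hi h
      have := (S.len_eq (hv i) this.1 this.2).2
      omega
  refine ⟨hli, fun j h1 h2 => ?_⟩
  by_cases hj : j = i
  · subst hj
    rw [Function.update_self]
    refine ⟨?_, hli⟩
    by_cases h0 : hv j = 0
    · rw [if_pos h0]; rw [if_pos h0] at hl; exact hl
    · rw [if_neg h0]; rw [if_neg h0] at hl
      have := hpc j hi h0
      rw [Function.update_of_ne (by omega), hl]
  · rw [Function.update_of_ne hj]
    have := S.len_eq j (by omega) h2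
    refine ⟨?_, this.2⟩
    rw [this.1]
    by_cases h0 : hv j = 0
    · rw [if_pos h0, if_pos h0]
    · have := hgt j h2 h0
      rw [if_neg h0, if_neg h0, Function.update_of_ne (by omega)]

/-- At its turn `i` has its final size, and so has the current heavy child of its parent, which came
earlier. The heavy child is replaced only by a strictly larger sibling. -/
theorem SizeInv.step {n : ℕ} {q : ℕ → ℕ} (hq : ∀ i < n, 0 < i → q i < i) {i : ℕ}
    {sz hv hv' len len' : ℕ → ℕ} (S : SizeInv n q (i + 1) sz hv len) (hi : i < n) (hi0 : 0 < i)
    (hl : ∀ j, i ≤ j → j < n → len' j = (if hv j = 0 then 1 else len' (hv j) + 1) ∧ len' j + j ≤ n)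
    (hv1 : hv (q i) ≠ 0 ∧ sz i ≤ sz (hv (q i)) → hv' = hv)
    (hv2 : ¬ (hv (q i) ≠ 0 ∧ sz i ≤ sz (hv (q i))) → hv' = Function.update hv (q i) i) :
    SizeInv n q i (Function.update sz (q i) (sz (q i) + sz i)) hv' len' := by
  have hqi := hq i hi hi0
  have hself := accum_self hq (fun _ => 1) hi
  have hszi : sz i = subSum q n (fun _ => 1) i := by
    rw [S.sz_eq i hi, if_pos (by omega), hself]
  have hne : ∀ j, i ≤ j → hv' j = hv j := by
    intro j hj
    by_cases hc : hv (q i) ≠ 0 ∧ sz i ≤ sz (hv (q i))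
    · rw [hv1 hc]
    · rw [hv2 hc, Function.update_of_ne (by omega)]
  refine ⟨fun u hu => ?_, fun p hp => ?_, fun j h1 h2 => ?_⟩
  · have hst := accum_step (par := q) (n := n) (fun _ => 1) (u := u) hi hself
    by_cases h : u = q i
    · rw [h, Function.update_self, S.sz_eq _ (by omega), if_pos (by omega), if_pos (by omega),
        ← h, hst, if_pos h, hszi, hself]
    · rw [Function.update_of_ne h, S.sz_eq u hu]
      rw [if_neg h, add_zero] at hst
      by_cases h1 : u < i
      · rw [if_pos (by omega), if_pos h1, hst]
      · rw [if_neg h1]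
        by_cases h2 : u = i
        · subst h2; rw [if_pos (by omega), hself]
        · rw [if_neg (by omega)]
  · by_cases hpq : p = q i
    · right
      subst hpq
      by_cases hc : hv (q i) ≠ 0 ∧ sz i ≤ sz (hv (q i))
      · rw [hv1 hc]
        rcases S.hv_ok _ hp with h | ⟨h1, h2, h3, h4, h5⟩
        · exact absurd h.1 hc.1
        · refine ⟨h1, by omega, h3, h4, fun c c1 c2 c3 c4 => ?_⟩
          by_cases hci : c = i
          · subst hci
            have := hc.2
            rwa [hszi, S.sz_eq _ h3, if_neg (by omega)] at this
          · exact h5 c (by omega) c2 c3 c4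
      · rw [hv2 hc, Function.update_self]
        refine ⟨hi0, le_rfl, hi, rfl, fun c c1 c2 c3 c4 => ?_⟩
        by_cases hci : c = i
        · rw [hci]
        · rcases S.hv_ok _ hp with h | ⟨h1, h2, h3, h4, h5⟩
          · exact absurd c4 (h.2 c (by omega) c2 c3)
          · have h6 := h5 c (by omega) c2 c3 c4
            rw [not_and_or, not_not, hszi, S.sz_eq _ h3, if_neg (by omega)] at hc
            omega
    · have hvp : hv' p = hv p := by
        by_cases hc : hv (q i) ≠ 0 ∧ sz i ≤ sz (hv (q i))
        · rw [hv1 hc]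
        · rw [hv2 hc, Function.update_of_ne hpq]
      rw [hvp]
      rcases S.hv_ok p hp with h | ⟨h1, h2, h3, h4, h5⟩
      · left
        refine ⟨h.1, fun c c1 c2 c3 c4 => ?_⟩
        by_cases hci : c = i
        · subst hci; exact hpq c4.symm
        · exact h.2 c (by omega) c2 c3 c4
      · right
        refine ⟨h1, by omega, h3, h4, fun c c1 c2 c3 c4 => ?_⟩
        by_cases hci : c = i
        · subst hci; exact absurd c4.symm hpq
        · exact h5 c (by omega) c2 c3 c4
  · rw [hne j h1]
    exact hl j h1 h2

/-! ### The programs that lay out the tree -/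

namespace RAM

/-- Number the vertices, and find the numbers of their parents. -/
def numberProg : Prog :=
  .seq (.wset 2 (.const 0))
  (.seq (forUp 2 0 (.seq (.wstore 7 (.load 6 (.reg 2)) (.reg 2)) (.wstore 9 (.reg 2) (.const 1))))
  (.seq (.wset 2 (.const 1))
    (forUp 2 0 (.wstore 8 (.reg 2) (.load 7 (.load 5 (.load 6 (.reg 2))))))))

/-- Compute the sizes of the subtrees, the heavy children, and the lengths of the heavy paths. -/
def heavyProg : Prog :=
  .seq (.wset 2 (.reg 0))
  (forDown 2 (.seq
    (.ite (.weq (.load 11 (.reg 2)) (.const 0)) (.wstore 12 (.reg 2) (.const 1))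
      (.wstore 12 (.reg 2) (.add (.load 12 (.load 11 (.reg 2))) (.const 1))))
    (.ite (.weq (.reg 2) (.const 0)) .skip
      (.seq (.wset 3 (.load 8 (.reg 2)))
      (.seq (.ite (.and (.not (.weq (.load 11 (.reg 3)) (.const 0)))
          (.wle (.load 9 (.reg 2)) (.load 9 (.load 11 (.reg 3))))) .skip
        (.wstore 11 (.reg 3) (.reg 2)))
      (.wstore 9 (.reg 3) (.add (.load 9 (.reg 3)) (.load 9 (.reg 2)))))))))

/-- Compute the positions. -/
def posProg : Prog :=
  .seq (.seq (.wset 2 (.const 0)) (.wset 3 (.const 0)))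
  (forUp 2 0
    (.ite (.and (.wle (.const 1) (.reg 2)) (.weq (.load 11 (.load 8 (.reg 2))) (.reg 2)))
      (.seq (.wstore 13 (.reg 2) (.add (.load 13 (.load 8 (.reg 2))) (.const 1)))
        (.wstore 27 (.reg 2) (.load 27 (.load 8 (.reg 2)))))
      (.seq (.wstore 13 (.reg 2) (.reg 3))
      (.seq (.wstore 27 (.reg 2) (.reg 3)) (.wset 3 (.add (.reg 3) (.load 12 (.reg 2))))))))

/-- Store the layout by positions. -/
def scatterProg : Prog :=
  .seq (.wset 2 (.const 0))
  (forUp 2 0 (.seq (.wset 3 (.load 13 (.reg 2)))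
    (.seq (.wstore 14 (.reg 3) (.load 27 (.reg 2)))
    (.seq (.wstore 15 (.reg 3) (.load 13 (.load 8 (.reg 2))))
    (.wstore 16 (.load 6 (.reg 2)) (.reg 3))))))

/-- Lay out the tree. -/
def layoutProg : Prog :=
  .seq rootProg (.seq numberProg (.seq heavyProg (.seq posProg scatterProg)))

variable {W n m : ℕ} {G : WGraph n m} {T : Finset (Fin m)} {q hv len pos hd : ℕ → ℕ}

theorem Rooted.surj {qv b : ℕ → ℕ} (R : Rooted G T qv b) {v : ℕ} (hv : v < n) : ∃ i < n, qv i = v := by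
  have hinj : Function.Injective fun v : Fin n => (⟨qv v, R.lt v v.2⟩ : Fin n) := by
    intro u v h
    exact Fin.ext (R.inj u u.2 v v.2 (by simpa using h))
  obtain ⟨i, hi⟩ := (Finite.injective_iff_surjective.1 hinj) ⟨v, hv⟩
  exact ⟨i, i.2, by simpa using hi⟩

theorem numberProg_ok {s : State} (h0 : s.wreg 0 = n) (hn : 1 ≤ n) (hW : n ≤ W)
    (R : Rooted G T (s.warr 6) (s.warr 5)) :
    Ok W numberProg s (n * 50 + 20) fun s' => (∀ i < n, s'.warr 9 i = 1) ∧
      (∀ i < n, 0 < i → s'.warr 8 i < i ∧ s.warr 6 (s'.warr 8 i) = s.warr 5 (s.warr 6 i)) ∧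
      s'.warr 8 0 = s.warr 8 0 := by
  refine (Ok.seq (T := 2) (T' := n * 50 + 14) (Ok.line (by simp) ?_)).mono (by omega) fun _ => id
  simp only [wp, WExp.eval]
  refine ⟨by omega, ?_⟩
  refine (Ok.seq' (T := n * 28 + 4) (T' := n * 20 + 8) (R := fun s' => (∀ i < n, s'.warr 9 i = 1) ∧
    ∀ i < n, s'.warr 7 (s.warr 6 i) = i) ?_ ?_).mono (by omega) fun _ => id
  · refine (Ok.forUp (fun i s' => (∀ j < i, s'.warr 9 j = 1) ∧ ∀ j < i, s'.warr 7 (s.warr 6 j) = j)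
      (a := 0) (N := n) 20 (by decide) (by decide) (by decide) (by simp) (by simpa using h0)
      (by omega) hW ⟨by omega, by omega⟩ ?_).mono (by omega) fun s' h => h.1
    rintro i s' - hi ⟨h1, h2⟩ hx hF
    have f6 := hF.warr 6 (by decide)
    simp at f6
    refine Ok.line (by simp) ?_
    have := R.lt i hi
    simp [hx, f6]
    refine ⟨by omega, by omega, by omega, fun j hj => ?_, fun j hj => ?_⟩
    · by_cases h : j = i
      · subst h; simp
      · simpa [h] using h1 j (by omega)
    · by_cases h : j = i
      · subst h; simp
      · have : s.warr 6 j ≠ s.warr 6 i := fun he => h (R.inj j (by omega) i hi he)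
        rw [Function.update_of_ne this]
        exact h2 j (by omega)
  · rintro s1 ⟨h1, h2⟩ hF
    have g0 := hF.wreg 0 (by decide)
    have g6 := hF.warr 6 (by decide)
    have g5 := hF.warr 5 (by decide)
    have g8 := hF.warr 8 (by decide)
    simp at g0 g6 g5 g8
    refine (Ok.seq (T := 2) (T' := n * 20 + 4) (Ok.line (by simp) ?_)).mono (by omega) fun _ => id
    simp only [wp, WExp.eval]
    refine ⟨by omega, ?_⟩
    refine (Ok.forUp (fun i s' => (∀ j < i, 0 < j → s'.warr 8 j < j ∧
        s.warr 6 (s'.warr 8 j) = s.warr 5 (s.warr 6 j)) ∧ s'.warr 8 0 = s.warr 8 0)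
      (a := 1) (N := n) 12 (by decide) (by decide) (by decide) (by simp) (by simp [g0, h0])
      (by omega) hW ⟨by omega, by simp [g8]⟩ ?_).fr.mono (by omega) ?_
    · rintro i s' hi1 hi ⟨h3, h4⟩ hx hF'
      have f6 := hF'.warr 6 (by decide)
      have f5 := hF'.warr 5 (by decide)
      have f7 := hF'.warr 7 (by decide)
      simp [g6, g5] at f6 f5 f7
      obtain ⟨j, hj, hj'⟩ := Rooted.surj R (R.par_lt i hi hi1)
      -- The parent of a vertex occurs in no slot from that of the vertex on, so the new numbers of
      -- parents are smaller.
      have hji : j < i := by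
        by_contra h
        exact R.par_ne i j hi1 (by omega) hj hj'
      refine Ok.line (by simp) ?_
      simp only [wp, WExp.eval, hx, f6, f5, f7, ← hj', h2 j hj, setW_warr, storeW_warr, if_true]
      refine ⟨by omega, by omega, fun c hc hc0 => ?_, ?_⟩
      · by_cases h : c = i
        · subst h; rw [Function.update_self]; exact ⟨hji, hj'⟩
        · rw [Function.update_of_ne h]; exact h3 c (by omega) hc0
      · rw [Function.update_of_ne (by omega), h4]
    · rintro s' ⟨⟨⟨h3, h4⟩, -⟩, hF'⟩
      have f9 := hF'.warr 9 (by decide)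
      simp at f9
      exact ⟨by rw [f9]; exact h1, h3, h4⟩

theorem heavyProg_ok {s : State} (h0 : s.wreg 0 = n) (hW : 2 * n ≤ W)
    (hq : ∀ i < n, 0 < i → s.warr 8 i < i) (h9 : ∀ i < n, s.warr 9 i = 1)
    (h11 : ∀ i, s.warr 11 i = 0) :
    Ok W heavyProg s (n * 60 + 20) fun s' =>
      SizeInv n (s.warr 8) 0 (s'.warr 9) (s'.warr 11) (s'.warr 12) := by
  refine (Ok.seq (T := 2) (T' := n * 57 + 3) (Ok.line (by simp) ?_)).mono (by omega) fun _ => id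
  simp only [wp, WExp.eval, h0]
  refine ⟨by omega, ?_⟩
  refine (Ok.forDown (fun i s' => SizeInv n (s.warr 8) i (s'.warr 9) (s'.warr 11) (s'.warr 12))
    (N := n) 50 (by decide) (by simp) (by omega) ?_ ?_).mono le_rfl fun s' h => h.1
  · refine ⟨fun u hu => ?_, fun p hp => Or.inl ⟨by simp [h11], fun c h1 h2 => by omega⟩,
      fun j h1 h2 => by omega⟩
    rw [if_pos hu, accum_top]; simp [h9 u hu]
  · intro i s' hi S hx hF
    have f8 := hF.warr 8 (by decide)
    simp at f8
    obtain ⟨hli, hlen⟩ := S.len_step hq hi (l := if s'.warr 11 i = 0 then 1 else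
      s'.warr 12 (s'.warr 11 i) + 1) rfl
    refine (Ok.seq (T := 15) (T' := 35) (Ok.line (by simp) ?_)).mono (by omega) fun _ => id
    have key : ∀ s1 : State, s1.wreg 2 = i → s1.warr 8 = s.warr 8 → s1.warr 9 = s'.warr 9 →
        s1.warr 11 = s'.warr 11 → s1.warr 12 = Function.update (s'.warr 12) i
          (if s'.warr 11 i = 0 then 1 else s'.warr 12 (s'.warr 11 i) + 1) →
        Ok W (.ite (.weq (.reg 2) (.const 0)) .skip
          (.seq (.wset 3 (.load 8 (.reg 2)))
          (.seq (.ite (.and (.not (.weq (.load 11 (.reg 3)) (.const 0)))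
              (.wle (.load 9 (.reg 2)) (.load 9 (.load 11 (.reg 3))))) .skip
            (.wstore 11 (.reg 3) (.reg 2)))
          (.wstore 9 (.reg 3) (.add (.load 9 (.reg 3)) (.load 9 (.reg 2))))))) s1 35
          fun s' => SizeInv n (s.warr 8) i (s'.warr 9) (s'.warr 11) (s'.warr 12) := by
      intro s1 e2 e8 e9 e11 e12
      refine Ok.line (by simp) ?_
      simp only [wp, WExp.eval, Test.Holds, e2, e8, e9, e11, setW_wreg, setW_warr, storeW_warr,
        storeW_wreg]
      refine ⟨fun hi0 => ?_, fun hi0 => ?_⟩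
      · subst hi0
        rw [e12]
        refine ⟨fun u hu => ?_, fun p hp => ?_, hlen⟩
        · rw [S.sz_eq u hu]
          by_cases hu0 : u = 0
          · subst hu0; rw [if_pos (by omega), if_neg (by omega), accum_self hq _ hu]
          · rw [if_neg (by omega), if_neg (by omega)]
        · rcases S.hv_ok p hp with h | ⟨a1, a2, a3, a4, a5⟩
          · exact Or.inl ⟨h.1, fun c _ h2 h3 => h.2 c (by omega) h2 h3⟩
          · exact Or.inr ⟨a1, by omega, a3, a4, fun c _ h2 h3 => a5 c (by omega) h2 h3⟩
      · have hqi := hq i hi (by omega)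
        have hle : s'.warr 9 (s.warr 8 i) + s'.warr 9 i ≤ W := by
          have a1 := accum_le hq (i := i + 1) (show s.warr 8 i < n by omega) (by omega)
          have a2 := accum_le hq (i := i + 1) hi (by omega)
          rw [S.sz_eq _ (by omega), S.sz_eq _ hi, if_pos (by omega), if_pos (by omega)]
          omega
        norm_num [e2]
        refine ⟨by omega, fun hc1 hc2 => ?_, fun hc => ?_⟩
        · refine ⟨by omega, by omega, ?_⟩
          rw [e12]
          exact S.step hq hi (by omega) hlen (fun _ => rfl) (fun h => absurd ⟨hc1, hc2⟩ h)
        · refine ⟨by omega, by omega, by omega, by omega, ?_⟩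
          rw [e12]
          exact S.step hq hi (by omega) hlen (fun h => absurd h.2 (by have := hc h.1; omega)) (fun _ => rfl)
    simp only [wp, WExp.eval, Test.Holds, setW_wreg, setW_warr, if_true]
    refine ⟨fun hc => ⟨by omega, by omega, key _ ?_ ?_ ?_ ?_ ?_⟩,
      fun hc => ⟨by omega, by rw [if_neg hc] at hli; omega, key _ ?_ ?_ ?_ ?_ ?_⟩⟩ <;> simp [hc, f8]

/-- The state of the computation of positions: the vertices below `i` have positions below `nf`. -/
structure PosInv (n : ℕ) (q hv len : ℕ → ℕ) (i : ℕ) (pos hd : ℕ → ℕ) (nf : ℕ) : Prop where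
  zero : 0 < i → pos 0 = 0
  heavy : ∀ j < i, IsHeavy q hv j → pos j = pos (q j) + 1 ∧ hd j = hd (q j)
  light : ∀ j < i, ¬ IsHeavy q hv j → hd j = pos j ∧ ∀ j' < j, pos j' + len j' ≤ pos j
  le : ∀ j < i, pos j + len j ≤ nf
  cover : ∀ x < nf, ∃ j < i, pos j ≤ x ∧ x < pos j + len j
  nf_le : nf ≤ i * n
  hd_le : ∀ j < i, hd j ≤ pos j

/-- A light vertex opens a new block at `nf`, long enough for its whole heavy path; a heavy one
moves into the place after its parent, already reserved. The bound `nf ≤ i * n` is crude, but it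
suffices for the word size while it is not yet known that the positions stay below `n`. -/
theorem PosInv.step {i nf p h nf' : ℕ} (P : PosInv n q hv len i pos hd nf) (hi : i < n)
    (hq : ∀ i < n, 0 < i → q i < i) (hlen : ∀ i < n, 1 ≤ len i ∧ len i ≤ n)
    (hheavy : IsHeavy q hv i → len (q i) = len i + 1 ∧ p = pos (q i) + 1 ∧ h = hd (q i) ∧ nf' = nf)
    (hlight : ¬ IsHeavy q hv i → p = nf ∧ h = nf ∧ nf' = nf + len i) :
    PosInv n q hv len (i + 1) (Function.update pos i p) (Function.update hd i h) nf' := by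
  have hne : ∀ j < i, Function.update pos i p j = pos j ∧ Function.update hd i h j = hd j := by
    intro j hj
    rw [Function.update_of_ne (by omega), Function.update_of_ne (by omega)]
    exact ⟨rfl, rfl⟩
  have hs : Function.update pos i p i = p ∧ Function.update hd i h i = h := by simp
  have hnn : nf ≤ nf' := by
    by_cases hh : IsHeavy q hv i
    · have := hheavy hh; omega
    · have := hlight hh; omega
  refine ⟨fun _ => ?_, fun j hj hh => ?_, fun j hj hh => ?_, fun j hj => ?_, fun x hx => ?_, ?_,
    fun j hj => ?_⟩
  · rcases Nat.eq_zero_or_pos i with rfl | h0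
    · have h1 := hlight (fun h => by have := h.1; omega)
      have := P.nf_le
      rw [hs.1]; omega
    · rw [(hne 0 h0).1, P.zero h0]
  · have hqj := hq j (by omega) hh.1
    rcases Nat.eq_or_lt_of_le (show j ≤ i by omega) with rfl | h1
    · obtain ⟨a1, a2, a3, a4⟩ := hheavy hh
      rw [hs.1, hs.2, (hne _ hqj).1, (hne _ hqj).2]
      exact ⟨a2, a3⟩
    · rw [(hne j h1).1, (hne j h1).2, (hne (q j) (by omega)).1, (hne (q j) (by omega)).2]
      exact P.heavy j h1 hh
  · rcases Nat.eq_or_lt_of_le (show j ≤ i by omega) with rfl | h1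
    · obtain ⟨a1, a2, a3⟩ := hlight hh
      rw [hs.1, hs.2]
      refine ⟨by omega, fun j' hj' => ?_⟩
      rw [(hne j' hj').1, a1]
      exact P.le j' hj'
    · rw [(hne j h1).1, (hne j h1).2]
      refine ⟨(P.light j h1 hh).1, fun j' hj' => ?_⟩
      rw [(hne j' (by omega)).1]
      exact (P.light j h1 hh).2 j' hj'
  · rcases Nat.eq_or_lt_of_le (show j ≤ i by omega) with rfl | h1
    · rw [hs.1]
      by_cases hh : IsHeavy q hv j
      · obtain ⟨a1, a2, a3, a4⟩ := hheavy hh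
        have := P.le (q j) (hq j hi hh.1)
        omega
      · have := hlight hh; omega
    · rw [(hne j h1).1]
      exact (P.le j h1).trans hnn
  · by_cases hxn : x < nf
    · obtain ⟨j, h1, h2⟩ := P.cover x hxn
      exact ⟨j, by omega, by rw [(hne j h1).1]; exact h2⟩
    · by_cases hh : IsHeavy q hv i
      · have := hheavy hh; omega
      · have := hlight hh
        exact ⟨i, by omega, by rw [hs.1]; omega⟩
  · have h1 := P.nf_le
    have h2 := hlen i hi
    rw [add_mul, one_mul]
    by_cases hh : IsHeavy q hv i
    · have := hheavy hh; omega
    · have := hlight hh; omega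
  · rcases Nat.eq_or_lt_of_le (show j ≤ i by omega) with rfl | h1
    · rw [hs.1, hs.2]
      by_cases hh : IsHeavy q hv j
      · have := hheavy hh
        have := P.hd_le (q j) (hq j hi hh.1)
        omega
      · have := hlight hh; omega
    · rw [(hne j h1).1, (hne j h1).2]
      exact P.hd_le j h1

theorem posProg_ok {s : State} (h0 : s.wreg 0 = n) (hW : n * n + n + 1 ≤ W)
    (hq : ∀ i < n, 0 < i → s.warr 8 i < i)
    (hlen : ∀ i < n, 1 ≤ s.warr 12 i ∧ s.warr 12 i ≤ n)
    (hheavy : ∀ i < n, IsHeavy (s.warr 8) (s.warr 11) i → s.warr 12 (s.warr 8 i) = s.warr 12 i + 1) :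
    Ok W posProg s (n * 50 + 20) fun s' => ∃ nf,
      PosInv n (s.warr 8) (s.warr 11) (s.warr 12) n (s'.warr 13) (s'.warr 27) nf := by
  refine (Ok.seq (T := 6) (T' := n * 50 + 4) (Ok.line (by simp) ?_)).mono (by omega) fun _ => id
  simp only [wp, WExp.eval]
  refine ⟨by omega, by omega, ?_⟩
  refine (Ok.forUp (fun i s' => PosInv n (s.warr 8) (s.warr 11) (s.warr 12) i (s'.warr 13)
      (s'.warr 27) (s'.wreg 3)) (a := 0) (N := n) 40 (by decide) (by decide) (by decide) (by simp)
      (by simpa using h0) (by omega) (by omega) ?_ ?_).mono (by omega) fun s' h => ⟨_, h.1⟩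
  · refine ⟨by omega, by omega, by omega, by omega, ?_, by simp, by omega⟩
    intro x hx
    simp at hx
  · rintro i s' - hi P hx hF
    have f8 := hF.warr 8 (by decide)
    have f11 := hF.warr 11 (by decide)
    have f12 := hF.warr 12 (by decide)
    simp at f8 f11 f12
    have hn1 := P.nf_le
    have hn2 : i * n ≤ n * n := Nat.mul_le_mul_right _ hi.le
    have hn3 : (i + 1) * n ≤ n * n := Nat.mul_le_mul_right _ hi
    rw [add_mul, one_mul] at hn3
    have hl := hlen i hi
    refine Ok.line (by simp) ?_
    simp only [wp, WExp.eval, Test.Holds, hx, f8, f11, f12, setW_warr, storeW_warr, storeW_wreg]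
    refine ⟨fun hc => ?_, fun hc => ?_⟩
    · have hh : IsHeavy (s.warr 8) (s.warr 11) i := ⟨hc.1, hc.2⟩
      have hqi := hq i hi hh.1
      have h1 := P.le _ hqi
      have h2 := P.hd_le _ hqi
      norm_num [f8, hx, f12]
      iterate 4 refine ⟨by omega, ?_⟩
      exact P.step hi hq hlen (fun _ => ⟨hheavy i hi hh, rfl, rfl, rfl⟩) (fun h => absurd hh h)
    · have hh : ¬ IsHeavy (s.warr 8) (s.warr 11) i := fun h => hc ⟨h.1, h.2⟩
      norm_num [f8, hx, f12]
      iterate 5 refine ⟨by omega, ?_⟩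
      exact P.step hi hq hlen (fun h => absurd h hh) (fun h => ⟨rfl, rfl, rfl⟩)

theorem scatterProg_ok {s : State} (h0 : s.wreg 0 = n) (hW : n ≤ W)
    (h6 : ∀ i < n, s.warr 6 i < n) (h6' : ∀ i < n, ∀ j < n, s.warr 6 i = s.warr 6 j → i = j)
    (h13 : ∀ i < n, s.warr 13 i < n) (h13' : ∀ i < n, ∀ j < n, s.warr 13 i = s.warr 13 j → i = j)
    (h27 : ∀ i < n, s.warr 27 i ≤ s.warr 13 i) (h8 : ∀ i < n, s.warr 8 i < n) :
    Ok W scatterProg s (n * 40 + 20) fun s' => ∀ i < n, s'.warr 14 (s.warr 13 i) = s.warr 27 i ∧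
      s'.warr 15 (s.warr 13 i) = s.warr 13 (s.warr 8 i) ∧ s'.warr 16 (s.warr 6 i) = s.warr 13 i := by
  refine (Ok.seq (T := 2) (T' := n * 40 + 4) (Ok.line (by simp) ?_)).mono (by omega) fun _ => id
  simp only [wp, WExp.eval]
  refine ⟨by omega, ?_⟩
  refine (Ok.forUp (fun i s' => ∀ j < i, s'.warr 14 (s.warr 13 j) = s.warr 27 j ∧
      s'.warr 15 (s.warr 13 j) = s.warr 13 (s.warr 8 j) ∧ s'.warr 16 (s.warr 6 j) = s.warr 13 j)
      (a := 0) (N := n) 30 (by decide) (by decide) (by decide) (by simp)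
      (by simpa using h0) (by omega) (by omega) (by omega) ?_).mono (by omega) fun s' h => h.1
  rintro i s' - hi h hx hF
  have f8 := hF.warr 8 (by decide)
  have f6 := hF.warr 6 (by decide)
  have f13 := hF.warr 13 (by decide)
  have f27 := hF.warr 27 (by decide)
  simp at f8 f6 f13 f27
  have a1 := h6 i hi
  have a2 := h13 i hi
  have a3 := h27 i hi
  have a4 := h13 _ (h8 i hi)
  refine Ok.line (by simp) ?_
  simp only [wp, WExp.eval, hx, f8, f6, f13, f27, setW_warr, storeW_warr, storeW_wreg, setW_wreg]
  norm_num [hx, f13, f6, f8]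
  iterate 6 refine ⟨by omega, ?_⟩
  intro j hj
  by_cases hji : j = i
  · subst hji; simp
  · have b1 : s.warr 13 j ≠ s.warr 13 i := fun he => hji (h13' j (by omega) i hi he)
    have b2 : s.warr 6 j ≠ s.warr 6 i := fun he => hji (h6' j (by omega) i hi he)
    rw [Function.update_of_ne b1, Function.update_of_ne b1, Function.update_of_ne b2]
    exact h j (by omega)

theorem SizeInv.heavyPaths {sz : ℕ → ℕ} {nf : ℕ} (hn : 0 < n) (hq : ∀ i < n, 0 < i → q i < i)
    (S : SizeInv n q 0 sz hv len) (P : PosInv n q hv len n pos hd nf) :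
    HeavyPaths n q hv len pos hd := by
  refine ⟨hq, fun p hp h => ?_, fun p hp => (S.len_eq p (by omega) hp).1, P.heavy, P.light,
    P.zero hn, ⟨nf, P.le, P.cover⟩, subSum q n (fun _ => 1), subSum_one_le hq hn,
    fun i hi => subSum_one_pos hq hi, fun i hi hi0 => ?_⟩
  · rcases S.hv_ok p hp with h' | h'
    · exact absurd h'.1 h
    · exact ⟨h'.2.2.1, h'.2.2.2.1⟩
  · have hqi := hq i hi hi0
    rcases S.hv_ok (q i) (by omega) with h' | ⟨h1, -, h3, h4, h5⟩
    · exact absurd rfl (h'.2 i (by omega) hi hi0)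
    · have h6 := h5 i (by omega) hi hi0 rfl
      constructor
      · rw [← accum_self hq _ (show q i < n by omega)]
        unfold accum
        have := Finset.single_le_sum (f := fun c => if q c = q i then subSum q n (fun _ => 1) c else 0)
          (fun _ _ => Nat.zero_le _) (Finset.mem_Ico.2 ⟨hqi, hi⟩)
        simp only [if_true] at this
        exact this.trans (Nat.le_add_left _ _)
      · intro hh
        have hne : i ≠ hv (q i) := fun h => hh ⟨hi0, h.symm⟩
        have := subSum_add_le hq hi h3 hi0 h1 h4.symm hne
        omega

theorem layoutProg_ok {s : State} (hT : G.IsSpanningTree T) (hn1 : 1 ≤ n) (hn : s.wreg 0 = n)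
    (hm : s.wreg 1 = m)
    (h0 : ∀ e : Fin m, s.warr 0 e = G.src e) (h1 : ∀ e : Fin m, s.warr 1 e = G.dst e)
    (h2 : ∀ e : Fin m, s.warr 2 e = if e ∈ T then 1 else 0)
    (hz : ∀ a u, 3 ≤ a → s.warr a u = 0) (hW : m * (2 * n) + n * n + 2 * n + m + 2 ≤ W) :
    Ok W layoutProg s (m * 60 + n * 300 + 200) fun s' =>
      ∃ ld, Layout n (s'.warr 15) (s'.warr 14) ld ∧ (∀ i < n, ld i ≤ Nat.log 2 n) ∧
        G.TreePos T (s'.warr 16) (s'.warr 15) := by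
  refine (Ok.seq' (T := m * 60 + n * 100 + 50) (T' := n * 200 + 120)
    (rootProg_ok hT hn1 hn hm h0 h1 h2 (fun u => hz 4 u (by omega)) (fun u => hz 5 u (by omega))
      (fun u => hz 6 u (by omega)) (by omega)) ?_).mono (by omega) fun _ => id
  intro s1 R hF1
  have a8 := hF1.warr 8 (by decide)
  have a11 := hF1.warr 11 (by decide)
  have a0 := hF1.wreg 0 (by decide)
  refine (Ok.seq' (T := n * 50 + 20) (T' := n * 150 + 80)
    (numberProg_ok (by rw [a0, hn]) hn1 (by omega) R) ?_).mono (by omega) fun _ => id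
  rintro s2 ⟨n9, n8, n80⟩ hF2
  have b11 := hF2.warr 11 (by decide)
  have b0 := hF2.wreg 0 (by decide)
  have b6 := hF2.warr 6 (by decide)
  rw [a8, hz 8 0 (by omega)] at n80
  have hq : ∀ i < n, 0 < i → s2.warr 8 i < i := fun i hi h => (n8 i hi h).1
  refine (Ok.seq' (T := n * 60 + 20) (T' := n * 90 + 60)
    (heavyProg_ok (by rw [b0, a0, hn]) (by omega) hq n9
      (fun i => by rw [b11, a11, hz 11 i (by omega)])) ?_).mono (by omega) fun _ => id
  rintro s3 S hF3
  have c8 := hF3.warr 8 (by decide)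
  have c6 := hF3.warr 6 (by decide)
  have c0 := hF3.wreg 0 (by decide)
  have hlen : ∀ i < n, 1 ≤ s3.warr 12 i ∧ s3.warr 12 i ≤ n := by
    intro i hi
    have := S.len_eq i (by omega) hi
    refine ⟨?_, by omega⟩
    rw [this.1]; split_ifs <;> omega
  refine (Ok.seq' (T := n * 50 + 20) (T' := n * 40 + 20)
    (posProg_ok (by rw [c0, b0, a0, hn]) (by omega) (by rw [c8]; exact hq) hlen ?_) ?_).mono
    (by omega) fun _ => id
  · intro i hi hh
    rw [c8] at hh ⊢
    have := hq i hi hh.1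
    have h0 := hh.1
    rw [(S.len_eq _ (by omega) (by omega : s2.warr 8 i < n)).1, hh.2, if_neg (by omega)]
  rintro s4 ⟨nf, P⟩ hF4
  have d8 := hF4.warr 8 (by decide)
  have d6 := hF4.warr 6 (by decide)
  have d0 := hF4.wreg 0 (by decide)
  rw [c8] at P d8
  rw [c6, b6] at d6
  have H := SizeInv.heavyPaths hn1 hq S P
  refine (scatterProg_ok (n := n) (by rw [d0, c0, b0, a0, hn]) (by omega) (by rw [d6]; exact R.lt)
    (by rw [d6]; exact R.inj) (fun i hi => H.pos_lt hi) H.inj P.hd_le ?_).mono (by omega) ?_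
  · intro i hi
    rw [d8]
    rcases Nat.eq_zero_or_pos i with rfl | h0
    · omega
    · have := hq i hi h0; omega
  rintro s5 h5
  rw [d8, d6] at h5
  obtain ⟨ld, L, hld⟩ := H.layout (par := s5.warr 15) (head := s5.warr 14) hn1
    (fun i hi _ => (h5 i hi).2.1) (fun i hi => (h5 i hi).1)
  refine ⟨ld, L, hld, fun v hv => ?_, fun u hu v hv h => ?_, L.par_lt, fun x hx hx0 => ?_⟩
  · obtain ⟨i, hi, rfl⟩ := Rooted.surj R hv
    rw [(h5 i hi).2.2]; exact H.pos_lt hi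
  · obtain ⟨i, hi, rfl⟩ := Rooted.surj R hu
    obtain ⟨j, hj, rfl⟩ := Rooted.surj R hv
    rw [(h5 i hi).2.2, (h5 j hj).2.2] at h
    rw [H.inj i hi j hj h]
  · have hinj : Function.Injective fun v : Fin n => (⟨s4.warr 13 v, H.pos_lt v.2⟩ : Fin n) := by
      intro u v h
      exact Fin.ext (H.inj u u.2 v v.2 (by simpa using h))
    obtain ⟨⟨i, hi⟩, hi'⟩ := (Finite.injective_iff_surjective.1 hinj) ⟨x, hx⟩
    simp only [Fin.mk.injEq] at hi'
    have hi0 : 0 < i := by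
      by_contra h
      obtain rfl : i = 0 := by omega
      rw [H.zero] at hi'; omega
    obtain ⟨e, he, hs⟩ := R.edge i hi hi0
    refine ⟨e, he, ?_⟩
    have hqi := n8 i hi hi0
    have := congrArg (Sym2.map (s5.warr 16)) hs
    simp only [Sym2.map_mk] at this
    rw [this, ← hi', (h5 i hi).2.1, (h5 i hi).2.2, ← hqi.2, (h5 _ (by omega)).2.2]

end RAM

/-! ## The output, and the whole program -/

open Classical in
-- Between a vertex and its parent the property of being below exactly one of `v` and `w` changes
-- only at `v` and at `w`. The side can therefore be marked in one pass, parents first.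
theorem not_anc_iff_step {par : ℕ → ℕ} {n v w i : ℕ} (hp : ∀ i < n, 0 < i → par i < i) (hi : i < n)
    (h0 : 0 < i) (hvw : v ≠ w) (b : ℕ) (hb : b = if Anc par v (par i) ↔ Anc par w (par i) then 0 else 1) :
    (if Anc par v i ↔ Anc par w i then 0 else 1) = if i = v ∨ i = w then 1 - b else b := by
  have hni := not_anc_par hp hi h0
  by_cases hv : i = v
  · subst hv
    have h1 := anc_iff_par (par := par) (v := w) h0 hvw.symm
    by_cases h2 : Anc par w (par i) <;> simp [hb, hni, h1, h2, Anc.refl]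
  · by_cases hw : i = w
    · subst hw
      have h1 := anc_iff_par (par := par) (v := v) h0 hvw
      by_cases h2 : Anc par v (par i) <;> simp [hb, hni, h1, h2, Anc.refl]
    · rw [if_neg (show ¬ (i = v ∨ i = w) from not_or.2 ⟨hv, hw⟩), hb, anc_iff_par h0 (Ne.symm hv), anc_iff_par h0 (Ne.symm hw)]

namespace RAM

variable {W n : ℕ} {par : ℕ → ℕ}

/-- Mark the positions below exactly one of the two best positions. -/
def markProg : Prog :=
  .seq (.wset 2 (.const 0)) (forUp 2 0
    (.seq (.ite (.weq (.reg 2) (.const 0)) (.wset 3 (.const 0)) (.wset 3 (.load 26 (.load 15 (.reg 2)))))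
    (.seq (.ite (.and (.not (.weq (.reg 2) (.reg 30))) (.not (.weq (.reg 2) (.reg 31)))) .skip
      (.wset 3 (.sub (.const 1) (.reg 3))))
    (.wstore 26 (.reg 2) (.reg 3)))))

open Classical in
theorem markProg_ok {s : State} {v w : ℕ} (hn : s.wreg 0 = n) (hW : n + 1 ≤ W)
    (hp : ∀ i < n, 0 < i → par i < i) (h15 : ∀ i < n, s.warr 15 i = par i)
    (h30 : s.wreg 30 = v) (h31 : s.wreg 31 = w) (hwv : w < v) :
    Ok W markProg s (n * 50 + 10) fun s' =>
      ∀ i < n, s'.warr 26 i = if Anc par v i ↔ Anc par w i then 0 else 1 := by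
  refine (Ok.seq (T := 2) (T' := n * 48 + 4) (Ok.line (by simp) ?_)).mono (by omega) fun _ => id
  simp only [wp, WExp.eval]
  refine ⟨by omega, ?_⟩
  refine (Ok.forUp (fun i s' => ∀ j < i, s'.warr 26 j = if Anc par v j ↔ Anc par w j then 0 else 1)
    (a := 0) (N := n) 40 (by decide) (by decide) (by decide) (by simp) (by simp [hn])
    (by omega) (by omega) (by simp) ?_).mono (by omega) fun s' h => h.1
  rintro i s' - hi hI hx hF
  have f15 := hF.warr 15 (by decide)
  have g30 := hF.wreg 30 (by decide)
  have g31 := hF.wreg 31 (by decide)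
  simp [h30, h31] at f15 g30 g31
  have key : ∀ b : ℕ, b ≤ 1 → (if Anc par v i ↔ Anc par w i then 0 else 1) = b →
      ∀ j < i + 1, Function.update (s'.warr 26) i b j =
        if Anc par v j ↔ Anc par w j then 0 else 1 := by
    intro b _ hb j hj
    by_cases h : j = i
    · subst h; simp [hb]
    · rw [Function.update_of_ne h]; exact hI j (by omega)
  -- `b` is the mark of the parent; above the root it is taken to be 0, which is right because with
  -- `w = 0` the root is below `w` but not below `v`.
  obtain ⟨b, hb1, hb0, hbp, hb⟩ : ∃ b ≤ 1, (i = 0 → b = 0) ∧ (i ≠ 0 → s'.warr 26 (par i) = b) ∧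
      (if Anc par v i ↔ Anc par w i then 0 else 1) = if i = v ∨ i = w then 1 - b else b := by
    rcases Nat.eq_zero_or_pos i with h0 | h0
    · have hv : ¬ Anc par v 0 := by rw [anc_iff]; simp; omega
      have hw : Anc par w 0 ↔ 0 = w := by rw [anc_iff]; simp [eq_comm]
      refine ⟨0, by omega, fun _ => rfl, fun h => absurd h0 h, ?_⟩
      by_cases hw0 : 0 = w <;> simp only [h0, hv, hw, hw0, show ¬ 0 = v by omega] <;> simp [hv, hw, hw0]
      simp [← hw0, Anc.refl]; omega
    · have hb' := hI _ (hp i hi h0)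
      refine ⟨_, ?_, fun h => by omega, fun _ => rfl,
        not_anc_iff_step hp hi h0 (by omega : v ≠ w) _ hb'⟩
      rw [hb']; split_ifs <;> omega
  have h15i := h15 i hi
  refine Ok.line (by simp) ?_
  have hs : ∀ s1 : State, s1.wreg = Function.update s'.wreg 3 b → s1.warr = s'.warr →
      wp W (.seq (.ite (.and (.not (.weq (.reg 2) (.reg 30))) (.not (.weq (.reg 2) (.reg 31)))) .skip
        (.wset 3 (.sub (.const 1) (.reg 3)))) (.wstore 26 (.reg 2) (.reg 3)))
        (fun s' => ∀ j < i + 1, (s'.setW 2 (i + 1)).warr 26 j =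
          if Anc par v j ↔ Anc par w j then 0 else 1) s1 := by
    intro s1 e1 e2
    have k2 : s1.wreg 2 = i := by rw [e1]; simpa using hx
    have k3 : s1.wreg 3 = b := by rw [e1]; simp
    have k30 : s1.wreg 30 = v := by rw [e1]; simpa using g30
    have k31 : s1.wreg 31 = w := by rw [e1]; simpa using g31
    simp only [wp, WExp.eval, Test.Holds, k2, k3, k30, k31, setW_wreg, setW_warr, storeW_warr, e2]
    refine ⟨fun h => ⟨by omega, by omega, ?_⟩, fun h => ⟨by omega, by simp; omega, by simp; omega, ?_⟩⟩
    · have := key b hb1 (by rw [hb, if_neg (not_or.2 h)])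
      simpa using this
    · have := key (1 - b) (by omega) (by rw [hb, if_pos (by omega)])
      simpa using this
  rw [wp, wp]
  refine ⟨fun h => ⟨by simp, hs _ ?_ rfl⟩, fun h => ⟨?_, hs _ ?_ rfl⟩⟩
  · simp only [Test.Holds, WExp.eval, hx] at h
    simp [State.setW, hb0 h]
  · simp only [Test.Holds, WExp.eval, hx] at h
    simp [hx, f15, h15i, hbp h]; omega
  · simp only [Test.Holds, WExp.eval, hx] at h
    simp [State.setW, hx, f15, h15i, hbp h]

/-- Write the indicator of the marked vertices. -/
def writeProg : Prog :=
  .seq (.wset 2 (.const 0)) (.seq (forUp 2 0 (.wstore 3 (.reg 2) (.load 26 (.load 16 (.reg 2)))))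
    (.rset 0 (.reg 5)))

theorem writeProg_ok {s : State} (hn : s.wreg 0 = n) (hW : n + 1 ≤ W)
    (h16 : ∀ i < n, s.warr 16 i < n) (h26 : ∀ i < n, s.warr 26 i ≤ 1) :
    Ok W writeProg s (n * 20 + 10) fun s' =>
      (∀ i < n, s'.warr 3 i = s.warr 26 (s.warr 16 i)) ∧ s'.rreg 0 = s.rreg 5 := by
  refine (Ok.seq (T := 2) (T' := n * 20 + 8) (Ok.line (by simp) ?_)).mono (by omega) fun _ => id
  simp only [wp, WExp.eval]
  refine ⟨by omega, ?_⟩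
  refine (Ok.seq' (T := n * 20 + 4) (T' := 2)
    ((Ok.forUp (fun i s' => ∀ j < i, s'.warr 3 j = s.warr 26 (s.warr 16 j))
    (a := 0) (N := n) 12 (by decide) (by decide) (by decide) (by simp) (by simp [hn])
    (by omega) (by omega) (by simp) ?_).mono (by omega) fun s' h => h.1) ?_).mono (by omega)
      fun _ => id
  · rintro i s' - hi hI hx hF
    have f16 := hF.warr 16 (by decide)
    have f26 := hF.warr 26 (by decide)
    simp at f16 f26
    have := h26 _ (h16 i hi)
    refine Ok.line (by simp) ?_
    simp only [wp, WExp.eval, hx, f16, f26]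
    refine ⟨by omega, by omega, fun j hj => ?_⟩
    by_cases h : j = i
    · subst h; simp
    · simpa [h] using hI j (by omega)
  · intro s' h hF
    have := hF.rreg 5 (by decide)
    refine Ok.line (by simp) ?_
    simp only [wp, RExp.eval]
    exact ⟨h, by simpa using this⟩

end RAM

/-! ### Word size, running time and correctness of the whole program -/

namespace RAM

variable {n m : ℕ}

/-- The whole program. -/
def minCutProg : Prog :=
  .seq layoutProg (.seq edgesProg (.seq sumProg (.seq build (.seq contribsProg
    (.seq mainLoop (.seq markProg writeProg))))))

/-- The large words are the sums of neighbours, at most `2 * n` per edge, the ends of blocks before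
they are known to be below `n`, and the numbers of nodes, of which the edges create at most `18 * k
* k` each. With `k ≤ n` all this is at most cubic, and `3 ≤ n + m` supplies the factor 27. -/
theorem word_bound {n m k : ℕ} (hn : 2 ≤ n) (hm : 1 ≤ m) (hk : 2 ^ k ≤ 2 * n) (hkn : k ≤ n) :
    m * (2 * n) + n * n + 2 * n + m + 2 ≤ (n + m) ^ 6 ∧ 5 * n ≤ (n + m) ^ 6 ∧
      2 * 2 ^ k + n + m * (18 * k * k) ≤ (n + m) ^ 6 := by
  have h1 : (n + m) ^ 2 * 27 ≤ (n + m) ^ 6 := by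
    calc (n + m) ^ 2 * 27 ≤ (n + m) ^ 2 * (n + m) ^ 3 := by
          gcongr
          calc 27 = 3 ^ 3 := rfl
            _ ≤ _ := by gcongr; omega
      _ = (n + m) ^ 5 := by ring
      _ ≤ _ := Nat.pow_le_pow_right (by omega) (by omega)
  have h2 : (n + m) ^ 3 * 27 ≤ (n + m) ^ 6 := by
    calc (n + m) ^ 3 * 27 ≤ (n + m) ^ 3 * (n + m) ^ 3 := by
          gcongr
          calc 27 = 3 ^ 3 := rfl
            _ ≤ _ := by gcongr; omega
      _ = _ := by ring
  have h3 : (n + m) ^ 2 = n * n + 2 * (m * n) + m * m := by ring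
  have h4 : m * (2 * n) = 2 * (m * n) := by ring
  have h5 : 2 * n ≤ n * n := Nat.mul_le_mul_right _ hn
  have h6 : m ≤ m * m := Nat.le_mul_self m
  have h7 : m * (18 * k * k) ≤ 18 * (n + m) ^ 3 := by
    calc m * (18 * k * k) ≤ (n + m) * (18 * (n + m) * (n + m)) := by gcongr <;> omega
      _ = _ := by ring
  have h8 : n + m ≤ (n + m) ^ 3 := Nat.le_self_pow (by omega) _
  refine ⟨by omega, by omega, by omega⟩

/-- The leading terms come from the edges: nine additions over at most `L + 1` heavy paths, of order
`L + 1` each, and 200 operations for each of the `Φ` nodes owned before the merges. Everything else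
is absorbed by `n ≤ 2 * m` and `1 ≤ L`. -/
theorem time_bound {n m L Φ : ℕ} (hL : 1 ≤ L) (hm : 1 ≤ m) (hn : n ≤ 2 * m)
    (hΦ : Φ ≤ n + m * (18 * (L + 1) * (L + 1))) :
    (m * 60 + n * 300 + 200) + ((m * (40 * L + 110) + 10) + ((n * 40 + 10) + ((500 * n + 100) +
      ((m * (9 * ((L + 1) * (320 * (L + 1) + 120) + 20) + 50) + 10) +
      ((n * (100 * (L + 1) + 110) + 200 * Φ + 10) + ((n * 50 + 10) + (n * 20 + 10)))))))
      ≤ 50000 * (m * (L * L)) := by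
  have h1 : L ≤ L * L := Nat.le_mul_self L
  have h2 : m * L ≤ m * (L * L) := Nat.mul_le_mul_left _ h1
  have h3 : m ≤ m * L := Nat.le_mul_of_pos_right _ hL
  have h4 : n * L ≤ 2 * (m * L) := by
    rw [← mul_assoc]; exact Nat.mul_le_mul_right _ hn
  have e1 : m * (18 * (L + 1) * (L + 1)) = 18 * (m * (L * L)) + 36 * (m * L) + 18 * m := by ring
  have e2 : m * (40 * L + 110) = 40 * (m * L) + 110 * m := by ring
  have e3 : m * (9 * ((L + 1) * (320 * (L + 1) + 120) + 20) + 50) =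
    2880 * (m * (L * L)) + 6840 * (m * L) + 4190 * m := by ring
  have e4 : n * (100 * (L + 1) + 110) = 100 * (n * L) + 210 * n := by ring
  omega

/-- Since ln 2 exceeds 1/2, the binary logarithm is at most twice the natural one; squaring costs
the factor 4 between the two constants. -/
theorem log_bound {n m t : ℕ} (h : t ≤ 50000 * (m * (Nat.log 2 n * Nat.log 2 n))) (hn : 2 ≤ n) :
    (t : ℝ) ≤ 200000 * m * (Real.log n) ^ 2 := by
  have h1 : (Nat.log 2 n : ℝ) / 2 ≤ Real.log n := by
    have h2 : Real.log ((2 : ℝ) ^ Nat.log 2 n) ≤ Real.log n := by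
      apply Real.log_le_log (by positivity)
      exact_mod_cast Nat.pow_log_le_self 2 (by omega)
    rw [Real.log_pow] at h2
    have := Real.log_two_gt_d9
    have h4 : (0 : ℝ) ≤ Nat.log 2 n := by positivity
    nlinarith
  have h2 : ((Nat.log 2 n : ℝ) / 2) ^ 2 ≤ Real.log n ^ 2 := by gcongr
  have h3 : (t : ℝ) ≤ 50000 * (m * (Nat.log 2 n * Nat.log 2 n)) := by exact_mod_cast h
  calc (t : ℝ) ≤ 200000 * m * ((Nat.log 2 n : ℝ) / 2) ^ 2 := by rw [div_pow]; linarith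
    _ ≤ _ := by gcongr

open WGraph in
theorem minCutProg_ok (hn2 : 2 ≤ n) (G : WGraph n m) {T : Finset (Fin m)}
    (hT : G.IsSpanningTree T) :
    ∃ (s : State) (t : ℕ) (S : Finset (Fin n)), Exec ((n + m) ^ 6) minCutProg (input G T) s t ∧
      t ≤ 50000 * (m * (Nat.log 2 n * Nat.log 2 n)) ∧ G.IsMinRespectingCut 2 T S ∧
      Outputs G s S := by
  classical
  have hnm : n ≤ m + 1 := by
    have h1 := hT.card
    have h2 : T.card ≤ m := by simpa using T.card_le_univ
    omega
  obtain ⟨L, hL⟩ : ∃ L, L = Nat.log 2 n := ⟨_, rfl⟩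
  have hL1 : 1 ≤ L := by rw [hL]; exact Nat.log_pos (by omega) hn2
  obtain ⟨k, hk⟩ : ∃ k, k = L + 1 := ⟨_, rfl⟩
  have hk2 : 2 ^ k ≤ 2 * n := by
    rw [hk, hL, pow_succ]; have := Nat.pow_log_le_self 2 (x := n) (by omega); omega
  have hnk : n < 2 ^ k := by rw [hk, hL]; exact Nat.lt_pow_succ_log_self (by omega) n
  have hkn : k ≤ n := by
    have : L < n := by rw [hL]; exact Nat.log_lt_self 2 (by omega)
    omega
  obtain ⟨w1, w2, w3⟩ := word_bound hn2 (m := m) (by omega) hk2 hkn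
  obtain ⟨W, hW⟩ : ∃ W, W = (n + m) ^ 6 := ⟨_, rfl⟩
  rw [← hW] at w1 w2 w3 ⊢
  obtain ⟨s0, hs0⟩ : ∃ s0, s0 = input G T := ⟨_, rfl⟩
  have i0 : s0.wreg 0 = n := by simp [hs0, input]
  have i1 : s0.wreg 1 = m := by simp [hs0, input]
  have i30 : s0.wreg 30 = 0 := by simp [hs0, input]
  have ia0 : ∀ e : Fin m, s0.warr 0 e = G.src e := by simp [hs0, input]
  have ia1 : ∀ e : Fin m, s0.warr 1 e = G.dst e := by simp [hs0, input]
  have ia2 : ∀ e : Fin m, s0.warr 2 e = if e ∈ T then 1 else 0 := by simp [hs0, input]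
  have ir0 : ∀ e : Fin m, s0.rarr 0 e = G.wt e := by simp [hs0, input]
  have ir1 : ∀ u, s0.rarr 1 u = 0 := by simp [hs0, input]
  have iz : ∀ a u, 3 ≤ a → s0.warr a u = 0 := by
    intro a u ha
    simp [hs0, input, show a ≠ 0 by omega, show a ≠ 1 by omega, show a ≠ 2 by omega]
  rw [← hs0]
  obtain ⟨s1, t1, x1, b1, ⟨ld, Ly, hB, hP⟩, F1⟩ :=
    (layoutProg_ok hT (by omega) i0 i1 ia0 ia1 ia2 iz w1).fr
  obtain ⟨par, hpar⟩ : ∃ par, par = s1.warr 15 := ⟨_, rfl⟩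
  obtain ⟨head, hhead⟩ : ∃ head, head = s1.warr 14 := ⟨_, rfl⟩
  obtain ⟨pos, hpos⟩ : ∃ pos, pos = s1.warr 16 := ⟨_, rfl⟩
  rw [← hpar, ← hhead] at Ly
  rw [← hL] at hB
  rw [← hpar, ← hpos] at hP
  obtain ⟨X, hX⟩ : ∃ X : ℕ → ℕ, ∀ e, X e = pos (s0.warr 0 e) := ⟨_, fun _ => rfl⟩
  obtain ⟨Y, hY⟩ : ∃ Y : ℕ → ℕ, ∀ e, Y e = pos (s0.warr 1 e) := ⟨_, fun _ => rfl⟩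
  have hXn : ∀ e < m, X e < n := by
    intro e he; rw [hX]; apply hP.pos_lt; rw [ia0 ⟨e, he⟩]; exact Fin.is_lt _
  have hYn : ∀ e < m, Y e < n := by
    intro e he; rw [hY]; apply hP.pos_lt; rw [ia1 ⟨e, he⟩]; exact Fin.is_lt _
  obtain ⟨Lc, hLc⟩ : ∃ Lc : ℕ → ℕ, ∀ e < m, Lc e < n ∧
      ∀ w, Anc par w (Lc e) ↔ (Anc par w (X e) ∧ Anc par w (Y e)) := by
    have : ∀ e, ∃ l, e < m → l < n ∧ ∀ w, Anc par w l ↔ (Anc par w (X e) ∧ Anc par w (Y e)) := by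
      intro e
      by_cases he : e < m
      · obtain ⟨l, h⟩ := Ly.exists_lca (hXn e he) (hYn e he)
        exact ⟨l, fun _ => h⟩
      · exact ⟨0, fun h => absurd h he⟩
    exact ⟨fun e => (this e).choose, fun e => (this e).choose_spec⟩
  have f1 : s1.wreg 0 = n ∧ s1.wreg 1 = m ∧ s1.wreg 30 = 0 ∧ s1.warr 0 = s0.warr 0 ∧
      s1.warr 1 = s0.warr 1 ∧ s1.warr 22 = s0.warr 22 ∧ s1.rarr 0 = s0.rarr 0 ∧
      s1.rarr 1 = s0.rarr 1 :=
    ⟨by rw [F1.wreg 0 (by decide), i0], by rw [F1.wreg 1 (by decide), i1],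
      by rw [F1.wreg 30 (by decide), i30], F1.warr 0 (by decide), F1.warr 1 (by decide),
      F1.warr 22 (by decide), F1.rarr 0 (by decide), F1.rarr 1 (by decide)⟩
  obtain ⟨s2, t2, x2, b2, ⟨hE, hV⟩, F2⟩ := (edgesProg_ok (W := W) Ly hB f1.2.1
    (fun i _ => by rw [hhead]) (fun i _ => by rw [hpar])
    (fun e _ => by rw [← hpos, f1.2.2.2.1, hX]) (fun e _ => by rw [← hpos, f1.2.2.2.2.1, hY])
    hXn hYn (by omega) (fun e he => (hLc e he).1) (fun e he => (hLc e he).2)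
    (fun u => by rw [f1.2.2.2.2.2.2.2, ir1])).fr
  rw [f1.2.2.2.2.2.2.1] at hV
  obtain ⟨s3, t3, x3, b3, hS, F3⟩ := (sumProg_ok (W := W) (n := n) (par := par) (s := s2)
    (by rw [F2.wreg 0 (by decide), f1.1]) (by omega) (by omega) Ly.par_lt
    (fun i _ => by rw [F2.warr 15 (by decide), hpar])).fr
  obtain ⟨s4, t4, x4, b4, ⟨hF, k16, k20, k19, k18⟩, F4⟩ := (build_ok (W := W) (n := n) (k := k)
    (s := s3) (by rw [F3.wreg 0 (by decide), F2.wreg 0 (by decide), f1.1]) (by omega) w2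
    (by rw [hk, hL]) (by
      rw [F3.warr 22 (by decide), F2.warr 22 (by decide), f1.2.2.2.2.2.1]
      funext u; exact iz 22 u (by omega))).fr
  have g : ∀ a ∈ [17, 18, 19], s4.warr a = s2.warr a := by
    intro a ha
    rw [F4.warr a (by revert a; decide), F3.warr a (by revert a; decide)]
  have g' : ∀ a ∈ [14, 15, 16], s4.warr a = s1.warr a := by
    intro a ha
    rw [F4.warr a (by revert a; decide), F3.warr a (by revert a; decide),
      F2.warr a (by revert a; decide)]
  have r0 : s4.rarr 0 = s0.rarr 0 := by
    rw [F4.rarr 0 (by decide), F3.rarr 0 (by decide), F2.rarr 0 (by decide), f1.2.2.2.2.2.2.1]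
  have q : ∀ x ∈ [0, 1, 30], s4.wreg x = s1.wreg x := by
    intro x hx
    rw [F4.wreg x (by revert x; decide), F3.wreg x (by revert x; decide),
      F2.wreg x (by revert x; decide)]
  obtain ⟨s5, t5, x5, b5, ⟨hF5, h18⟩, F5⟩ := (contribsProg_ok (W := W) hF Ly hB
    (by rw [q 1 (by decide), f1.2.1]) (fun i _ => by rw [g' 14 (by decide), hhead])
    (fun i _ => by rw [g' 15 (by decide), hpar]) hnk k16 (by omega) k20 k19
    (fun e he => by
      rw [g 17 (by decide), g 18 (by decide), g 19 (by decide)]; exact hE e he)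
    hXn hYn (fun e he => (hLc e he).1) (by omega) (by rw [k18, ← hk]; exact w3)).fr
  rw [r0] at hF5
  have nw : ∀ x ∈ [0, 1, 16, 19, 20, 30], x ∉ contribsProg.ww := by decide
  have na : ∀ x ∈ [15, 16], x ∉ contribsProg.wa := by decide
  have nr : 1 ∉ contribsProg.ra := by decide
  obtain ⟨Φ, hΦ, hFP⟩ := hF5.forestP
  obtain ⟨P, hPd⟩ : ∃ P, P = s3.rarr 1 := ⟨_, rfl⟩
  obtain ⟨f, hf⟩ : ∃ f : ℕ → ℕ → ℝ, f = fun u w => 0 + ∑ e ∈ Finset.range m,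
    -2 * s0.rarr 0 e * pathDiff (X e) (Y e) (Lc e) u * pathInd par (X e) (Y e) (Lc e) w := ⟨_, rfl⟩
  rw [← hPd, ← hf] at hFP
  rw [← hPd] at hS
  -- Both `P` and the mixed term arise as subtree sums of `pathDiff`, the latter with `w` fixed.
  -- Turning `pathDiff` into `pathInd` yields the formula of `cutValue_side`.
  have hval : ∀ v < n, ∀ w < n, P v + (P w + subSum par n f v w) =
      G.cutValue (side n pos par v w) := by
    intro v hv w hw
    have hPs : ∀ u < n, P u = ∑ e ∈ Finset.range m, s0.rarr 0 e * pathInd par (X e) (Y e) (Lc e) u := by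
      intro u hu
      rw [hS u hu, show s2.rarr 1 = _ from funext hV, subSum_sum]
      refine Finset.sum_congr rfl fun e he => ?_
      rw [Finset.mem_range] at he
      rw [subSum_pathDiff (hXn e he) (hYn e he) (hLc e he).1]
    rw [cutValue_side ir0 (fun e => by rw [hX, ia0]) (fun e => by rw [hY, ia1])
      (fun e he => (hLc e he).2), ← hPs v hv, ← hPs w hw, subSum_apply, hf]
    congr 2
    simp only [zero_add]
    rw [show (fun v => ∑ e ∈ Finset.range m, -2 * s0.rarr 0 e * pathDiff (X e) (Y e) (Lc e) v *
      pathInd par (X e) (Y e) (Lc e) w) = fun v => ∑ e ∈ Finset.range m,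
      (-2 * s0.rarr 0 e * pathInd par (X e) (Y e) (Lc e) w) * pathDiff (X e) (Y e) (Lc e) v from
      funext fun v => Finset.sum_congr rfl fun e _ => by ring, subSum_sum]
    refine Finset.sum_congr rfl fun e he => ?_
    rw [Finset.mem_range] at he
    rw [subSum_pathDiff (hXn e he) (hYn e he) (hLc e he).1]
    ring
  obtain ⟨s6, t6, x6, b6, hBI, F6⟩ := (mainLoop_ok (W := W) (P := P) (par := par)
    (val := fun v w => P v + (P w + subSum par n f v w)) hFP
    (by rw [F5.wreg 0 (nw 0 (by decide)), q 0 (by decide), f1.1]) hn2 hnk.le Ly.par_lt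
    (fun i _ => by rw [F5.warr 15 (na 15 (by decide)), g' 15 (by decide), hpar])
    (fun i _ => by rw [F5.rarr 1 nr, F4.rarr 1 (by decide), hPd])
    (by rw [F5.wreg 30 (nw 30 (by decide)), q 30 (by decide), f1.2.2.1]) (fun _ _ => rfl)
    (by rw [F5.wreg 16 (nw 16 (by decide)), k16]) (by rw [F5.wreg 20 (nw 20 (by decide)), k20])
    (by rw [F5.wreg 19 (nw 19 (by decide)), k19]) (by rw [k18, ← hk] at h18; omega)).fr
  rcases hBI with ⟨-, h⟩ | ⟨-, ⟨hv1, hvn, hwv⟩, h5, hmin⟩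
  -- As `2 ≤ n`, the pair `(1, 0)` has been compared, so a best pair exists.
  · exact absurd ⟨le_rfl, by omega, by omega⟩ (h 1 0)
  obtain ⟨v, hv⟩ : ∃ v, v = s6.wreg 30 := ⟨_, rfl⟩
  obtain ⟨w, hw⟩ : ∃ w, w = s6.wreg 31 := ⟨_, rfl⟩
  rw [← hv] at hv1 hvn hwv h5
  rw [← hw] at hwv h5
  beta_reduce at h5 hmin
  have n0 : s6.wreg 0 = n := by
    rw [F6.wreg 0 (by decide), F5.wreg 0 (nw 0 (by decide)), q 0 (by decide), f1.1]
  have n16 : s6.warr 16 = pos := by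
    rw [F6.warr 16 (by decide), F5.warr 16 (na 16 (by decide)), g' 16 (by decide), hpos]
  obtain ⟨s7, t7, x7, b7, hM, F7⟩ := (markProg_ok (W := W) n0 (by omega) Ly.par_lt
    (fun i _ => by rw [F6.warr 15 (by decide), F5.warr 15 (na 15 (by decide)), g' 15 (by decide),
      hpar]) hv.symm hw.symm hwv).fr
  obtain ⟨s8, t8, x8, b8, hO, hr⟩ := writeProg_ok (W := W) (s := s7) (n := n)
    (by rw [F7.wreg 0 (by decide), n0]) (by omega)
    (fun i hi => by rw [F7.warr 16 (by decide), n16]; exact hP.pos_lt i hi)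
    (fun i hi => by rw [hM i hi]; split_ifs <;> omega)
  have hwn : w < n := by omega
  refine ⟨s8, _, side n pos par v w, x1.seq (x2.seq (x3.seq (x4.seq (x5.seq (x6.seq
    (x7.seq x8)))))), ?_, hP.isMin hT hvn hwv fun v' w' hv' hw' => ?_, fun u => ?_, ?_⟩
  · rw [← hL]
    refine le_trans ?_ (time_bound (n := n) (Φ := Φ) hL1 (m := m) (by omega) (by omega) ?_)
    · rw [hk] at b5 b6
      omega
    · rw [k18] at h18
      rw [hk] at h18 hΦ
      omega
  · rw [← hval v hvn w hwn, ← hval v' hv' w' (by omega), ← h5]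
    exact hmin v' w' ⟨by omega, hv', hw'⟩
  · rw [hO u u.2, F7.warr 16 (by decide), n16, hM _ (hP.pos_lt u u.2)]
    by_cases h : Anc par v (pos u) ↔ Anc par w (pos u)
    · rw [if_pos h, if_neg]; simpa [side] using h
    · rw [if_neg h, if_pos]; simpa [side] using h
  · rw [hr, F7.rreg 5 (by decide), h5, hval v hvn w hwn]

end RAM

theorem mainTheorem6 :
    ∃ (P : RAM.Prog) (K : ℕ) (C : ℝ), ∀ (n m : ℕ) (_ : 2 ≤ n) (G : WGraph n m)
      (T : Finset (Fin m)) (_ : G.IsSpanningTree T),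
      ∃ (s : RAM.State) (t : ℕ) (S : Finset (Fin n)),
        RAM.Exec ((n + m) ^ K) P (RAM.input G T) s t ∧
        (t : ℝ) ≤ C * m * (Real.log n) ^ 2 ∧
        G.IsMinRespectingCut 2 T S ∧ RAM.Outputs G s S := by
  refine ⟨RAM.minCutProg, 6, 200000, fun n m hn G T hT => ?_⟩
  obtain ⟨s, t, S, h1, h2, h3, h4⟩ := RAM.minCutProg_ok hn G hT
  exact ⟨s, t, S, h1, RAM.log_bound h2 hn, h3, h4⟩
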